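/- **Setting.** Let $(\mathcal S,\mathcal A,\mathsf P,c)$ be a finite average-cost Markov decision process with $|c(s,a)|\le\bar c$, and let $\pi$ be a policy with $\pi(a|s)>0$ for all $s,a$ whose state transition matrix $P_\pi(s,s')=\sum_a\pi(a|s)\mathsf P(s'|s,a)$ is irreducible and aperiodic. Let $\nu$ be its stationary distribution, and let $C_P>0$, $\varrho\in(0,1)$ be constants with $\max_s\|(P_\pi)^t(s,\cdot)-\nu\|_1\le C_P\varrho^t$ for all integers $t\ge0$. Put $P((s,a),(s',a'))=\mathsf P(s'|s,a)\pi(a'|s')$, $D=\mathrm{diag}(\nu(s)\pi(a|s))$, $\|x\|_D^2=x^\top Dx$ and $\rho^*=\sum_{s,a}\nu(s)\pi(a|s)c(s,a)$. Let $\Psi$ be a feature matrix with rows $\psi(s,a)\in\mathbb R^d$ ($d\ge1$), linearly independent columns, $\|\psi(s,a)\|_2\le1$ and $\mathbf 1\notin\mathrm{range}(\Psi)$. Let $B=\Psi^\top D\Psi$, $\mu=\lambda_{\min}(B)$, $\Phi=\Psi B^{-1/2}$, $M=\Phi^\top DP\Phi$, and $$1-\beta=\inf\{x^\top D(I-P)x:\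 x\in\mathrm{range}(\Psi),\ \|x\|_D=1\}.$$ Let $\theta^*$ solve $\Psi^\top D\Psi\theta=\Psi^\top DP\Psi\theta+\Psi^\top D(c-\rho^*\mathbf 1)$. Let $\bar Q^\pi=\sum_{t\ge0}P^t(c-\rho^*\mathbf 1)$ and $\bar Q^*=\bar Q^\pi+\hat b\mathbf 1$ with $\hat b\in\arg\min_b\|\bar Q^\pi+b\mathbf 1-\Psi\theta^*\|_D$. Finally put $$C_M=\frac{C_P\,\|\Psi\|_2\|I-P\|_2}{\sqrt{\min_{s,a}\nu(s)\pi(a|s)}},\qquad C_R=C_P\|\Psi\|_2,\qquad C_{\max}=\max\{C_P,C_M,C_R\}.$$ **Algorithm (VRTD).** For a sample $\xi=((s,a),(s',a'),c(s,a))$ put $\tilde g(\theta,\rho,\xi)=(\langle\psi(s,a)-\psi(s',a'),\theta\rangle-c(s,a)+\rho)\,\psi(s,a)$. All samples are taken consecutively from one trajectory of state-action pairs of the chain $P$ (with any initial distribution). Start with $\hat\theta_0=\theta^0$. In epoch $k=1,\dots,K$ set $\theta_1=\tilde\theta=\hat\theta_{k-1}$. Collect $N_k'$ state-action samples, each the last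 of $\tau'+1$ successive ones, and let $\hat\rho_k=\tilde\rho$ be the average of their costs. Collect $N_k$ samples $\xi_i$, each the last of $\tau'+1$ successive ones, and put $\hat g=\frac1{N_k}\sum_i\tilde g(\tilde\theta,\tilde\rho,\xi_i)$. For $t=1,\dots,T$ collect a sample $\xi_t$, the last of $\tau+1$ successive ones, and put $\theta_{t+1}=\theta_t-\eta\big(\tilde g(\theta_t,\tilde\rho,\xi_t)-\tilde g(\tilde\theta,\tilde\rho,\xi_t)+\hat g\big)$. Output $\hat\theta_k=\frac1T\sum_{t=1}^T\theta_t$. **Theorem.** Let $K,N,N'$ be positive integers. Assume for all $k\in\{1,\dots,K\}$ $$0<\eta\le\tfrac{1-\beta}{845},\quad T\ge\tfrac{64}{\mu(1-\beta)\eta},\quad N_k\ge\max\big\{\tfrac{1160}{\mu(1-\beta)^2},(\tfrac34)^{K-k}N\big\},\quad N_k'\ge(\tfrac34)^{K-k}N',$$ $$\varrho^{\tau}\le\frac{\sqrt\mu\,\eta}{C_M},\qquad \varrho^{\tau'}\le\min\Big\{\frac{\min_{s,a}\nu(s)\pi(a|s)}{C_P},\frac1{4C_{\max}+1}\Big\}.$$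 Then $$\mathbb E[(\hat\rho_K-\rho^*)^2]\le\frac{5\bar c^2}{N'},$$ $$\mathbb E\|\Psi\hat\theta_K-\Psi\theta^*\|_D^2\le\frac1{2^K}\|\Psi\theta^0-\Psi\theta^*\|_D^2+\frac{3W_1}{N}+\frac{108\,\bar c^2}{N'(1-\beta)^2\mu}+\frac{3\bar c^2}{4N'},$$ where $$W_1=22\,\mathrm{trace}\{(I_d-M)^{-1}\bar\Sigma(I_d-M)^{-\top}\}+\frac{4}{\mu(1-\beta)^2}\|\bar Q^*-\Psi\theta^*\|_D^2,$$ $$\bar\Sigma=\mathrm{cov}\big[B^{-1/2}\big(\langle\psi(s,a)-\psi(s',a'),\theta^*\rangle-c(s,a)+\rho^*\big)\psi(s,a)\big]$$ for $s\sim\nu$, $a\sim\pi(\cdot|s)$, $s'\sim\mathsf P(\cdot|s,a)$, $a'\sim\pi(\cdot|s')$. -/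

import Mathlib

noncomputable section

namespace AvgMDP

/-- A finite average-cost Markov decision process with state space `S` and action space `A`.
The cost `cost s a` is the overall cost (it already contains a possible regularizer). -/
structure MDP (S A : Type*) [Fintype S] where
  /-- `trans s a s'` is the probability of moving to `s'` when action `a` is taken in `s`. -/
  trans : S → A → S → ℝ
  trans_mem : ∀ s a, trans s a ∈ stdSimplex ℝ S
  cost : S → A → ℝ

/-- A randomized stationary policy; `prob s a` is the probability of action `a` in state `s`. -/
structure Policy (S A : Type*) [Fintype A] where
  prob : S → A → ℝ
  prob_mem : ∀ s, prob s ∈ stdSimplex ℝ A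

section Model

variable {S A : Type*} [Fintype S] [Fintype A]

/-- The state transition matrix induced by a policy. -/
def stateMatrix (M : MDP S A) (pol : Policy S A) : Matrix S S ℝ :=
  Matrix.of fun s s' => ∑ a, pol.prob s a * M.trans s a s'

/-- The state-action transition matrix induced by a policy. -/
def saMatrix (M : MDP S A) (pol : Policy S A) : Matrix (S × A) (S × A) ℝ :=
  Matrix.of fun x y => M.trans x.1 x.2 y.1 * pol.prob y.1 y.2

/-- The cost as a vector indexed by state-action pairs. -/
def costVec (M : MDP S A) : S × A → ℝ := fun x => M.cost x.1 x.2

/-- Aperiodicity of a transition matrix: for every state `s` the greatest common divisor of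
its return times is `1`. -/
def IsAperiodic {E : Type*} [Fintype E] [DecidableEq E] (P : Matrix E E ℝ) : Prop :=
  ∀ s, ∀ k : ℕ, (∀ t : ℕ, 0 < t → 0 < (P ^ t) s s → k ∣ t) → k = 1

/-- `ν` is a stationary distribution of the transition matrix `P`. -/
def IsStationaryDist {E : Type*} [Fintype E] (P : Matrix E E ℝ) (ν : E → ℝ) : Prop :=
  ν ∈ stdSimplex ℝ E ∧ Matrix.vecMul ν P = ν

/-- Geometric mixing of the transition matrix `P` towards `ν` with constants `CP` and `r`. -/
def GeomMixing {E : Type*} [Fintype E] [DecidableEq E] (P : Matrix E E ℝ) (ν : E → ℝ)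
    (CP r : ℝ) : Prop :=
  ∀ (t : ℕ) (s : E), ∑ s', |(P ^ t) s s' - ν s'| ≤ CP * r ^ t

/-- The state-action weights `ν(s) π(a|s)`, the diagonal of the weighting matrix `D`. -/
def saDist (pol : Policy S A) (ν : S → ℝ) : S × A → ℝ := fun x => ν x.1 * pol.prob x.1 x.2

/-- The long-run average cost `ρ* = ⟨ν, c^π⟩`. -/
def avgCost (M : MDP S A) (pol : Policy S A) (ν : S → ℝ) : ℝ :=
  ∑ s, ν s * ∑ a, pol.prob s a * M.cost s a

/-- The basic differential action-value function
`∑ t, E[c(s_t, a_t) - ρ* | s_0 = s, a_0 = a]`. -/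
def basicQ [DecidableEq S] [DecidableEq A] (M : MDP S A) (pol : Policy S A) (ν : S → ℝ) :
    S × A → ℝ :=
  fun x => ∑' t : ℕ,
    ((saMatrix M pol ^ t).mulVec fun y => costVec M y - avgCost M pol ν) x

/-- `X` is a trajectory of the Markov chain with transition matrix `P` and an arbitrary initial
distribution. -/
structure IsTrajectory {E Ω : Type*} [MeasurableSpace Ω] (P : Matrix E E ℝ)
    (X : ℕ → Ω → E) (ℙ : MeasureTheory.Measure Ω) : Prop where
  measurable : ∀ (n : ℕ) (x : E), MeasurableSet (X n ⁻¹' {x})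
  markov : ∀ (n : ℕ) (x : ℕ → E),
    ℙ.real {ω | ∀ i ≤ n + 1, X i ω = x i} =
      ℙ.real {ω | ∀ i ≤ n, X i ω = x i} * P (x n) (x (n + 1))

end Model

section LinearApprox

/- Below `E` is the set of state-action pairs, `D` the vector of diagonal weights, `P` the
state-action transition matrix and `Ψ` the feature matrix, whose rows are the feature vectors
`ψ(s,a)` and whose columns are the basis vectors `ψ_1, …, ψ_d`. -/

variable {E : Type*} [Fintype E] {d : ℕ}

/-- The squared weighted norm `‖x‖_D²`. -/
def normSqD (D : E → ℝ) (x : E → ℝ) : ℝ := ∑ e, D e * x e ^ 2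

open scoped Matrix.Norms.L2Operator in
/-- The spectral norm of a matrix. -/
def specNorm {m n : Type*} [Fintype m] [Fintype n] [DecidableEq n] (B : Matrix m n ℝ) : ℝ := ‖B‖

/-- The subspace spanned by the basis vectors. -/
def featureSpan (Ψ : Matrix E (Fin d) ℝ) : Submodule ℝ (E → ℝ) :=
  Submodule.span ℝ (Set.range fun j => fun e => Ψ e j)

/-- `θ` solves the projected Bellman equation
`Ψᵀ D Ψ θ = Ψᵀ D P Ψ θ + Ψᵀ D (c - ρ 1)`. -/
def ProjectedBellman [DecidableEq E] (D : E → ℝ) (P : Matrix E E ℝ) (Ψ : Matrix E (Fin d) ℝ)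
    (c : E → ℝ) (ρ : ℝ) (θ : Fin d → ℝ) : Prop :=
  (Ψ.transpose * Matrix.diagonal D * Ψ).mulVec θ =
    (Ψ.transpose * Matrix.diagonal D * P * Ψ).mulVec θ +
      (Ψ.transpose * Matrix.diagonal D).mulVec fun e => c e - ρ

/-- The Gram matrix `B = Ψᵀ D Ψ`. -/
def gram [DecidableEq E] (D : E → ℝ) (Ψ : Matrix E (Fin d) ℝ) : Matrix (Fin d) (Fin d) ℝ :=
  Ψ.transpose * Matrix.diagonal D * Ψ

/-- `μ`, the smallest eigenvalue of `B`. -/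
def minEig [DecidableEq E] (D : E → ℝ) (Ψ : Matrix E (Fin d) ℝ) : ℝ :=
  sInf (spectrum ℝ (gram D Ψ))

/-- `B^{-1/2}`, by functional calculus of the symmetric matrix `B`. -/
def gramInvSqrt [DecidableEq E] (D : E → ℝ) (Ψ : Matrix E (Fin d) ℝ) :
    Matrix (Fin d) (Fin d) ℝ :=
  cfc (fun x : ℝ => (Real.sqrt x)⁻¹) (gram D Ψ)

/-- The orthonormalized features `Φ = Ψ B^{-1/2}`. -/
def orthoFeatures [DecidableEq E] (D : E → ℝ) (Ψ : Matrix E (Fin d) ℝ) : Matrix E (Fin d) ℝ :=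
  Ψ * gramInvSqrt D Ψ

/-- `Φᵀ D P Φ`, the action of `P` on the projected space. -/
def projMatrix [DecidableEq E] (D : E → ℝ) (P : Matrix E E ℝ) (Ψ : Matrix E (Fin d) ℝ) :
    Matrix (Fin d) (Fin d) ℝ :=
  (orthoFeatures D Ψ).transpose * Matrix.diagonal D * P * orthoFeatures D Ψ

/-- `1 - β`, the infimum of `xᵀ D (I - P) x` over `x` in the feature space with `‖x‖_D = 1`. -/
def monoConst [DecidableEq E] (D : E → ℝ) (P : Matrix E E ℝ) (Ψ : Matrix E (Fin d) ℝ) : ℝ :=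
  sInf {r | ∃ x ∈ featureSpan Ψ, normSqD D x = 1 ∧
    r = x ⬝ᵥ (Matrix.diagonal D * (1 - P)).mulVec x}

/-- The constant `C_M = C_P ‖Ψ‖₂ ‖I - P‖₂ / √(min D)`. -/
def constCM [DecidableEq E] (D : E → ℝ) (P : Matrix E E ℝ) (Ψ : Matrix E (Fin d) ℝ) (CP : ℝ) :
    ℝ :=
  CP / Real.sqrt (⨅ e, D e) * specNorm Ψ * specNorm (1 - P)

/-- The constant `C_R = C_P ‖Ψ‖₂`. -/
def constCR (Ψ : Matrix E (Fin d) ℝ) (CP : ℝ) : ℝ := CP * specNorm Ψ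

/-- `C_max = max {C_P, C_M, C_R}`. -/
def constCmax [DecidableEq E] (D : E → ℝ) (P : Matrix E E ℝ) (Ψ : Matrix E (Fin d) ℝ) (CP : ℝ) :
    ℝ :=
  max CP (max (constCM D P Ψ CP) (constCR Ψ CP))

/-- The stochastic operator
`g̃(θ, ρ, ξ) = (⟨ψ(x) - ψ(y), θ⟩ - c(x) + ρ) ψ(x)` at the sample `ξ = (x, y, c(x))`. -/
def stochOp (Ψ : Matrix E (Fin d) ℝ) (c : E → ℝ) (θ : Fin d → ℝ) (ρ : ℝ) (x y : E) :
    Fin d → ℝ :=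
  ((Ψ x - Ψ y) ⬝ᵥ θ - c x + ρ) • Ψ x

/-- Expectation of `f (x, y)` for `x ∼ D` and `y ∼ P(x, ·)`. -/
def pairMean (D : E → ℝ) (P : Matrix E E ℝ) (f : E → E → ℝ) : ℝ :=
  ∑ x, ∑ y, D x * P x y * f x y

/-- The covariance matrix of a random vector `f (x, y)` for `x ∼ D` and `y ∼ P(x, ·)`. -/
def pairCov (D : E → ℝ) (P : Matrix E E ℝ) (f : E → E → Fin d → ℝ) : Matrix (Fin d) (Fin d) ℝ :=
  Matrix.of fun i j => pairMean D P fun x y =>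
    (f x y i - pairMean D P fun x' y' => f x' y' i) *
      (f x y j - pairMean D P fun x' y' => f x' y' j)

/-- `Σ̄`, the covariance matrix of `B^{-1/2} g̃(θ, ρ, ξ)` at stationarity. -/
def noiseCov [DecidableEq E] (D : E → ℝ) (P : Matrix E E ℝ) (Ψ : Matrix E (Fin d) ℝ)
    (c : E → ℝ) (θ : Fin d → ℝ) (ρ : ℝ) : Matrix (Fin d) (Fin d) ℝ :=
  pairCov D P fun x y => (gramInvSqrt D Ψ).mulVec (stochOp Ψ c θ ρ x y)

/-- `W₁ = 22 trace {(I - M)⁻¹ Σ̄ (I - M)⁻ᵀ} + 4 / (μ (1-β)²) ‖Q - Ψ θ‖_D²`. -/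
def constW [DecidableEq E] (D : E → ℝ) (P : Matrix E E ℝ) (Ψ : Matrix E (Fin d) ℝ)
    (c : E → ℝ) (θ : Fin d → ℝ) (ρ : ℝ) (Q : E → ℝ) : ℝ :=
  22 * ((1 - projMatrix D P Ψ)⁻¹ * noiseCov D P Ψ c θ ρ *
      ((1 - projMatrix D P Ψ)⁻¹).transpose).trace +
    4 / (minEig D Ψ * monoConst D P Ψ ^ 2) * normSqD D (Q - Ψ.mulVec θ)

end LinearApprox

section Algorithm

variable {E : Type*} {d : ℕ}

/-- Parameters of the variance-reduced temporal difference method: step size, epoch length,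
skipping lengths, and the batch sizes of the epochs `1, 2, …`
(`batch k` for the operator, `batchRho k` for the average cost). -/
structure Params where
  eta : ℝ
  T : ℕ
  tau : ℕ
  tau' : ℕ
  batch : ℕ → ℕ
  batchRho : ℕ → ℕ

/-- Number of transitions of the trajectory that epoch `k` uses. -/
def epochLength (p : Params) (k : ℕ) : ℕ :=
  (p.tau' + 1) * p.batchRho k + (p.tau' + 1) * p.batch k + (p.tau + 1) * p.T

/-- The time at which epoch `k ≥ 1` starts. -/
def epochStart (p : Params) (k : ℕ) : ℕ := ∑ j ∈ Finset.Ico 1 k, epochLength p j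

/-- The average-cost estimate of epoch `k ≥ 1` along the trajectory `x`: the mean of the cost over
`batchRho k` state-action samples, each the last one of `tau' + 1` successive ones. -/
def rhoHat (p : Params) (c : E → ℝ) (x : ℕ → E) (k : ℕ) : ℝ :=
  (1 / (p.batchRho k : ℝ)) *
    ∑ i ∈ Finset.range (p.batchRho k), c (x (epochStart p k + (p.tau' + 1) * i + p.tau'))

/-- The batch operator `ĝ(θ, ρ)` of epoch `k ≥ 1`: the mean of `g̃(θ, ρ, ξ)` over `batch k` samples
`ξ = (x_n, x_{n+1}, c(x_n))`, each the last one of `tau' + 1` successive ones. -/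
def batchOp (p : Params) (Ψ : Matrix E (Fin d) ℝ) (c : E → ℝ) (x : ℕ → E) (k : ℕ)
    (θ : Fin d → ℝ) (ρ : ℝ) : Fin d → ℝ :=
  let start := epochStart p k + (p.tau' + 1) * p.batchRho k
  (1 / (p.batch k : ℝ)) • ∑ i ∈ Finset.range (p.batch k),
    stochOp Ψ c θ ρ (x (start + (p.tau' + 1) * i + p.tau'))
      (x (start + (p.tau' + 1) * i + p.tau' + 1))

/-- The inner iterates of epoch `k ≥ 1` started at `θc`; `innerIter … t` is `θ_{t+1}`. The sample
of each step is the last one of `tau + 1` successive ones. -/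
def innerIter (p : Params) (Ψ : Matrix E (Fin d) ℝ) (c : E → ℝ) (x : ℕ → E) (k : ℕ)
    (θc : Fin d → ℝ) : ℕ → Fin d → ℝ
  | 0 => θc
  | t + 1 =>
    let ρ := rhoHat p c x k
    let θ := innerIter p Ψ c x k θc t
    let n := epochStart p k + (p.tau' + 1) * p.batchRho k + (p.tau' + 1) * p.batch k +
      (p.tau + 1) * t + p.tau
    θ - p.eta • (stochOp Ψ c θ ρ (x n) (x (n + 1)) - stochOp Ψ c θc ρ (x n) (x (n + 1)) +
      batchOp p Ψ c x k θc ρ)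

/-- The output `θ̂_k` of epoch `k` along the trajectory `x`, with `θ̂_0 = θ0`: the average of
`θ_1, …, θ_T`. -/
def thetaHat (p : Params) (Ψ : Matrix E (Fin d) ℝ) (c : E → ℝ) (θ0 : Fin d → ℝ) (x : ℕ → E) :
    ℕ → Fin d → ℝ
  | 0 => θ0
  | k + 1 => (1 / (p.T : ℝ)) • ∑ t ∈ Finset.range p.T,
      innerIter p Ψ c x (k + 1) (thetaHat p Ψ c θ0 x k) t

end Algorithm

end AvgMDP

end

/-! Put A = Ψᵀ D (I - P) Ψ. By definition of 1 - β its quadratic form dominates (1 - β) ‖Ψ ·‖_D², so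
A is invertible. Relative to θ*, the inner loop of an epoch is a stochastic iteration whose mean
step vanishes at θ* - Δ, where Δ is A⁻¹ applied to the error of the batch operator (`innerIter_eq`).
The error of an epoch thus splits into the deviation of the iterates from that shifted point and the
shift Δ itself.

Deviation (`sum_innerDev_le`). Variance reduction makes the noise of a step linear in the current
and the initial deviation, so no additive variance remains, and averaging over the loop divides the
mean square by 20. The difficulty is Markovian sampling: the state-action chain mixes one step later
than the state chain, so the τ steps between the current iterate and its sample only give ϱ^(τ-1).
Each step is therefore conditioned on the iterate before the previous step, at lag 2τ + 1
(`inner_step_le`). The exchange costs terms of order η² in the previous direction, whose second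
moment obeys a recursion of its own (`sum_le_of_inner_recursion`).

Shift. The batch error is a mean of centred noises plus (ρ̂ - ρ*) times a mean feature
(`batchErr_eq`). In the second moment of the noise sum (`sum_noise_featSq_le`), diagonal terms are
compared with stationarity through a density bound 2, adjacent pairs are handled by Young's
inequality, and distant pairs by the conditional bias of the later noise. By the Poisson equation
for Q̄* that bias is p - D paired with the features and (I - P)(Ψθ - Q̄*), which brings in ‖Q̄* -
Ψθ*‖_D. The stationary mean of ‖Ψ A⁻¹ g̃(θ*, ρ*, ξ)‖_D² is the trace in W₁ (`trace_noiseCov`). The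
cost estimate is treated by the same correlation argument (`sum_cost_sq_le`).

Together these halve the error per epoch up to W₁ / N_k + 36 c̄² / ((1 - β)² μ N_k') (`epoch_le`),
and the geometric growth of the batches lets the recursion sum with factor 3
(`le_of_epoch_recursion`). -/

noncomputable section

set_option linter.unusedSectionVars false

namespace AvgMDP

/-! ### The Markov property as an identity between expectations of path functionals. -/

section PathExpectation

open MeasureTheory

variable {E Ω : Type*} [MeasurableSpace Ω]

/-- The expectation of a functional of the trajectory. -/
def pathMean (ℙ : Measure Ω) (X : ℕ → Ω → E) (F : (ℕ → E) → ℝ) : ℝ :=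
  ∫ ω, F (fun n => X n ω) ∂ℙ

/-- `F` is a function of the first `n + 1` points of the path. -/
abbrev Adapted {β : Type*} (n : ℕ) (F : (ℕ → E) → β) : Prop := DependsOn F (Set.Iic n)

lemma Adapted.mono' {β : Type*} {n m : ℕ} {F : (ℕ → E) → β} (h : Adapted n F) (hnm : n ≤ m) :
    Adapted m F :=
  h.mono (Set.Iic_subset_Iic.2 hnm)

lemma adapted_const {β : Type*} (n : ℕ) (b : β) : Adapted n (fun _ : ℕ → E => b) :=
  fun _ _ _ => rfl

lemma adapted_coord {n m : ℕ} (h : m ≤ n) : Adapted n (fun x : ℕ → E => x m) :=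
  fun _ _ hxy => hxy m h

lemma Adapted.comp {β γ : Type*} {n : ℕ} {F : (ℕ → E) → β} (h : Adapted n F) (g : β → γ) :
    Adapted n (fun x => g (F x)) :=
  fun _ _ hxy => congrArg g (h hxy)

lemma Adapted.comp₂ {β γ δ : Type*} {n : ℕ} {F : (ℕ → E) → β} {G : (ℕ → E) → γ}
    (hF : Adapted n F) (hG : Adapted n G) (g : β → γ → δ) :
    Adapted n (fun x => g (F x) (G x)) := by
  intro x y hxy
  simp only [hF hxy, hG hxy]

lemma Adapted.comp₃ {β γ δ ε : Type*} {n : ℕ} {F : (ℕ → E) → β} {G : (ℕ → E) → γ}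
    {H : (ℕ → E) → δ} (hF : Adapted n F) (hG : Adapted n G) (hH : Adapted n H)
    (g : β → γ → δ → ε) : Adapted n (fun x => g (F x) (G x) (H x)) := by
  intro x y hxy
  simp only [hF hxy, hG hxy, hH hxy]

lemma adapted_sum {ι β : Type*} [AddCommMonoid β] {n : ℕ} {s : Finset ι} {F : ι → (ℕ → E) → β}
    (h : ∀ i ∈ s, Adapted n (F i)) : Adapted n (fun x => ∑ i ∈ s, F i x) :=
  fun _ _ hxy => Finset.sum_congr rfl fun i hi => h i hi hxy

variable [Fintype E] {ℙ : Measure Ω} [IsProbabilityMeasure ℙ] {P : Matrix E E ℝ}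
  {X : ℕ → Ω → E} (hX : IsTrajectory P X ℙ)

/-- The path that follows `a` up to time `n` and stays where it is afterwards. -/
def extendPath {n : ℕ} (a : Fin (n + 1) → E) : ℕ → E :=
  fun i => a ⟨min i n, Nat.lt_succ_of_le (min_le_right i n)⟩

/-- Reduces adapted functionals to functions on the finite set of prefixes, so that integrals become
finite sums over prefix events. -/
lemma Adapted.eq_extendPath {β : Type*} {n : ℕ} {F : (ℕ → E) → β} (h : Adapted n F) (x : ℕ → E) :
    F x = F (extendPath fun i : Fin (n + 1) => x i) := by
  apply h
  intro i hi
  simp [extendPath, min_eq_left (Set.mem_Iic.1 hi)]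

include hX in
lemma IsTrajectory.measurableSet_prefix {n : ℕ} (a : Fin (n + 1) → E) :
    MeasurableSet {ω | (fun i : Fin (n + 1) => X i ω) = a} := by
  have : {ω | (fun i : Fin (n + 1) => X i ω) = a} = ⋂ i : Fin (n + 1), X i ⁻¹' {a i} := by
    ext ω
    simp [funext_iff]
  rw [this]
  exact MeasurableSet.iInter fun i => hX.measurable i (a i)

include hX in
-- An adapted functional takes finitely many values, each on a union of measurable prefix events. No
-- regularity of F on path space is needed.
lemma IsTrajectory.integrable {n : ℕ} {F : (ℕ → E) → ℝ} (hF : Adapted n F) :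
    Integrable (fun ω => F fun n => X n ω) ℙ := by
  classical
  have : (fun ω => F fun n => X n ω) = fun ω => ∑ a : Fin (n + 1) → E,
      Set.indicator {ω | (fun i : Fin (n + 1) => X i ω) = a} (fun _ => F (extendPath a)) ω := by
    funext ω
    rw [Finset.sum_eq_single (fun i : Fin (n + 1) => X i ω)]
    · simp only [Set.indicator, Set.mem_ofPred_eq, if_true]
      exact hF.eq_extendPath _
    · intro b _ hb
      simp [Set.indicator, Ne.symm hb]
    · simp
  rw [this]
  exact integrable_finsetSum _ fun a _ =>
    (integrable_const _).indicator (hX.measurableSet_prefix a)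

include hX in
lemma IsTrajectory.pathMean_mono {n : ℕ} {F G : (ℕ → E) → ℝ} (hF : Adapted n F)
    (hG : Adapted n G) (h : ∀ x, F x ≤ G x) : pathMean ℙ X F ≤ pathMean ℙ X G :=
  integral_mono (hX.integrable hF) (hX.integrable hG) fun _ => h _

lemma pathMean_nonneg {F : (ℕ → E) → ℝ} (h : ∀ x, 0 ≤ F x) : 0 ≤ pathMean ℙ X F :=
  integral_nonneg fun _ => h _

include hX in
lemma IsTrajectory.pathMean_add {n : ℕ} {F G : (ℕ → E) → ℝ} (hF : Adapted n F)
    (hG : Adapted n G) :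
    pathMean ℙ X (fun x => F x + G x) = pathMean ℙ X F + pathMean ℙ X G :=
  integral_add (hX.integrable hF) (hX.integrable hG)

lemma pathMean_mul_left (c : ℝ) (F : (ℕ → E) → ℝ) :
    pathMean ℙ X (fun x => c * F x) = c * pathMean ℙ X F :=
  integral_const_mul _ _

lemma pathMean_const (c : ℝ) : pathMean ℙ X (fun _ => c) = c := by
  simp [pathMean]

include hX in
lemma IsTrajectory.pathMean_sum {ι : Type*} {s : Finset ι} {n : ℕ} {F : ι → (ℕ → E) → ℝ}
    (hF : ∀ i ∈ s, Adapted n (F i)) :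
    pathMean ℙ X (fun x => ∑ i ∈ s, F i x) = ∑ i ∈ s, pathMean ℙ X (F i) :=
  integral_finsetSum _ fun i hi => hX.integrable (hF i hi)

include hX in
/-- The Markov property in expectation, one step ahead. -/
lemma IsTrajectory.pathMean_succ {n : ℕ} {G : (ℕ → E) → E → ℝ}
    (hG : ∀ y, Adapted n fun x => G x y) :
    pathMean ℙ X (fun x => G x (x (n + 1))) =
      pathMean ℙ X (fun x => ∑ y, P (x n) y * G x y) := by
  classical
  have key : ∀ (a : Fin (n + 1) → E) (y : E),
      ℙ.real ({ω | (fun i : Fin (n + 1) => X i ω) = a} ∩ X (n + 1) ⁻¹' {y}) =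
        ℙ.real {ω | (fun i : Fin (n + 1) => X i ω) = a} * P (a (Fin.last n)) y := by
    intro a y
    -- The test path follows the prefix up to time n and takes the value y afterwards, so the two
    -- cylinder events are the prefix event with and without the next point.
    have h := hX.markov n (fun i => if i ≤ n then extendPath a i else y)
    have e1 : {ω | ∀ i ≤ n + 1, X i ω = if i ≤ n then extendPath a i else y} =
        {ω | (fun i : Fin (n + 1) => X i ω) = a} ∩ X (n + 1) ⁻¹' {y} := by
      ext ω
      simp only [Set.mem_ofPred_eq, Set.mem_inter_iff, Set.mem_preimage, Set.mem_singleton_iff,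
        funext_iff]
      constructor
      · intro h
        refine ⟨fun i => ?_, by simpa using h (n + 1) le_rfl⟩
        have hi : (i : ℕ) ≤ n := Nat.lt_succ_iff.1 i.2
        have := h i (by omega)
        simpa [hi, extendPath] using this
      · rintro ⟨h1, h2⟩ i hi
        by_cases hin : i ≤ n
        · simpa [hin, extendPath] using h1 ⟨i, by omega⟩
        · obtain rfl : i = n + 1 := by omega
          simpa using h2
    have e2 : {ω | ∀ i ≤ n, X i ω = if i ≤ n then extendPath a i else y} =
        {ω | (fun i : Fin (n + 1) => X i ω) = a} := by
      ext ω
      simp only [Set.mem_ofPred_eq, funext_iff]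
      constructor
      · intro h i
        have hi : (i : ℕ) ≤ n := Nat.lt_succ_iff.1 i.2
        simpa [hi, extendPath] using h i hi
      · intro h i hi
        simpa [hi, extendPath] using h ⟨i, by omega⟩
    rw [e1, e2] at h
    rw [h]
    simp [extendPath, Fin.last]
  have split : ∀ F : E → (ℕ → E) → ℝ, (∀ y, Adapted n (F y)) → ∀ y,
      ∫ ω, (X (n + 1) ⁻¹' {y}).indicator (fun ω => F y fun n => X n ω) ω ∂ℙ =
        ∫ ω, P (X n ω) y * F y (fun n => X n ω) ∂ℙ := by
    intro F hF y
    have h1 : ∀ ω, (X (n + 1) ⁻¹' {y}).indicator (fun ω => F y fun n => X n ω) ω =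
        ∑ a : Fin (n + 1) → E,
          ({ω | (fun i : Fin (n + 1) => X i ω) = a} ∩ X (n + 1) ⁻¹' {y}).indicator
            (fun _ => F y (extendPath a)) ω := by
      intro ω
      rw [Finset.sum_eq_single (fun i : Fin (n + 1) => X i ω)]
      · simp only [Set.indicator, Set.mem_inter_iff, Set.mem_ofPred_eq, true_and]
        rw [(hF y).eq_extendPath]
      · intro b _ hb
        simp [Set.indicator, Ne.symm hb]
      · simp
    have h2 : ∀ ω, P (X n ω) y * F y (fun n => X n ω) =
        ∑ a : Fin (n + 1) → E,
          ({ω | (fun i : Fin (n + 1) => X i ω) = a}).indicator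
            (fun _ => P (a (Fin.last n)) y * F y (extendPath a)) ω := by
      intro ω
      rw [Finset.sum_eq_single (fun i : Fin (n + 1) => X i ω)]
      · simp only [Set.indicator, Set.mem_ofPred_eq, if_true]
        rw [(hF y).eq_extendPath]
        simp
      · intro b _ hb
        simp [Set.indicator, Ne.symm hb]
      · simp
    simp_rw [h1, h2]
    have hm := fun a : Fin (n + 1) → E => hX.measurableSet_prefix a
    have hm' := hX.measurable (n + 1) y
    rw [integral_finsetSum _ fun a _ => (integrable_const _).indicator ((hm a).inter hm'),
      integral_finsetSum _ fun a _ => (integrable_const _).indicator (hm a)]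
    refine Finset.sum_congr rfl fun a _ => ?_
    rw [integral_indicator_const _ ((hm a).inter hm'), integral_indicator_const _ (hm a), key]
    simp only [smul_eq_mul]
    ring
  have hdecomp : ∀ ω, G (fun n => X n ω) (X (n + 1) ω) =
      ∑ y, (X (n + 1) ⁻¹' {y}).indicator (fun ω => G (fun n => X n ω) y) ω := by
    intro ω
    rw [Finset.sum_eq_single (X (n + 1) ω)]
    · simp [Set.indicator]
    · intro b _ hb
      simp [Set.indicator, Ne.symm hb]
    · simp
  unfold pathMean
  simp_rw [hdecomp]
  rw [integral_finsetSum _ fun y _ => (hX.integrable (hG y)).indicator (hX.measurable _ y),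
    integral_finsetSum _ fun y _ => hX.integrable
      (F := fun x => P (x n) y * G x y) ((adapted_coord le_rfl).comp₂ (hG y) fun e r => P e y * r)]
  exact Finset.sum_congr rfl fun y _ => split (fun y x => G x y) hG y

include hX in
/-- The Markov property in expectation, `m` steps ahead. -/
lemma IsTrajectory.pathMean_lag [DecidableEq E] {n : ℕ} (m : ℕ) {G : (ℕ → E) → E → ℝ}
    (hG : ∀ y, Adapted n fun x => G x y) :
    pathMean ℙ X (fun x => G x (x (n + m))) =
      pathMean ℙ X (fun x => ∑ y, (P ^ m) (x n) y * G x y) := by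
  induction m generalizing G with
  | zero =>
    simp [Matrix.one_apply]
  | succ m ih =>
    -- The last step is averaged out first. What remains is a new function of x (n + m), which is
    -- why the induction generalizes G.
    rw [← add_assoc, hX.pathMean_succ (n := n + m) fun y => (hG y).mono' (Nat.le_add_right n m),
      ih (G := fun x z => ∑ y, P z y * G x y) fun z => adapted_sum fun y _ =>
        (hG y).comp fun r => P z y * r]
    congr 1
    funext x
    simp_rw [pow_succ, Matrix.mul_apply, Finset.mul_sum, Finset.sum_mul]
    rw [Finset.sum_comm]
    simp_rw [mul_assoc]

include hX in
/-- The Markov property in expectation for a pair of successive points. -/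
lemma IsTrajectory.pathMean_pair [DecidableEq E] {n : ℕ} (m : ℕ) {G : (ℕ → E) → E → E → ℝ}
    (hG : ∀ y z, Adapted n fun x => G x y z) :
    pathMean ℙ X (fun x => G x (x (n + m)) (x (n + m + 1))) =
      pathMean ℙ X (fun x => pairMean ((P ^ m) (x n)) P (G x)) := by
  have hG' : ∀ z, Adapted (n + m) fun x => G x (x (n + m)) z := by
    intro z x y hxy
    have h1 : x (n + m) = y (n + m) := hxy _ (by simp)
    simp only [h1]
    exact hG _ z fun i hi => hxy i (Set.mem_Iic.2 ((Set.mem_Iic.1 hi).trans (Nat.le_add_right n m)))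
  rw [hX.pathMean_succ (G := fun x z => G x (x (n + m)) z) hG',
    hX.pathMean_lag m (G := fun x y => ∑ z, P y z * G x y z) fun y => adapted_sum fun z _ =>
      (hG y z).comp fun r => P y z * r]
  congr 1
  funext x
  simp only [pairMean, Finset.mul_sum, mul_assoc]

end PathExpectation

/-! ### Weighted norms, Young inequalities, and moments of the sampled operator at stationarity. -/

section Deterministic

open Matrix

variable {E : Type*} [Fintype E] {d : ℕ}

/-- `D` is a positive probability vector which is stationary for the stochastic matrix `P`. -/
structure StationaryChain (D : E → ℝ) (P : Matrix E E ℝ) : Prop where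
  pos : ∀ x, 0 < D x
  sum_eq : ∑ x, D x = 1
  nonneg : ∀ x y, 0 ≤ P x y
  row : ∀ x, ∑ y, P x y = 1
  stat : ∀ y, ∑ x, D x * P x y = D y

/-- `A = Ψᵀ D (I - P) Ψ`. -/
def opMatrix [DecidableEq E] (D : E → ℝ) (P : Matrix E E ℝ) (Ψ : Matrix E (Fin d) ℝ) :
    Matrix (Fin d) (Fin d) ℝ :=
  Ψ.transpose * Matrix.diagonal D * (1 - P) * Ψ

/-- The sample version of `A`. -/
def sampleOp (Ψ : Matrix E (Fin d) ℝ) (x y : E) (v : Fin d → ℝ) : Fin d → ℝ :=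
  ((Ψ x - Ψ y) ⬝ᵥ v) • Ψ x

/-- `‖Ψ v‖_D²`. -/
def featSq (D : E → ℝ) (Ψ : Matrix E (Fin d) ℝ) (v : Fin d → ℝ) : ℝ := normSqD D (Ψ.mulVec v)

section PairMean

variable {p : E → ℝ} {P : Matrix E E ℝ}

lemma pairMean_add (f g : E → E → ℝ) :
    pairMean p P (fun x y => f x y + g x y) = pairMean p P f + pairMean p P g := by
  simp only [pairMean, mul_add, Finset.sum_add_distrib]

lemma pairMean_sub (f g : E → E → ℝ) :
    pairMean p P (fun x y => f x y - g x y) = pairMean p P f - pairMean p P g := by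
  simp only [pairMean, mul_sub, Finset.sum_sub_distrib]

lemma pairMean_mul_left (c : ℝ) (f : E → E → ℝ) :
    pairMean p P (fun x y => c * f x y) = c * pairMean p P f := by
  simp only [pairMean, Finset.mul_sum]
  exact Finset.sum_congr rfl fun x _ => Finset.sum_congr rfl fun y _ => by ring

lemma pairMean_sum {ι : Type*} (s : Finset ι) (f : ι → E → E → ℝ) :
    pairMean p P (fun x y => ∑ i ∈ s, f i x y) = ∑ i ∈ s, pairMean p P (f i) := by
  simp only [pairMean, Finset.mul_sum]
  refine (Finset.sum_congr rfl fun x _ => Finset.sum_comm).trans Finset.sum_comm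

lemma pairMean_mono {f g : E → E → ℝ} (hp : ∀ x, 0 ≤ p x) (hP : ∀ x y, 0 ≤ P x y)
    (h : ∀ x y, f x y ≤ g x y) : pairMean p P f ≤ pairMean p P g :=
  Finset.sum_le_sum fun x _ => Finset.sum_le_sum fun y _ =>
    mul_le_mul_of_nonneg_left (h x y) (mul_nonneg (hp x) (hP x y))

lemma pairMean_nonneg {f : E → E → ℝ} (hp : ∀ x, 0 ≤ p x) (hP : ∀ x y, 0 ≤ P x y)
    (h : ∀ x y, 0 ≤ f x y) : 0 ≤ pairMean p P f :=
  Finset.sum_nonneg fun x _ => Finset.sum_nonneg fun y _ =>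
    mul_nonneg (mul_nonneg (hp x) (hP x y)) (h x y)

lemma pairMean_fst (hP : ∀ x, ∑ y, P x y = 1) (f : E → ℝ) :
    pairMean p P (fun x _ => f x) = ∑ x, p x * f x := by
  refine Finset.sum_congr rfl fun x _ => ?_
  rw [← Finset.sum_mul, ← Finset.mul_sum, hP, mul_one]

lemma pairMean_snd (f : E → ℝ) :
    pairMean p P (fun _ y => f y) = ∑ y, (∑ x, p x * P x y) * f y := by
  simp only [pairMean, Finset.sum_mul]
  exact Finset.sum_comm

lemma pairMean_const (hp : ∑ x, p x = 1) (hP : ∀ x, ∑ y, P x y = 1) (c : ℝ) :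
    pairMean p P (fun _ _ => c) = c := by
  rw [pairMean_fst hP (fun _ => c), ← Finset.sum_mul, hp, one_mul]

/-- Transfers second moments from stationarity to a law of bounded density; applied with C = 2 after
at least τ' + 1 steps of the chain. -/
lemma pairMean_le_mul {q : E → ℝ} {f : E → E → ℝ} {C : ℝ} (hP : ∀ x y, 0 ≤ P x y)
    (hpq : ∀ x, p x ≤ C * q x) (hf : ∀ x y, 0 ≤ f x y) :
    pairMean p P f ≤ C * pairMean q P f := by
  simp only [pairMean, Finset.mul_sum]
  refine Finset.sum_le_sum fun x _ => Finset.sum_le_sum fun y _ => ?_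
  calc p x * P x y * f x y ≤ (C * q x) * P x y * f x y :=
        mul_le_mul_of_nonneg_right (mul_le_mul_of_nonneg_right (hpq x) (hP x y)) (hf x y)
    _ = _ := by ring

end PairMean

lemma normSqD_nonneg {D : E → ℝ} (hD : ∀ x, 0 < D x) (f : E → ℝ) : 0 ≤ normSqD D f :=
  Finset.sum_nonneg fun x _ => mul_nonneg (hD x).le (sq_nonneg _)

lemma featSq_nonneg {D : E → ℝ} (hD : ∀ x, 0 < D x) (Ψ : Matrix E (Fin d) ℝ) (v : Fin d → ℝ) :
    0 ≤ featSq D Ψ v := normSqD_nonneg hD _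

lemma dotProduct_self_nonneg' {n : Type*} [Fintype n] (v : n → ℝ) : 0 ≤ v ⬝ᵥ v :=
  Finset.sum_nonneg fun i _ => mul_self_nonneg (v i)

lemma sq_dotProduct_le {n : Type*} [Fintype n] (v w : n → ℝ) :
    (v ⬝ᵥ w) ^ 2 ≤ (v ⬝ᵥ v) * (w ⬝ᵥ w) := by
  have := Finset.sum_mul_sq_le_sq_mul_sq Finset.univ v w
  simpa [dotProduct, sq] using this

lemma dotProduct_le_of_pos {n : Type*} [Fintype n] (v w : n → ℝ) {c : ℝ} (hc : 0 < c) :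
    2 * |v ⬝ᵥ w| ≤ c * (v ⬝ᵥ v) + (1 / c) * (w ⬝ᵥ w) := by
  have h := sq_dotProduct_le v w
  have hv := dotProduct_self_nonneg' v
  have hw := dotProduct_self_nonneg' w
  rw [← sq_abs] at h
  have h2 : (2 * |v ⬝ᵥ w|) ^ 2 ≤ (c * (v ⬝ᵥ v) + (1 / c) * (w ⬝ᵥ w)) ^ 2 := by
    have : (c * (v ⬝ᵥ v) + (1 / c) * (w ⬝ᵥ w)) ^ 2 =
        (c * (v ⬝ᵥ v) - (1 / c) * (w ⬝ᵥ w)) ^ 2 + 4 * ((v ⬝ᵥ v) * (w ⬝ᵥ w)) := by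
      field_simp
      ring
    rw [this]
    nlinarith [sq_nonneg (c * (v ⬝ᵥ v) - (1 / c) * (w ⬝ᵥ w))]
  exact (abs_le_of_sq_le_sq' h2 (by positivity)).2

/-- Young's inequality for sums of squares. -/
lemma dotProduct_add_self_le {n : Type*} [Fintype n] (v w : n → ℝ) {c : ℝ} (hc : 0 < c) :
    (v + w) ⬝ᵥ (v + w) ≤ (1 + c) * (v ⬝ᵥ v) + (1 + 1 / c) * (w ⬝ᵥ w) := by
  have h := dotProduct_le_of_pos v w hc
  have e : (v + w) ⬝ᵥ (v + w) = v ⬝ᵥ v + 2 * (v ⬝ᵥ w) + w ⬝ᵥ w := by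
    rw [add_dotProduct, dotProduct_add, dotProduct_add, dotProduct_comm w v]
    ring
  rw [e]
  nlinarith [le_abs_self (v ⬝ᵥ w)]

/-- Absorbing the square root of the weight into the vector carries Euclidean inequalities over to
‖Ψ ·‖_D. -/
lemma featSq_eq_dot (D : E → ℝ) (hD : ∀ x, 0 < D x) (Ψ : Matrix E (Fin d) ℝ) (v : Fin d → ℝ) :
    featSq D Ψ v =
      (fun x => √(D x) * Ψ.mulVec v x) ⬝ᵥ fun x => √(D x) * Ψ.mulVec v x := by
  refine Finset.sum_congr rfl fun x _ => ?_
  have := Real.mul_self_sqrt (hD x).le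
  linear_combination (-(Ψ.mulVec v x) ^ 2) * this

lemma featSq_add_le {D : E → ℝ} (hD : ∀ x, 0 < D x) (Ψ : Matrix E (Fin d) ℝ) (v w : Fin d → ℝ)
    {c : ℝ} (hc : 0 < c) :
    featSq D Ψ (v + w) ≤ (1 + c) * featSq D Ψ v + (1 + 1 / c) * featSq D Ψ w := by
  simp only [featSq_eq_dot D hD]
  convert dotProduct_add_self_le (fun x => √(D x) * Ψ.mulVec v x)
    (fun x => √(D x) * Ψ.mulVec w x) hc using 1
  simp only [mulVec_add]
  congr 1 <;> · funext x; simp only [Pi.add_apply]; ring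

lemma featSq_smul (D : E → ℝ) (Ψ : Matrix E (Fin d) ℝ) (c : ℝ) (v : Fin d → ℝ) :
    featSq D Ψ (c • v) = c ^ 2 * featSq D Ψ v := by
  simp only [featSq, normSqD, mulVec_smul, Pi.smul_apply, smul_eq_mul, Finset.mul_sum]
  exact Finset.sum_congr rfl fun x _ => by ring

lemma featSq_neg (D : E → ℝ) (Ψ : Matrix E (Fin d) ℝ) (v : Fin d → ℝ) :
    featSq D Ψ (-v) = featSq D Ψ v := by
  simpa using featSq_smul D Ψ (-1) v

lemma featSq_sub_le {D : E → ℝ} (hD : ∀ x, 0 < D x) (Ψ : Matrix E (Fin d) ℝ) (v w : Fin d → ℝ)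
    {c : ℝ} (hc : 0 < c) :
    featSq D Ψ (v - w) ≤ (1 + c) * featSq D Ψ v + (1 + 1 / c) * featSq D Ψ w := by
  rw [sub_eq_add_neg, ← featSq_neg D Ψ w]
  exact featSq_add_le hD Ψ v (-w) hc

lemma sum_smul_featSq_le {D : E → ℝ} (hD : ∀ x, 0 < D x) (Ψ : Matrix E (Fin d) ℝ) (T : ℕ)
    (v : ℕ → Fin d → ℝ) :
    featSq D Ψ ((1 / (T : ℝ)) • ∑ t ∈ Finset.range T, v t) ≤
      (1 / (T : ℝ)) * ∑ t ∈ Finset.range T, featSq D Ψ (v t) := by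
  rcases Nat.eq_zero_or_pos T with rfl | hT
  · simp [featSq, normSqD]
  rw [featSq_smul]
  have h : featSq D Ψ (∑ t ∈ Finset.range T, v t) ≤ T * ∑ t ∈ Finset.range T, featSq D Ψ (v t) := by
    unfold featSq normSqD
    rw [Finset.sum_comm, Finset.mul_sum]
    refine Finset.sum_le_sum fun x _ => ?_
    rw [← Finset.mul_sum, mulVec_sum]
    simp only [Finset.sum_apply]
    have := sq_sum_le_card_mul_sum_sq (s := Finset.range T) (f := fun t => (Ψ.mulVec (v t)) x)
    rw [Finset.card_range] at this
    nlinarith [hD x]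
  have hT' : (0 : ℝ) < T := by exact_mod_cast hT
  calc (1 / (T : ℝ)) ^ 2 * featSq D Ψ (∑ t ∈ Finset.range T, v t)
      ≤ (1 / (T : ℝ)) ^ 2 * (T * ∑ t ∈ Finset.range T, featSq D Ψ (v t)) := by gcongr
    _ = _ := by field_simp

variable {D : E → ℝ} {P : Matrix E E ℝ} {Ψ : Matrix E (Fin d) ℝ}

lemma sq_feature_le (hψ : ∀ x, Ψ x ⬝ᵥ Ψ x ≤ 1) (x : E) (v : Fin d → ℝ) :
    (Ψ x ⬝ᵥ v) ^ 2 ≤ v ⬝ᵥ v := by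
  have h := sq_dotProduct_le (Ψ x) v
  nlinarith [hψ x, dotProduct_self_nonneg' v]

lemma sq_feature_sub_le (hψ : ∀ x, Ψ x ⬝ᵥ Ψ x ≤ 1) (x y : E) (v : Fin d → ℝ) :
    ((Ψ x - Ψ y) ⬝ᵥ v) ^ 2 ≤ 4 * (v ⬝ᵥ v) := by
  rw [sub_dotProduct]
  nlinarith [sq_feature_le hψ x v, sq_feature_le hψ y v, sq_nonneg (Ψ x ⬝ᵥ v + Ψ y ⬝ᵥ v)]

lemma featSq_le_dot (hc : StationaryChain D P) (hψ : ∀ x, Ψ x ⬝ᵥ Ψ x ≤ 1) (v : Fin d → ℝ) :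
    featSq D Ψ v ≤ v ⬝ᵥ v := by
  calc featSq D Ψ v ≤ ∑ x, D x * (v ⬝ᵥ v) :=
        Finset.sum_le_sum fun x _ => mul_le_mul_of_nonneg_left (sq_feature_le hψ x v) (hc.pos x).le
    _ = v ⬝ᵥ v := by rw [← Finset.sum_mul, hc.sum_eq, one_mul]

lemma dot_sampleOp (x y : E) (v w : Fin d → ℝ) :
    w ⬝ᵥ sampleOp Ψ x y v = (Ψ x ⬝ᵥ w) * ((Ψ x - Ψ y) ⬝ᵥ v) := by
  rw [sampleOp, dotProduct_smul, smul_eq_mul, dotProduct_comm w, mul_comm]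

lemma sampleOp_sub (x y : E) (v w : Fin d → ℝ) :
    sampleOp Ψ x y (v - w) = sampleOp Ψ x y v - sampleOp Ψ x y w := by
  simp only [sampleOp, dotProduct_sub, sub_smul]

lemma sampleOp_smul (x y : E) (c : ℝ) (v : Fin d → ℝ) :
    sampleOp Ψ x y (c • v) = c • sampleOp Ψ x y v := by
  simp only [sampleOp, dotProduct_smul, smul_eq_mul, mul_smul]

lemma sampleOp_self_le (hψ : ∀ x, Ψ x ⬝ᵥ Ψ x ≤ 1) (x y : E) (v : Fin d → ℝ) :
    sampleOp Ψ x y v ⬝ᵥ sampleOp Ψ x y v ≤ ((Ψ x - Ψ y) ⬝ᵥ v) ^ 2 := by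
  rw [sampleOp, dotProduct_smul, smul_dotProduct, smul_eq_mul, smul_eq_mul]
  nlinarith [hψ x, sq_nonneg ((Ψ x - Ψ y) ⬝ᵥ v)]

lemma sampleOp_self_le' (hψ : ∀ x, Ψ x ⬝ᵥ Ψ x ≤ 1) (x y : E) (v : Fin d → ℝ) :
    sampleOp Ψ x y v ⬝ᵥ sampleOp Ψ x y v ≤ 4 * (v ⬝ᵥ v) :=
  (sampleOp_self_le hψ x y v).trans (sq_feature_sub_le hψ x y v)

lemma sum_row_mul_sub (hrow : ∀ x, ∑ y, P x y = 1) [DecidableEq E] (f : E → ℝ) (x : E) :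
    ∑ y, P x y * (f x - f y) = ((1 - P).mulVec f) x := by
  simp only [mul_sub, Finset.sum_sub_distrib, ← Finset.sum_mul, hrow, one_mul, sub_mulVec,
    one_mulVec, Pi.sub_apply]
  rfl

lemma pairMean_feature (hrow : ∀ x, ∑ y, P x y = 1) [DecidableEq E] (p : E → ℝ)
    (v w : Fin d → ℝ) :
    pairMean p P (fun x y => w ⬝ᵥ sampleOp Ψ x y v) =
      ∑ x, p x * (Ψ x ⬝ᵥ w) * ((1 - P).mulVec (Ψ.mulVec v)) x := by
  refine Finset.sum_congr rfl fun x _ => ?_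
  rw [← sum_row_mul_sub hrow, Finset.mul_sum]
  refine Finset.sum_congr rfl fun y _ => ?_
  change p x * P x y * (w ⬝ᵥ sampleOp Ψ x y v) =
    p x * (Ψ x ⬝ᵥ w) * (P x y * (Ψ x ⬝ᵥ v - Ψ y ⬝ᵥ v))
  rw [dot_sampleOp, sub_dotProduct]
  ring

lemma dot_opMatrix (hc : StationaryChain D P) [DecidableEq E] (v w : Fin d → ℝ) :
    w ⬝ᵥ (opMatrix D P Ψ).mulVec v = pairMean D P fun x y => w ⬝ᵥ sampleOp Ψ x y v := by
  rw [pairMean_feature hc.row, opMatrix, ← mulVec_mulVec, ← mulVec_mulVec, ← mulVec_mulVec,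
    dotProduct_mulVec, vecMul_transpose]
  refine Finset.sum_congr rfl fun x _ => ?_
  rw [mulVec_diagonal]
  change (Ψ x ⬝ᵥ w) * _ = _
  ring

/-- `x ↦ D x` is invariant, so second coordinates have the same law. -/
lemma pairMean_snd_stat (hc : StationaryChain D P) (f : E → ℝ) :
    pairMean D P (fun _ y => f y) = ∑ y, D y * f y := by
  rw [pairMean_snd]
  simp only [hc.stat]

lemma pairMean_sub_sq_le (p : E → ℝ) (hp : ∀ x, 0 ≤ p x) (hP : ∀ x y, 0 ≤ P x y) (f : E → ℝ) :
    pairMean p P (fun x y => (f x - f y) ^ 2) ≤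
      2 * (pairMean p P (fun x _ => f x ^ 2) + pairMean p P fun _ y => f y ^ 2) := by
  rw [← pairMean_add, ← pairMean_mul_left]
  exact pairMean_mono hp hP fun x y => by nlinarith [sq_nonneg (f x + f y)]

lemma pairMean_sub_sq_stat_le (hc : StationaryChain D P) (f : E → ℝ) :
    pairMean D P (fun x y => (f x - f y) ^ 2) ≤ 4 * normSqD D f := by
  refine (pairMean_sub_sq_le D (fun x => (hc.pos x).le) hc.nonneg f).trans ?_
  rw [pairMean_snd_stat hc (fun y => f y ^ 2), pairMean_fst hc.row (fun y => f y ^ 2)]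
  simp only [normSqD]
  linarith

lemma pairMean_sampleOp_stat_le (hc : StationaryChain D P) (hψ : ∀ x, Ψ x ⬝ᵥ Ψ x ≤ 1)
    (v : Fin d → ℝ) :
    pairMean D P (fun x y => sampleOp Ψ x y v ⬝ᵥ sampleOp Ψ x y v) ≤ 4 * featSq D Ψ v := by
  refine le_trans ?_ (pairMean_sub_sq_stat_le hc (Ψ.mulVec v))
  refine pairMean_mono (fun x => (hc.pos x).le) hc.nonneg fun x y => ?_
  refine (sampleOp_self_le hψ x y v).trans (le_of_eq ?_)
  rw [sub_dotProduct]
  rfl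

/-- Jensen's inequality in disguise: A v is the stationary mean of the sampled operator, so testing
that mean against w = A v and absorbing half of |w|² leaves the second moment of the samples. -/
lemma opMatrix_self_le (hc : StationaryChain D P) (hψ : ∀ x, Ψ x ⬝ᵥ Ψ x ≤ 1) [DecidableEq E]
    (v : Fin d → ℝ) :
    (opMatrix D P Ψ).mulVec v ⬝ᵥ (opMatrix D P Ψ).mulVec v ≤ 4 * featSq D Ψ v := by
  set w := (opMatrix D P Ψ).mulVec v with hw
  have h1 : w ⬝ᵥ w = pairMean D P fun x y => w ⬝ᵥ sampleOp Ψ x y v := dot_opMatrix hc v w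
  have h2 : pairMean D P (fun x y => w ⬝ᵥ sampleOp Ψ x y v) ≤
      pairMean D P fun x y =>
        1 / 2 * (w ⬝ᵥ w) + 1 / 2 * (sampleOp Ψ x y v ⬝ᵥ sampleOp Ψ x y v) := by
    refine pairMean_mono (fun x => (hc.pos x).le) hc.nonneg fun x y => ?_
    have := dotProduct_le_of_pos w (sampleOp Ψ x y v) one_pos
    linarith [le_abs_self (w ⬝ᵥ sampleOp Ψ x y v)]
  rw [pairMean_add, pairMean_const hc.sum_eq hc.row, pairMean_mul_left] at h2
  linarith [pairMean_sampleOp_stat_le hc hψ v]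

lemma abs_pairMean_le {p : E → ℝ} (hp : ∀ x, 0 ≤ p x) (hP : ∀ x y, 0 ≤ P x y)
    (f : E → E → ℝ) : |pairMean p P f| ≤ pairMean p P fun x y => |f x y| := by
  rw [abs_le]
  constructor
  · have : pairMean p P (fun x y => -1 * |f x y|) ≤ pairMean p P f :=
      pairMean_mono hp hP fun x y => by linarith [neg_abs_le (f x y)]
    rw [pairMean_mul_left] at this
    linarith
  · exact pairMean_mono hp hP fun x y => le_abs_self _

/-- Young's inequality that keeps the feature value at x, whose square integrates to ‖Ψ w‖_D²
without loss of a factor 1 / μ. The weights compensate the factor 4 of `sq_feature_sub_le`. -/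
lemma abs_dot_sampleOp_le (hψ : ∀ x, Ψ x ⬝ᵥ Ψ x ≤ 1) (x y : E) (w u : Fin d → ℝ) :
    |w ⬝ᵥ sampleOp Ψ x y u| ≤ 4 * (Ψ x ⬝ᵥ w) ^ 2 + 1 / 4 * (u ⬝ᵥ u) := by
  rw [dot_sampleOp, abs_le]
  have := sq_feature_sub_le hψ x y u
  constructor
  · nlinarith [sq_nonneg (8 * (Ψ x ⬝ᵥ w) + ((Ψ x - Ψ y) ⬝ᵥ u))]
  · nlinarith [sq_nonneg (8 * (Ψ x ⬝ᵥ w) - ((Ψ x - Ψ y) ⬝ᵥ u))]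

lemma abs_dot_opMatrix_le (hc : StationaryChain D P) (hψ : ∀ x, Ψ x ⬝ᵥ Ψ x ≤ 1) [DecidableEq E]
    (w u : Fin d → ℝ) :
    |w ⬝ᵥ (opMatrix D P Ψ).mulVec u| ≤ 4 * featSq D Ψ w + 1 / 4 * (u ⬝ᵥ u) := by
  have hp := fun x => (hc.pos x).le
  rw [dot_opMatrix hc]
  refine (abs_pairMean_le hp hc.nonneg _).trans
    ((pairMean_mono hp hc.nonneg fun x y => abs_dot_sampleOp_le hψ x y w u).trans (le_of_eq ?_))
  rw [pairMean_add, pairMean_const hc.sum_eq hc.row, pairMean_mul_left,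
    pairMean_fst hc.row fun x => (Ψ x ⬝ᵥ w) ^ 2]
  rfl

/-- The sample operator has second moment at most that of the uncentered one. -/
lemma pairMean_centered_stat_le (hc : StationaryChain D P) (hψ : ∀ x, Ψ x ⬝ᵥ Ψ x ≤ 1)
    [DecidableEq E] (v : Fin d → ℝ) :
    pairMean D P (fun x y => (sampleOp Ψ x y v - (opMatrix D P Ψ).mulVec v) ⬝ᵥ
      (sampleOp Ψ x y v - (opMatrix D P Ψ).mulVec v)) ≤ 4 * featSq D Ψ v := by
  set a := (opMatrix D P Ψ).mulVec v with ha
  have h : ∀ x y, (sampleOp Ψ x y v - a) ⬝ᵥ (sampleOp Ψ x y v - a) =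
      sampleOp Ψ x y v ⬝ᵥ sampleOp Ψ x y v - 2 * (a ⬝ᵥ sampleOp Ψ x y v) + a ⬝ᵥ a := by
    intro x y
    rw [sub_dotProduct, dotProduct_sub, dotProduct_sub, dotProduct_comm _ a]
    ring
  simp only [h]
  rw [pairMean_add, pairMean_sub, pairMean_mul_left, pairMean_const hc.sum_eq hc.row,
    ← dot_opMatrix hc]
  linarith [pairMean_sampleOp_stat_le hc hψ v, dotProduct_self_nonneg' a]

end Deterministic

/-! ### The Gram matrix, its inverse square root, and the monotonicity constant. -/

section Spectral

open Matrix

variable {E : Type*} [Fintype E] [DecidableEq E] {d : ℕ} {D : E → ℝ} {P : Matrix E E ℝ}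
  {Ψ : Matrix E (Fin d) ℝ}

lemma dot_gram (v w : Fin d → ℝ) :
    w ⬝ᵥ (gram D Ψ).mulVec v = ∑ x, D x * (Ψ.mulVec w x * Ψ.mulVec v x) := by
  rw [gram, ← mulVec_mulVec, ← mulVec_mulVec, dotProduct_mulVec, vecMul_transpose]
  refine Finset.sum_congr rfl fun x _ => ?_
  rw [mulVec_diagonal]
  ring

lemma dot_gram_self (v : Fin d → ℝ) : v ⬝ᵥ (gram D Ψ).mulVec v = featSq D Ψ v := by
  rw [dot_gram]
  exact Finset.sum_congr rfl fun x _ => by ring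

lemma gram_transpose : (gram D Ψ)ᵀ = gram D Ψ := by
  simp [gram, transpose_mul, Matrix.mul_assoc]

lemma gram_isHermitian : (gram D Ψ).IsHermitian := by
  rw [IsHermitian, conjTranspose_eq_transpose_of_trivial, gram_transpose]

lemma mulVec_eq_zero_of_featSq (hD : ∀ x, 0 < D x) {v : Fin d → ℝ} (h : featSq D Ψ v = 0) :
    Ψ.mulVec v = 0 := by
  funext x
  have := (Finset.sum_eq_zero_iff_of_nonneg fun x _ =>
    mul_nonneg (hD x).le (sq_nonneg (Ψ.mulVec v x))).1 h x (Finset.mem_univ x)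
  simpa [(hD x).ne'] using this

lemma mulVec_eq_sum_cols (v : Fin d → ℝ) : Ψ.mulVec v = ∑ j, v j • fun x => Ψ x j := by
  funext x
  simp [mulVec, dotProduct, mul_comm]

lemma gram_posDef (hD : ∀ x, 0 < D x) (hindep : LinearIndependent ℝ fun j => fun x => Ψ x j) :
    (gram D Ψ).PosDef := by
  refine PosDef.of_dotProduct_mulVec_pos gram_isHermitian fun {v} hv => ?_
  rw [star_trivial, dot_gram_self]
  refine lt_of_le_of_ne (featSq_nonneg hD Ψ v) fun h => hv ?_
  have h0 := mulVec_eq_zero_of_featSq hD h.symm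
  rw [mulVec_eq_sum_cols] at h0
  exact funext (Fintype.linearIndependent_iff.1 hindep v h0)

lemma spectrum_gram_pos (hD : ∀ x, 0 < D x)
    (hindep : LinearIndependent ℝ fun j => fun x => Ψ x j) {t : ℝ}
    (ht : t ∈ spectrum ℝ (gram D Ψ)) : 0 < t := by
  rw [(gram_isHermitian (D := D) (Ψ := Ψ)).spectrum_real_eq_range_eigenvalues] at ht
  obtain ⟨i, rfl⟩ := ht
  exact (gram_posDef hD hindep).eigenvalues_pos i

/-- Positivity of d makes the spectrum nonempty, so that the infimum is attained; over the empty set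
`sInf` would return 0. -/
lemma minEig_pos (hD : ∀ x, 0 < D x) (hd : 0 < d)
    (hindep : LinearIndependent ℝ fun j => fun x => Ψ x j) : 0 < minEig D Ψ := by
  have : Nonempty (Fin d) := ⟨⟨0, hd⟩⟩
  have hs := (gram_isHermitian (D := D) (Ψ := Ψ)).spectrum_real_eq_range_eigenvalues
  have hmem : minEig D Ψ ∈ spectrum ℝ (gram D Ψ) := by
    rw [minEig, hs]
    exact (Set.range_nonempty _).csInf_mem (Set.finite_range _)
  exact spectrum_gram_pos hD hindep hmem

open MatrixOrder in
lemma minEig_mul_le (v : Fin d → ℝ) : minEig D Ψ * (v ⬝ᵥ v) ≤ featSq D Ψ v := by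
  have hB := gram_isHermitian (D := D) (Ψ := Ψ)
  have h : algebraMap ℝ _ (minEig D Ψ) ≤ gram D Ψ := by
    rw [algebraMap_le_iff_le_spectrum (ha := hB.isSelfAdjoint)]
    intro t ht
    refine csInf_le ?_ ht
    rw [hB.spectrum_real_eq_range_eigenvalues]
    exact (Set.finite_range _).bddBelow
  have h2 := (Matrix.le_iff.1 h).dotProduct_mulVec_nonneg v
  rw [star_trivial, sub_mulVec, dotProduct_sub, dot_gram_self, Matrix.algebraMap_eq_diagonal] at h2
  have h3 : v ⬝ᵥ (diagonal ((algebraMap ℝ (Fin d → ℝ)) (minEig D Ψ))).mulVec v =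
      minEig D Ψ * (v ⬝ᵥ v) := by
    simp only [dotProduct, mulVec_diagonal, Finset.mul_sum]
    exact Finset.sum_congr rfl fun i _ => by
      simp only [Pi.algebraMap_apply, Algebra.algebraMap_self, RingHom.id_apply]
      ring
  linarith

lemma gramInvSqrt_transpose : (gramInvSqrt D Ψ)ᵀ = gramInvSqrt D Ψ := by
  have h : IsSelfAdjoint (gramInvSqrt D Ψ) := IsSelfAdjoint.cfc
  rw [← conjTranspose_eq_transpose_of_trivial]
  exact h

lemma gramInvSqrt_mul_gram_mul (hD : ∀ x, 0 < D x)
    (hindep : LinearIndependent ℝ fun j => fun x => Ψ x j) :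
    gramInvSqrt D Ψ * gram D Ψ * gramInvSqrt D Ψ = 1 := by
  have hB := gram_isHermitian (D := D) (Ψ := Ψ)
  have hsa : IsSelfAdjoint (gram D Ψ) := hB.isSelfAdjoint
  -- The spectrum is finite, hence every function is continuous on it, including the inverse square
  -- root.
  have hcont : ∀ f : ℝ → ℝ, ContinuousOn f (spectrum ℝ (gram D Ψ)) := by
    intro f
    have : (spectrum ℝ (gram D Ψ)).Finite := by
      rw [hB.spectrum_real_eq_range_eigenvalues]
      exact Set.finite_range _
    exact this.continuousOn f
  have h1 : gramInvSqrt D Ψ * gram D Ψ = cfc (fun x : ℝ => (√x)⁻¹ * x) (gram D Ψ) := by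
    rw [cfc_mul _ _ _ (hcont _) (hcont _), cfc_id' ℝ (gram D Ψ) hsa]
    rfl
  rw [h1, gramInvSqrt, ← cfc_mul _ _ _ (hcont _) (hcont _)]
  rw [← cfc_one ℝ (gram D Ψ) hsa]
  refine cfc_congr fun t ht => ?_
  have htp := spectrum_gram_pos hD hindep ht
  have hs := Real.mul_self_sqrt htp.le
  have hs0 : √t ≠ 0 := (Real.sqrt_pos.2 htp).ne'
  simp only [Pi.one_apply]
  field_simp
  linarith

lemma monoConst_form (hc : StationaryChain D P) (v : Fin d → ℝ) :
    Ψ.mulVec v ⬝ᵥ (diagonal D * (1 - P)).mulVec (Ψ.mulVec v) =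
      v ⬝ᵥ (opMatrix D P Ψ).mulVec v := by
  rw [dot_opMatrix hc, pairMean_feature hc.row, ← mulVec_mulVec]
  refine Finset.sum_congr rfl fun x _ => ?_
  rw [mulVec_diagonal]
  change (Ψ x ⬝ᵥ v) * _ = _
  ring

/-- By stationarity f x² and f y² have the same mean, so the form is a Dirichlet form. This gives
nonnegativity, hence a lower bound for the set in `monoConst`, as well as the upper bounds of the
gap by 2 and by 2 ‖I - P‖. -/
lemma form_eq_half (hc : StationaryChain D P) (f : E → ℝ) :
    f ⬝ᵥ (diagonal D * (1 - P)).mulVec f =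
      1 / 2 * pairMean D P fun x y => (f x - f y) ^ 2 := by
  have h : ∀ x y, (f x - f y) ^ 2 = 2 * (f x * (f x - f y)) - f x ^ 2 + f y ^ 2 := by
    intro x y; ring
  simp only [h]
  rw [pairMean_add, pairMean_sub, pairMean_mul_left, pairMean_snd_stat hc (fun y => f y ^ 2),
    pairMean_fst hc.row (fun y => f y ^ 2)]
  have h2 : f ⬝ᵥ (diagonal D * (1 - P)).mulVec f = pairMean D P fun x y => f x * (f x - f y) := by
    rw [← mulVec_mulVec]
    refine Finset.sum_congr rfl fun x _ => ?_
    rw [mulVec_diagonal, ← sum_row_mul_sub hc.row, Finset.mul_sum, Finset.mul_sum]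
    refine Finset.sum_congr rfl fun y _ => ?_
    change f x * (D x * (P x y * (f x - f y))) = D x * P x y * (f x * (f x - f y))
    ring
  rw [h2]
  ring

lemma form_nonneg (hc : StationaryChain D P) (f : E → ℝ) :
    0 ≤ f ⬝ᵥ (diagonal D * (1 - P)).mulVec f := by
  rw [form_eq_half hc]
  have := pairMean_nonneg (p := D) (P := P) (f := fun x y => (f x - f y) ^ 2)
    (fun x => (hc.pos x).le) hc.nonneg fun _ _ => sq_nonneg _
  linarith

lemma monoConst_le (hc : StationaryChain D P) {f : E → ℝ} (hf : f ∈ featureSpan Ψ)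
    (h1 : normSqD D f = 1) :
    monoConst D P Ψ ≤ f ⬝ᵥ (diagonal D * (1 - P)).mulVec f := by
  refine csInf_le ⟨0, ?_⟩ ⟨f, hf, h1, rfl⟩
  rintro r ⟨x, -, -, rfl⟩
  exact form_nonneg hc x

lemma monoConst_mul_le (hc : StationaryChain D P) (v : Fin d → ℝ) :
    monoConst D P Ψ * featSq D Ψ v ≤ v ⬝ᵥ (opMatrix D P Ψ).mulVec v := by
  rcases (featSq_nonneg hc.pos Ψ v).eq_or_lt with h0 | hpos
  · rw [← h0, mul_zero, ← monoConst_form hc]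
    exact form_nonneg hc _
  set s := featSq D Ψ v
  have hs : 0 < √s := Real.sqrt_pos.2 hpos
  have hmem : Ψ.mulVec ((√s)⁻¹ • v) ∈ featureSpan Ψ := by
    rw [mulVec_eq_sum_cols]
    exact Submodule.sum_mem _ fun j _ => Submodule.smul_mem _ _ (Submodule.subset_span ⟨j, rfl⟩)
  have hn : normSqD D (Ψ.mulVec ((√s)⁻¹ • v)) = 1 := by
    change featSq D Ψ ((√s)⁻¹ • v) = 1
    rw [featSq_smul, inv_pow, Real.sq_sqrt hpos.le]
    exact inv_mul_cancel₀ hpos.ne'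
  have h := monoConst_le hc hmem hn
  rw [monoConst_form hc, mulVec_smul, dotProduct_smul, smul_dotProduct, smul_eq_mul, smul_eq_mul,
    ← mul_assoc, ← mul_inv, Real.mul_self_sqrt hpos.le] at h
  calc monoConst D P Ψ * s ≤ (s⁻¹ * (v ⬝ᵥ (opMatrix D P Ψ).mulVec v)) * s := by gcongr
    _ = _ := by field_simp

lemma sum_sq_mulVec_le {m n : Type*} [Fintype m] [Fintype n] [DecidableEq n] (B : Matrix m n ℝ)
    (v : n → ℝ) : ∑ i, (B.mulVec v i) ^ 2 ≤ specNorm B ^ 2 * ∑ j, v j ^ 2 := by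
  have h := Matrix.l2_opNorm_mulVec B (WithLp.toLp 2 v)
  have h2 := pow_le_pow_left₀ (norm_nonneg _) h 2
  rw [mul_pow, EuclideanSpace.real_norm_sq_eq, EuclideanSpace.real_norm_sq_eq] at h2
  exact h2

open scoped Matrix.Norms.L2Operator in
lemma specNorm_nonneg {m n : Type*} [Fintype m] [Fintype n] [DecidableEq n] (B : Matrix m n ℝ) :
    0 ≤ specNorm B := norm_nonneg B

lemma abs_apply_le_specNorm {m n : Type*} [Fintype m] [Fintype n] [DecidableEq n]
    (B : Matrix m n ℝ) (i : m) (j : n) : |B i j| ≤ specNorm B := by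
  have h := sum_sq_mulVec_le B (Pi.single j 1)
  have h1 : ∑ k, (Pi.single j 1 : n → ℝ) k ^ 2 = 1 := by
    rw [Finset.sum_eq_single j] <;> simp +contextual
  rw [h1, mul_one] at h
  have h2 := (Finset.single_le_sum (f := fun i => (B.mulVec (Pi.single j 1) i) ^ 2)
    (fun _ _ => sq_nonneg _) (Finset.mem_univ i)).trans h
  simp only [mulVec_single_one, col_apply] at h2
  exact abs_le_of_sq_le_sq h2 (specNorm_nonneg B)

/-- A Euclidean operator bound does not respect the weights D. Instead the diagonal terms of the
Dirichlet form vanish, which leaves the factor 1 - P x x, an entry of I - P and therefore at most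
its spectral norm. -/
lemma form_le_two_specNorm (hc : StationaryChain D P) (f : E → ℝ) :
    f ⬝ᵥ (diagonal D * (1 - P)).mulVec f ≤ 2 * specNorm (1 - P) * normSqD D f := by
  rw [form_eq_half hc]
  set s := specNorm (1 - P)
  have hdiag : ∀ x, 1 - P x x ≤ s := fun x => by
    have := (le_abs_self _).trans (abs_apply_le_specNorm (1 - P) x x)
    simpa using this
  have h1 : pairMean D P (fun x y => (f x - f y) ^ 2) ≤
      pairMean D P fun x y => 2 * ((f x ^ 2 + f y ^ 2) - (if x = y then 2 * f x ^ 2 else 0)) := by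
    refine pairMean_mono (fun x => (hc.pos x).le) hc.nonneg fun x y => ?_
    split_ifs with h
    · subst h; nlinarith
    · nlinarith [sq_nonneg (f x + f y)]
  have h2 : pairMean D P (fun x y => if x = y then 2 * f x ^ 2 else 0) =
      ∑ x, D x * P x x * (2 * f x ^ 2) := by
    simp [pairMean]
  rw [pairMean_mul_left, pairMean_sub, pairMean_add, h2, pairMean_snd_stat hc (fun y => f y ^ 2),
    pairMean_fst hc.row (fun y => f y ^ 2)] at h1
  have h3 : ∑ x, D x * f x ^ 2 + ∑ x, D x * f x ^ 2 - ∑ x, D x * P x x * (2 * f x ^ 2) ≤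
      2 * s * normSqD D f := by
    rw [normSqD, Finset.mul_sum, ← Finset.sum_add_distrib, ← Finset.sum_sub_distrib]
    refine Finset.sum_le_sum fun x _ => ?_
    have := mul_le_mul_of_nonneg_right (hdiag x) (mul_nonneg (hc.pos x).le (sq_nonneg (f x)))
    linarith
  linarith

end Spectral

/-! ### Bounds for A⁻¹ and for the adjoint A⁻ᵀ B. -/

section Inverse

open Matrix

variable {E : Type*} [Fintype E] [DecidableEq E] {d : ℕ} {D : E → ℝ} {P : Matrix E E ℝ}
  {Ψ : Matrix E (Fin d) ℝ}

/-- The strong monotonicity constant `gap` of `A` with respect to `‖Ψ ·‖_D`, and a lower bound `μ`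
for the Gram matrix. -/
structure StronglyMonotone (D : E → ℝ) (P : Matrix E E ℝ) (Ψ : Matrix E (Fin d) ℝ)
    (μ gap : ℝ) : Prop where
  mu_pos : 0 < μ
  mu_le : ∀ v : Fin d → ℝ, μ * (v ⬝ᵥ v) ≤ featSq D Ψ v
  gap_pos : 0 < gap
  gap_le : ∀ v : Fin d → ℝ, gap * featSq D Ψ v ≤ v ⬝ᵥ (opMatrix D P Ψ).mulVec v

variable {μ gap : ℝ}

lemma StronglyMonotone.isUnit (hm : StronglyMonotone D P Ψ μ gap) :
    IsUnit (opMatrix D P Ψ) := by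
  rw [← mulVec_injective_iff_isUnit]
  have key : ∀ v, (opMatrix D P Ψ).mulVec v = 0 → v = 0 := by
    intro v hv
    have h1 := hm.gap_le v
    rw [hv, dotProduct_zero] at h1
    have h2 := hm.mu_le v
    have h3 : v ⬝ᵥ v ≤ 0 := by
      by_contra h
      push Not at h
      nlinarith [mul_pos hm.mu_pos h, mul_pos hm.gap_pos (mul_pos hm.mu_pos h), hm.gap_pos]
    exact dotProduct_self_eq_zero.1 (le_antisymm h3 (dotProduct_self_nonneg' v))
  intro v w h
  have := key (v - w) (by rw [mulVec_sub]; exact sub_eq_zero.2 h)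
  exact sub_eq_zero.1 this

lemma StronglyMonotone.mul_inv (hm : StronglyMonotone D P Ψ μ gap) :
    opMatrix D P Ψ * (opMatrix D P Ψ)⁻¹ = 1 :=
  Matrix.mul_nonsing_inv _ ((Matrix.isUnit_iff_isUnit_det _).1 hm.isUnit)

/-- For y = A⁻¹ n monotonicity reads gap ‖Ψ y‖_D² ≤ ⟨y, n⟩. Young's inequality with weight gap μ
returns the Euclidean part of y to the left side, so only one power of μ is lost. -/
lemma StronglyMonotone.featSq_inv_le (hm : StronglyMonotone D P Ψ μ gap) (n : Fin d → ℝ) :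
    featSq D Ψ ((opMatrix D P Ψ)⁻¹.mulVec n) ≤ (n ⬝ᵥ n) / (gap ^ 2 * μ) := by
  set y := (opMatrix D P Ψ)⁻¹.mulVec n with hy
  have hA : (opMatrix D P Ψ).mulVec y = n := by
    rw [hy, mulVec_mulVec, hm.mul_inv, one_mulVec]
  have h1 := hm.gap_le y
  rw [hA] at h1
  have h2 := hm.mu_le y
  have hg := hm.gap_pos
  have hμ := hm.mu_pos
  have h3 := dotProduct_le_of_pos y n (c := gap * μ) (by positivity)
  rw [le_div_iff₀ (by positivity)]
  have h4 : 2 * (gap * featSq D Ψ y) ≤ gap * featSq D Ψ y + 1 / (gap * μ) * (n ⬝ᵥ n) := by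
    nlinarith [le_abs_self (y ⬝ᵥ n), mul_le_mul_of_nonneg_left h2 hg.le]
  have h5 : gap * featSq D Ψ y ≤ 1 / (gap * μ) * (n ⬝ᵥ n) := by linarith
  calc featSq D Ψ y * (gap ^ 2 * μ) = (gap * featSq D Ψ y) * (gap * μ) := by ring
    _ ≤ (1 / (gap * μ) * (n ⬝ᵥ n)) * (gap * μ) := by gcongr
    _ = n ⬝ᵥ n := by field_simp

lemma gram_cauchy_young (hD : ∀ x, 0 < D x) (v w : Fin d → ℝ) {c : ℝ} (hc : 0 < c) :
    2 * |w ⬝ᵥ (gram D Ψ).mulVec v| ≤ c * featSq D Ψ w + 1 / c * featSq D Ψ v := by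
  have h := dotProduct_le_of_pos (fun x => √(D x) * Ψ.mulVec w x)
    (fun x => √(D x) * Ψ.mulVec v x) hc
  rw [← featSq_eq_dot D hD, ← featSq_eq_dot D hD] at h
  convert h using 3
  rw [dot_gram]
  refine Finset.sum_congr rfl fun x _ => ?_
  have := Real.mul_self_sqrt (hD x).le
  linear_combination (-(Ψ.mulVec w x * Ψ.mulVec v x)) * this

/-- Bound on the vector `A⁻ᵀ B y`. -/
lemma StronglyMonotone.adjoint_self_le (hc : StationaryChain D P)
    (hm : StronglyMonotone D P Ψ μ gap) (y : Fin d → ℝ) :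
    ((opMatrix D P Ψ)⁻¹ᵀ * gram D Ψ).mulVec y ⬝ᵥ ((opMatrix D P Ψ)⁻¹ᵀ * gram D Ψ).mulVec y ≤
      featSq D Ψ y / (gap ^ 2 * μ) := by
  set q := ((opMatrix D P Ψ)⁻¹ᵀ * gram D Ψ).mulVec y with hq
  -- The vector q solves Aᵀ q = B y, so testing with q gives gap ‖Ψ q‖_D² ≤ ⟨q, B y⟩. Only the final
  -- comparison with the Euclidean norm costs a factor μ.
  have hA : q ⬝ᵥ (opMatrix D P Ψ).mulVec q = q ⬝ᵥ (gram D Ψ).mulVec y := by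
    have : (opMatrix D P Ψ)ᵀ.mulVec q = (gram D Ψ).mulVec y := by
      rw [hq, mulVec_mulVec, ← Matrix.mul_assoc, ← transpose_mul,
        Matrix.nonsing_inv_mul _ ((Matrix.isUnit_iff_isUnit_det _).1 hm.isUnit), transpose_one,
        Matrix.one_mul]
    rw [← this, dotProduct_mulVec, dotProduct_comm, mulVec_transpose]
  have h1 := hm.gap_le q
  rw [hA] at h1
  have hg := hm.gap_pos
  have hμ := hm.mu_pos
  have h2 := gram_cauchy_young (Ψ := Ψ) hc.pos y q hg
  have h3 : gap * featSq D Ψ q ≤ 1 / gap * featSq D Ψ y := by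
    linarith [le_abs_self (q ⬝ᵥ (gram D Ψ).mulVec y)]
  have h4 := hm.mu_le q
  rw [le_div_iff₀ (by positivity)]
  calc q ⬝ᵥ q * (gap ^ 2 * μ) = (μ * (q ⬝ᵥ q)) * gap ^ 2 := by ring
    _ ≤ featSq D Ψ q * gap ^ 2 := by gcongr
    _ = (gap * featSq D Ψ q) * gap := by ring
    _ ≤ (1 / gap * featSq D Ψ y) * gap := by gcongr
    _ = featSq D Ψ y := by field_simp

/-- Moves A⁻¹ onto the earlier vector y: the later noise is then tested against a vector already
known, as the bias estimate requires. -/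
lemma gram_dot_inv (y n : Fin d → ℝ) :
    y ⬝ᵥ (gram D Ψ).mulVec ((opMatrix D P Ψ)⁻¹.mulVec n) =
      ((opMatrix D P Ψ)⁻¹ᵀ * gram D Ψ).mulVec y ⬝ᵥ n := by
  rw [← mulVec_mulVec, mulVec_transpose, ← dotProduct_mulVec, dotProduct_mulVec y,
    ← mulVec_transpose, gram_transpose]

end Inverse

/-! ### Mean, bias and stationary covariance of the stochastic operator. -/

section Noise

open Matrix

variable {E : Type*} [Fintype E] [DecidableEq E] {d : ℕ} {D : E → ℝ} {P : Matrix E E ℝ}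
  {Ψ : Matrix E (Fin d) ℝ} {c Q : E → ℝ} {ρ : ℝ}

/-- The Poisson equation writes c - ρ as (I - P) Q, so cost and linear part merge into I - P applied
to Ψθ - Q. Bias is thereby measured by the distance to Q. -/
lemma pairMean_stochOp (hrow : ∀ x, ∑ y, P x y = 1) (hQ : (1 - P).mulVec Q = fun x => c x - ρ)
    (p : E → ℝ) (θ w : Fin d → ℝ) :
    pairMean p P (fun x y => w ⬝ᵥ stochOp Ψ c θ ρ x y) =
      ∑ x, p x * (Ψ x ⬝ᵥ w) * ((1 - P).mulVec (Ψ.mulVec θ - Q)) x := by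
  have h : ∀ x y, w ⬝ᵥ stochOp Ψ c θ ρ x y =
      w ⬝ᵥ sampleOp Ψ x y θ - (Ψ x ⬝ᵥ w) * (c x - ρ) := by
    intro x y
    rw [stochOp, dotProduct_smul, smul_eq_mul, dot_sampleOp, dotProduct_comm w]
    ring
  simp only [h]
  rw [pairMean_sub, pairMean_feature hrow, pairMean_fst hrow fun x => (Ψ x ⬝ᵥ w) * (c x - ρ),
    ← Finset.sum_sub_distrib]
  refine Finset.sum_congr rfl fun x _ => ?_
  rw [mulVec_sub, Pi.sub_apply, hQ]
  ring

lemma ProjectedBellman.opMatrix_mulVec {θ : Fin d → ℝ} (h : ProjectedBellman D P Ψ c ρ θ) :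
    (opMatrix D P Ψ).mulVec θ = (Ψ.transpose * diagonal D).mulVec fun e => c e - ρ := by
  have e : opMatrix D P Ψ = Ψ.transpose * diagonal D * Ψ - Ψ.transpose * diagonal D * P * Ψ := by
    rw [opMatrix, Matrix.mul_sub, Matrix.mul_one, Matrix.sub_mul]
  rw [e, sub_mulVec, h]
  abel

/-- At stationarity the stochastic operator has mean `A (θ - θ*)`. -/
lemma pairMean_stochOp_stat (hc : StationaryChain D P)
    {θstar : Fin d → ℝ} (h : ProjectedBellman D P Ψ c ρ θstar) (θ w : Fin d → ℝ) :
    pairMean D P (fun x y => w ⬝ᵥ stochOp Ψ c θ ρ x y) =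
      w ⬝ᵥ (opMatrix D P Ψ).mulVec (θ - θstar) := by
  have h1 : ∀ x y, w ⬝ᵥ stochOp Ψ c θ ρ x y =
      w ⬝ᵥ sampleOp Ψ x y θ - (Ψ x ⬝ᵥ w) * (c x - ρ) := by
    intro x y
    rw [stochOp, dotProduct_smul, smul_eq_mul, dot_sampleOp, dotProduct_comm w]
    ring
  simp only [h1]
  rw [pairMean_sub, ← dot_opMatrix hc, pairMean_fst hc.row fun x => (Ψ x ⬝ᵥ w) * (c x - ρ),
    mulVec_sub, dotProduct_sub, h.opMatrix_mulVec, ← mulVec_mulVec,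
    dotProduct_mulVec w Ψᵀ, vecMul_transpose]
  congr 1
  refine Finset.sum_congr rfl fun x _ => ?_
  rw [mulVec_diagonal]
  change _ = (Ψ x ⬝ᵥ w) * _
  ring

/-- The centred stochastic operator. -/
def noise (D : E → ℝ) (P : Matrix E E ℝ) (Ψ : Matrix E (Fin d) ℝ) (c : E → ℝ) (ρ : ℝ)
    (θstar θ : Fin d → ℝ) (x y : E) : Fin d → ℝ :=
  stochOp Ψ c θ ρ x y - (opMatrix D P Ψ).mulVec (θ - θstar)

/-- Separates the noise at θ*, which produces the trace term, from a part linear in θ - θ*, which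
the contraction of an epoch can absorb. -/
lemma noise_eq (θstar θ : Fin d → ℝ) (x y : E) :
    noise D P Ψ c ρ θstar θ x y = stochOp Ψ c θstar ρ x y +
      (sampleOp Ψ x y (θ - θstar) - (opMatrix D P Ψ).mulVec (θ - θstar)) := by
  have : stochOp Ψ c θ ρ x y = stochOp Ψ c θstar ρ x y + sampleOp Ψ x y (θ - θstar) := by
    rw [stochOp, stochOp, sampleOp, ← add_smul, dotProduct_sub]
    congr 1
    ring
  rw [noise, this]
  abel

lemma stochOp_sub (θ θ' : Fin d → ℝ) (ρ' : ℝ) (x y : E) :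
    stochOp Ψ c θ ρ' x y - stochOp Ψ c θ' ρ' x y = sampleOp Ψ x y (θ - θ') := by
  rw [stochOp, stochOp, sampleOp, ← sub_smul, dotProduct_sub]
  congr 1
  ring

/-- The conditional bias of the noise when its first point has law `p`. -/
lemma pairMean_noise (hc : StationaryChain D P) (hQ : (1 - P).mulVec Q = fun x => c x - ρ)
    {θstar : Fin d → ℝ} (h : ProjectedBellman D P Ψ c ρ θstar)
    {p : E → ℝ} (hp : ∑ x, p x = 1) (θ w : Fin d → ℝ) :
    pairMean p P (fun x y => w ⬝ᵥ noise D P Ψ c ρ θstar θ x y) =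
      ∑ x, (p x - D x) * (Ψ x ⬝ᵥ w) * ((1 - P).mulVec (Ψ.mulVec θ - Q)) x := by
  simp only [noise, dotProduct_sub]
  rw [pairMean_sub, pairMean_const hp hc.row, ← pairMean_stochOp_stat hc h,
    pairMean_stochOp hc.row hQ, pairMean_stochOp hc.row hQ, ← Finset.sum_sub_distrib]
  exact Finset.sum_congr rfl fun x _ => by ring

lemma sum_mulVec_mul (R : Matrix (Fin d) (Fin d) ℝ) (u : Fin d → ℝ) :
    R.mulVec u ⬝ᵥ R.mulVec u = ∑ k, ∑ i, ∑ j, R k i * R k j * (u i * u j) := by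
  refine Finset.sum_congr rfl fun k _ => ?_
  rw [mulVec, dotProduct, Finset.sum_mul_sum]
  exact Finset.sum_congr rfl fun i _ => Finset.sum_congr rfl fun j _ => by ring

lemma trace_pairCov (R : Matrix (Fin d) (Fin d) ℝ) (F : E → E → Fin d → ℝ)
    (h0 : ∀ i, pairMean D P (fun x y => F x y i) = 0) :
    (R * pairCov D P F * R.transpose).trace =
      pairMean D P fun x y => R.mulVec (F x y) ⬝ᵥ R.mulVec (F x y) := by
  simp only [sum_mulVec_mul]
  rw [pairMean_sum, trace]
  refine Finset.sum_congr rfl fun k _ => ?_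
  rw [pairMean_sum, diag_apply, Matrix.mul_apply]
  simp only [Matrix.mul_apply, transpose_apply, Finset.sum_mul]
  rw [Finset.sum_comm]
  refine Finset.sum_congr rfl fun i _ => ?_
  rw [pairMean_sum]
  refine Finset.sum_congr rfl fun j _ => ?_
  rw [pairMean_mul_left]
  simp only [pairCov, of_apply, h0, sub_zero]
  ring

/-- The trace term of the bound is the mean square `D`-norm of `A⁻¹ g̃(θ*, ρ*, ξ)`. -/
lemma trace_noiseCov (hc : StationaryChain D P)
    (hindep : LinearIndependent ℝ fun j => fun x => Ψ x j)
    {θstar : Fin d → ℝ} (h : ProjectedBellman D P Ψ c ρ θstar) :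
    ((1 - projMatrix D P Ψ)⁻¹ * noiseCov D P Ψ c θstar ρ *
        ((1 - projMatrix D P Ψ)⁻¹).transpose).trace =
      pairMean D P fun x y => featSq D Ψ ((opMatrix D P Ψ)⁻¹.mulVec (stochOp Ψ c θstar ρ x y)) := by
  set S := gramInvSqrt D Ψ with hS
  set B := gram D Ψ with hB
  have hST : Sᵀ = S := gramInvSqrt_transpose
  have h1 : S * B * S = 1 := gramInvSqrt_mul_gram_mul hc.pos hindep
  have h1' : S * (B * S) = 1 := by rw [← Matrix.mul_assoc, h1]
  have h2 : (B * S) * S = 1 := mul_eq_one_comm.1 h1'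
  have h3 : S * (S * B) = 1 := mul_eq_one_comm.1 h1
  have hBS : B * S = S * B := by
    calc B * S = B * S * (S * (S * B)) := by rw [h3, Matrix.mul_one]
      _ = S * B := by rw [← Matrix.mul_assoc, h2, Matrix.one_mul]
  -- With S = B^{-1/2}, the identity S B S = I turns I - M into S A S.
  have hproj : 1 - projMatrix D P Ψ = S * opMatrix D P Ψ * S := by
    have e : projMatrix D P Ψ = S * (Ψ.transpose * diagonal D * P * Ψ) * S := by
      rw [projMatrix, orthoFeatures, transpose_mul, ← hS, hST]
      simp only [Matrix.mul_assoc]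
    have e2 : opMatrix D P Ψ = B - Ψ.transpose * diagonal D * P * Ψ := by
      rw [opMatrix, Matrix.mul_sub, Matrix.mul_one, Matrix.sub_mul, hB, gram]
    rw [e, e2, Matrix.mul_sub, Matrix.sub_mul, h1]
  have hSinv : S⁻¹ = S * B := inv_eq_right_inv h3
  -- Here S B is B^{1/2}, so (I - M)⁻¹ B^{-1/2} = B^{1/2} A⁻¹, and the Euclidean square of B^{1/2} u
  -- is ‖Ψ u‖_D².
  have hinv : (1 - projMatrix D P Ψ)⁻¹ * S = S * B * (opMatrix D P Ψ)⁻¹ := by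
    rw [hproj, Matrix.mul_inv_rev, Matrix.mul_inv_rev, hSinv]
    simp only [Matrix.mul_assoc, h1', Matrix.mul_one]
  -- The projected Bellman equation makes g̃ at θ* centred, so the covariance is a plain second
  -- moment.
  have hmean : ∀ i, pairMean D P (fun x y => S.mulVec (stochOp Ψ c θstar ρ x y) i) = 0 := by
    intro i
    have := pairMean_stochOp_stat hc h θstar (S i)
    rw [sub_self, mulVec_zero, dotProduct_zero] at this
    exact this
  rw [noiseCov, trace_pairCov _ _ hmean]
  congr 1
  funext x y
  rw [mulVec_mulVec, hinv, ← mulVec_mulVec]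
  set u := (opMatrix D P Ψ)⁻¹.mulVec (stochOp Ψ c θstar ρ x y)
  have hBT : Bᵀ = B := gram_transpose
  rw [← dot_gram_self, dotProduct_mulVec, ← mulVec_transpose, transpose_mul, hST, hBT,
    mulVec_mulVec, hBS, dotProduct_comm]
  congr 2
  calc S * B * (S * B) = (S * B) * (B * S) := by rw [hBS]
    _ = B * S * (B * S) := by rw [hBS]
    _ = B * (S * (B * S)) := by rw [Matrix.mul_assoc]
    _ = B := by rw [h1', Matrix.mul_one]

end Noise

/-! ### From mixing bounds to laws that are nearly stationary for the inner loop. -/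

section Mixing

open Matrix

variable {E : Type*} [Fintype E] [DecidableEq E] {d : ℕ} {D : E → ℝ} {P : Matrix E E ℝ}
  {Ψ : Matrix E (Fin d) ℝ}

lemma iInf_mul_le (D : E → ℝ) (g : E → ℝ) :
    (⨅ x, D x) * ∑ x, g x ^ 2 ≤ normSqD D g := by
  rw [Finset.mul_sum]
  refine Finset.sum_le_sum fun x _ => mul_le_mul_of_nonneg_right ?_ (sq_nonneg _)
  exact ciInf_le (Set.finite_range D).bddBelow x

lemma iInf_pos {D : E → ℝ} [Nonempty E] (hD : ∀ x, 0 < D x) : 0 < ⨅ x, D x := by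
  obtain ⟨x, hx⟩ := exists_eq_ciInf_of_finite (f := D)
  rw [← hx]
  exact hD x

lemma sqrt_iInf_mul_le [Nonempty E] {D : E → ℝ} (hD : ∀ x, 0 < D x) (g : E → ℝ) :
    √(∑ x, g x ^ 2) ≤ √(normSqD D g) / √(⨅ x, D x) := by
  rw [← Real.sqrt_div' _ (iInf_pos hD).le]
  refine Real.sqrt_le_sqrt ?_
  rw [le_div_iff₀ (iInf_pos hD), mul_comm]
  exact iInf_mul_le D g

/-- Each |δ x| is at most the ℓ¹ norm, and Cauchy–Schwarz over E does the rest. -/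
lemma abs_sum_mul_mul_le {δ a b : E → ℝ} {ε : ℝ} (hδ : ∑ x, |δ x| ≤ ε) :
    |∑ x, δ x * a x * b x| ≤ ε * (√(∑ x, a x ^ 2) * √(∑ x, b x ^ 2)) := by
  have h1 : ∀ x, |δ x| ≤ ε := fun x =>
    (Finset.single_le_sum (f := fun x => |δ x|) (fun _ _ => abs_nonneg _)
      (Finset.mem_univ x)).trans hδ
  have hε : 0 ≤ ε := (Finset.sum_nonneg fun x _ => abs_nonneg (δ x)).trans hδ
  calc |∑ x, δ x * a x * b x| ≤ ∑ x, |δ x * a x * b x| := Finset.abs_sum_le_sum_abs _ _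
    _ ≤ ∑ x, ε * (|a x| * |b x|) := Finset.sum_le_sum fun x _ => by
        rw [abs_mul, abs_mul, mul_assoc]
        exact mul_le_mul_of_nonneg_right (h1 x) (by positivity)
    _ = ε * ∑ x, |a x| * |b x| := by rw [Finset.mul_sum]
    _ ≤ ε * (√(∑ x, a x ^ 2) * √(∑ x, b x ^ 2)) := by
        refine mul_le_mul_of_nonneg_left ?_ hε
        have := Real.sum_mul_le_sqrt_mul_sqrt Finset.univ (fun x => |a x|) (fun x => |b x|)
        simpa only [sq_abs] using this

lemma sqrt_sum_sq_mulVec_le {m n : Type*} [Fintype m] [Fintype n] [DecidableEq n]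
    (B : Matrix m n ℝ) (v : n → ℝ) :
    √(∑ i, (B.mulVec v i) ^ 2) ≤ specNorm B * √(∑ j, v j ^ 2) := by
  rw [← Real.sqrt_sq (specNorm_nonneg B), ← Real.sqrt_mul (sq_nonneg _)]
  exact Real.sqrt_le_sqrt (sum_sq_mulVec_le B v)

lemma dot_self_eq_sum_sq {n : Type*} [Fintype n] (v : n → ℝ) : v ⬝ᵥ v = ∑ i, v i ^ 2 :=
  Finset.sum_congr rfl fun i _ => by ring

/-- The bias caused by imperfect mixing. -/
lemma abs_bias_le [Nonempty E] (hD : ∀ x, 0 < D x) {δ : E → ℝ} {ε κ : ℝ} (hδ : ∑ x, |δ x| ≤ ε)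
    (hκ : ε / √(⨅ x, D x) * specNorm Ψ * specNorm (1 - P) ≤ κ) (w : Fin d → ℝ) (g : E → ℝ) :
    |∑ x, δ x * (Ψ x ⬝ᵥ w) * ((1 - P).mulVec g) x| ≤ κ * (√(w ⬝ᵥ w) * √(normSqD D g)) := by
  have hε : 0 ≤ ε := (Finset.sum_nonneg fun x _ => abs_nonneg (δ x)).trans hδ
  have h1 := sqrt_sum_sq_mulVec_le Ψ w
  have h2 := sqrt_sum_sq_mulVec_le (1 - P) g
  have h3 := sqrt_iInf_mul_le hD g
  have hP0 := specNorm_nonneg (1 - P)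
  have hΨ0 := specNorm_nonneg Ψ
  rw [dot_self_eq_sum_sq]
  calc |∑ x, δ x * (Ψ x ⬝ᵥ w) * ((1 - P).mulVec g) x|
      ≤ ε * (√(∑ x, (Ψ.mulVec w x) ^ 2) * √(∑ x, ((1 - P).mulVec g x) ^ 2)) :=
        abs_sum_mul_mul_le hδ
    _ ≤ ε * ((specNorm Ψ * √(∑ j, w j ^ 2)) *
          (specNorm (1 - P) * (√(normSqD D g) / √(⨅ x, D x)))) := by
        gcongr
        exact h2.trans (mul_le_mul_of_nonneg_left h3 hP0)
    _ = (ε / √(⨅ x, D x) * specNorm Ψ * specNorm (1 - P)) *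
          (√(∑ j, w j ^ 2) * √(normSqD D g)) := by ring
    _ ≤ _ := mul_le_mul_of_nonneg_right hκ (by positivity)

/-- The law `p` is close to stationarity in the way needed by the inner iterations. -/
structure NearStationary (D : E → ℝ) (P : Matrix E E ℝ) (Ψ : Matrix E (Fin d) ℝ) (η : ℝ)
    (p : E → ℝ) : Prop where
  nonneg : ∀ x, 0 ≤ p x
  sum_eq : ∑ x, p x = 1
  sq_le : ∀ v : Fin d → ℝ, ∑ x, p x * (Ψ x ⬝ᵥ v) ^ 2 ≤ 9 / 8 * featSq D Ψ v
  sq_le' : ∀ v : Fin d → ℝ, pairMean p P (fun _ y => (Ψ y ⬝ᵥ v) ^ 2) ≤ 9 / 8 * featSq D Ψ v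
  bias : ∀ w v : Fin d → ℝ,
    |pairMean p P (fun x y => w ⬝ᵥ sampleOp Ψ x y v) - w ⬝ᵥ (opMatrix D P Ψ).mulVec v| ≤
      η / 2 * (featSq D Ψ w + featSq D Ψ v)

/-- The hypothesis on ε is shaped for the bias: √μ converts one Euclidean norm to ‖Ψ ·‖_D, and ‖I -
P‖ comes from the drift. The second moments do not contain ‖I - P‖, so it has to be cancelled there:
the bound gap ≤ 2 ‖I - P‖ turns η ≤ gap / 845 into η ≤ ‖I - P‖ / 8. -/
lemma NearStationary.of_mixing [Nonempty E] {μ gap η ε : ℝ} (hc : StationaryChain D P)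
    (hm : StronglyMonotone D P Ψ μ gap) (hη : η ≤ gap / 845)
    (hε : ε / √(⨅ x, D x) * specNorm Ψ * specNorm (1 - P) ≤ √μ * η)
    {p : E → ℝ} (hp0 : ∀ x, 0 ≤ p x) (hp1 : ∑ x, p x = 1) (hp : ∑ x, |p x - D x| ≤ ε) :
    NearStationary D P Ψ η p := by
  have hε0 : 0 ≤ ε := (Finset.sum_nonneg fun x _ => abs_nonneg _).trans hp
  have hη0 : 0 ≤ η := by
    have h1 : 0 ≤ ε / √(⨅ x, D x) * specNorm Ψ * specNorm (1 - P) := by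
      have := specNorm_nonneg (1 - P)
      have := specNorm_nonneg Ψ
      positivity
    exact nonneg_of_mul_nonneg_right (h1.trans hε) (Real.sqrt_pos.2 hm.mu_pos)
  have hmu : ∀ v : Fin d → ℝ, √μ * √(v ⬝ᵥ v) ≤ √(featSq D Ψ v) := fun v => by
    rw [← Real.sqrt_mul hm.mu_pos.le]
    exact Real.sqrt_le_sqrt (hm.mu_le v)
  have hsq : ∀ δ : E → ℝ, ∑ x, |δ x| ≤ ε → ∀ v : Fin d → ℝ,
      ∑ x, δ x * (Ψ x ⬝ᵥ v) ^ 2 ≤ 1 / 8 * featSq D Ψ v := by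
    intro δ hδ v
    have hf0 := featSq_nonneg hc.pos Ψ v
    rcases hf0.eq_or_lt with h0 | hpos
    · have := mulVec_eq_zero_of_featSq hc.pos h0.symm
      have h2 : ∀ x, Ψ x ⬝ᵥ v = 0 := fun x => congrFun this x
      simp [h2, ← h0]
    have hgap : gap ≤ 2 * specNorm (1 - P) := by
      have h1 := hm.gap_le v
      rw [← monoConst_form hc] at h1
      have h2 := h1.trans (form_le_two_specNorm hc (Ψ.mulVec v))
      exact le_of_mul_le_mul_right h2 hpos
    have hs : 0 < specNorm (1 - P) := by linarith [hm.gap_pos]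
    have hηs : η ≤ specNorm (1 - P) / 8 := by linarith
    have h1 := abs_sum_mul_mul_le (a := fun x => Ψ x ⬝ᵥ v) (b := fun x => Ψ x ⬝ᵥ v) hδ
    have h2 := sqrt_sum_sq_mulVec_le Ψ v
    have h3 := sqrt_iInf_mul_le hc.pos (Ψ.mulVec v)
    rw [← dot_self_eq_sum_sq v] at h2
    have hΨ0 := specNorm_nonneg Ψ
    have h4 : specNorm (1 - P) * ∑ x, δ x * (Ψ x ⬝ᵥ v) ^ 2 ≤ η * featSq D Ψ v := by
      calc specNorm (1 - P) * ∑ x, δ x * (Ψ x ⬝ᵥ v) ^ 2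
          = specNorm (1 - P) * ∑ x, δ x * (Ψ x ⬝ᵥ v) * (Ψ x ⬝ᵥ v) := by
            simp only [sq, mul_assoc]
        _ ≤ specNorm (1 - P) * (ε * (√(∑ x, (Ψ.mulVec v x) ^ 2) * √(∑ x, (Ψ.mulVec v x) ^ 2))) :=
            mul_le_mul_of_nonneg_left ((le_abs_self _).trans h1) hs.le
        _ ≤ specNorm (1 - P) * (ε * ((specNorm Ψ * √(v ⬝ᵥ v)) *
              (√(normSqD D (Ψ.mulVec v)) / √(⨅ x, D x)))) := by gcongr
        _ = (ε / √(⨅ x, D x) * specNorm Ψ * specNorm (1 - P)) *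
              (√(v ⬝ᵥ v) * √(featSq D Ψ v)) := by rw [featSq]; ring
        _ ≤ (√μ * η) * (√(v ⬝ᵥ v) * √(featSq D Ψ v)) :=
            mul_le_mul_of_nonneg_right hε (by positivity)
        _ = η * ((√μ * √(v ⬝ᵥ v)) * √(featSq D Ψ v)) := by ring
        _ ≤ η * (√(featSq D Ψ v) * √(featSq D Ψ v)) := by gcongr; exact hmu v
        _ = η * featSq D Ψ v := by rw [Real.mul_self_sqrt hf0]
    have h5 : specNorm (1 - P) * ∑ x, δ x * (Ψ x ⬝ᵥ v) ^ 2 ≤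
        specNorm (1 - P) * (1 / 8 * featSq D Ψ v) := by
      refine h4.trans ?_
      calc η * featSq D Ψ v ≤ specNorm (1 - P) / 8 * featSq D Ψ v := by gcongr
        _ = _ := by ring
    exact le_of_mul_le_mul_left h5 hs
  refine ⟨hp0, hp1, fun v => ?_, fun v => ?_, fun w v => ?_⟩
  · have h := hsq (fun x => p x - D x) hp v
    simp only [sub_mul, Finset.sum_sub_distrib] at h
    have : ∑ x, D x * (Ψ x ⬝ᵥ v) ^ 2 = featSq D Ψ v := rfl
    linarith
  -- A stochastic matrix contracts the ℓ¹ norm, so the second coordinate is at least as close to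
  -- stationarity as the first.
  · have hδ : ∑ y, |∑ x, (p x - D x) * P x y| ≤ ε := by
      refine le_trans ?_ hp
      calc ∑ y, |∑ x, (p x - D x) * P x y| ≤ ∑ y, ∑ x, |p x - D x| * P x y := by
            refine Finset.sum_le_sum fun y _ => (Finset.abs_sum_le_sum_abs _ _).trans
              (Finset.sum_le_sum fun x _ => ?_)
            rw [abs_mul, abs_of_nonneg (hc.nonneg x y)]
        _ = ∑ x, |p x - D x| := by
            rw [Finset.sum_comm]
            simp only [← Finset.mul_sum, hc.row, mul_one]
    have h := hsq _ hδ v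
    rw [pairMean_snd (fun y => (Ψ y ⬝ᵥ v) ^ 2)]
    simp only [sub_mul, Finset.sum_sub_distrib, hc.stat] at h
    have : ∑ x, D x * (Ψ x ⬝ᵥ v) ^ 2 = featSq D Ψ v := rfl
    linarith
  · rw [dot_opMatrix hc, pairMean_feature hc.row, pairMean_feature hc.row,
      ← Finset.sum_sub_distrib]
    have h := abs_bias_le (P := P) hc.pos hp hε w (Ψ.mulVec v)
    have e : ∀ x, p x * (Ψ x ⬝ᵥ w) * ((1 - P).mulVec (Ψ.mulVec v)) x -
        D x * (Ψ x ⬝ᵥ w) * ((1 - P).mulVec (Ψ.mulVec v)) x =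
        (p x - D x) * (Ψ x ⬝ᵥ w) * ((1 - P).mulVec (Ψ.mulVec v)) x := fun x => by ring
    simp only [e]
    refine h.trans ?_
    have h1 := hmu w
    have hw0 := featSq_nonneg hc.pos Ψ w
    have hv0 := featSq_nonneg hc.pos Ψ v
    calc √μ * η * (√(w ⬝ᵥ w) * √(featSq D Ψ v))
        = η * ((√μ * √(w ⬝ᵥ w)) * √(featSq D Ψ v)) := by ring
      _ ≤ η * (√(featSq D Ψ w) * √(featSq D Ψ v)) := by gcongr
      _ ≤ η * (1 / 2 * (featSq D Ψ w + featSq D Ψ v)) := by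
          refine mul_le_mul_of_nonneg_left ?_ hη0
          nlinarith [sq_nonneg (√(featSq D Ψ w) - √(featSq D Ψ v)), Real.sq_sqrt hw0,
            Real.sq_sqrt hv0]
      _ = _ := by ring

namespace NearStationary

variable {η : ℝ} {p : E → ℝ}

lemma sampleOp_le (hn : NearStationary D P Ψ η p) (hc : StationaryChain D P)
    (hψ : ∀ x, Ψ x ⬝ᵥ Ψ x ≤ 1) (v : Fin d → ℝ) :
    pairMean p P (fun x y => sampleOp Ψ x y v ⬝ᵥ sampleOp Ψ x y v) ≤ 9 / 2 * featSq D Ψ v := by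
  have h1 : pairMean p P (fun x y => sampleOp Ψ x y v ⬝ᵥ sampleOp Ψ x y v) ≤
      pairMean p P fun x y => (Ψ x ⬝ᵥ v - Ψ y ⬝ᵥ v) ^ 2 :=
    pairMean_mono hn.nonneg hc.nonneg fun x y => by
      have := sampleOp_self_le hψ x y v
      rwa [sub_dotProduct] at this
  have h2 := pairMean_sub_sq_le (P := P) p hn.nonneg hc.nonneg fun x => Ψ x ⬝ᵥ v
  rw [pairMean_fst hc.row fun x => (Ψ x ⬝ᵥ v) ^ 2] at h2
  linarith [hn.sq_le v, hn.sq_le' v]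

/-- The cross term is -2 |a|² only up to the bias. For η ≤ 1/2 the bias adds at most half of ‖Ψ
v‖_D², and its part in a is absorbed by the remaining -|a|²; thus 9/2 becomes 5. -/
lemma centered_le (hn : NearStationary D P Ψ η p) (hc : StationaryChain D P)
    (hψ : ∀ x, Ψ x ⬝ᵥ Ψ x ≤ 1) (hη0 : 0 ≤ η) (hη : η ≤ 1 / 2) (v : Fin d → ℝ) :
    pairMean p P (fun x y => (sampleOp Ψ x y v - (opMatrix D P Ψ).mulVec v) ⬝ᵥ
      (sampleOp Ψ x y v - (opMatrix D P Ψ).mulVec v)) ≤ 5 * featSq D Ψ v := by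
  set a := (opMatrix D P Ψ).mulVec v with ha
  have h : ∀ x y, (sampleOp Ψ x y v - a) ⬝ᵥ (sampleOp Ψ x y v - a) =
      sampleOp Ψ x y v ⬝ᵥ sampleOp Ψ x y v - 2 * (a ⬝ᵥ sampleOp Ψ x y v) + a ⬝ᵥ a := by
    intro x y
    rw [sub_dotProduct, dotProduct_sub, dotProduct_sub, dotProduct_comm _ a]
    ring
  simp only [h]
  rw [pairMean_add, pairMean_sub, pairMean_mul_left, pairMean_const hn.sum_eq hc.row]
  have h1 := hn.sampleOp_le hc hψ v
  have h2 := (abs_le.1 (hn.bias a v)).1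
  rw [← ha] at h2
  have h3 := featSq_le_dot hc hψ a
  have h4 := featSq_nonneg hc.pos Ψ v
  nlinarith [dotProduct_self_nonneg' a, featSq_nonneg hc.pos Ψ a]

end NearStationary

end Mixing

/-! ### Contraction of the inner loop under Markovian sampling. -/

section InnerLoop

open Matrix MeasureTheory

/-- In the application e, a and u are the means of |v_t|², ‖Ψ v_t‖_D² and the squared direction, and
z is the mean of ‖Ψ w‖_D². Telescoping `hs` and summing `hus` gives 2 η gap Σ a ≤ e 0 + 2 η² (60 Σ a
+ 27 T z). The bound on η absorbs the sum on the right, and the bound on T makes e 0 at most η gap T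
z / 64. -/
lemma sum_le_of_inner_recursion {e a u : ℕ → ℝ} {z μ gap η : ℝ} {T : ℕ} (he : ∀ t, 0 ≤ e t)
    (ha : ∀ t, 0 ≤ a t) (hu0 : ∀ t, 0 ≤ u t) (hz : 0 ≤ z) (hμ : 0 < μ) (hgap : 0 < gap)
    (hgap2 : gap ≤ 2) (hη : 0 < η) (hη2 : η ≤ gap / 845)
    (hT : 64 / (μ * gap * η) ≤ T) (hez : μ * e 0 ≤ z) (hu : u 0 ≤ 4 * z)
    (h0 : e 1 + 2 * η * gap * a 0 ≤ e 0 + η ^ 2 * u 0)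
    (hs : ∀ t, e (t + 2) + 2 * η * gap * a (t + 1) ≤ e (t + 1) +
      2 * η ^ 2 * (10 * a t + 4 * a (t + 1) + z + u t + 3 / 2 * u (t + 1)))
    (hus : ∀ t, u (t + 1) ≤ 10 * z + 18 * a t + 16 * η ^ 2 * u t) :
    ∑ t ∈ Finset.range T, a t ≤ T / 20 * z := by
  have hT0 : (0 : ℝ) < T := lt_of_lt_of_le (by positivity) hT
  obtain ⟨n, rfl⟩ : ∃ n, T = n + 1 := ⟨T - 1, by
    have : 0 < T := by exact_mod_cast hT0
    omega⟩
  have c1 : ∀ n, e (n + 1) + 2 * η * gap * ∑ t ∈ Finset.range (n + 1), a t ≤ e 0 +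
      2 * η ^ 2 * (10 * ∑ t ∈ Finset.range n, a t + 4 * ∑ t ∈ Finset.range (n + 1), a t +
        (n + 1) * z + ∑ t ∈ Finset.range n, u t + 3 / 2 * ∑ t ∈ Finset.range (n + 1), u t) := by
    intro n
    induction n with
    | zero =>
      simp only [Finset.range_zero, Finset.sum_empty]
      have := mul_nonneg (sq_nonneg η) (ha 0)
      have := mul_nonneg (sq_nonneg η) (hu0 0)
      have := mul_nonneg (sq_nonneg η) hz
      norm_num
      linarith
    | succ k ih =>
      have := hs k
      simp only [Finset.sum_range_succ _ (k + 1), Finset.sum_range_succ _ k] at ih ⊢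
      push_cast
      linarith
  have c2 : ∀ n : ℕ, ∑ t ∈ Finset.range (n + 1), u t ≤ 10 * (n + 1) * z +
      18 * ∑ t ∈ Finset.range n, a t + 16 * η ^ 2 * ∑ t ∈ Finset.range n, u t := by
    intro n
    induction n with
    | zero => simp; linarith
    | succ k ih =>
      have := hus k
      rw [Finset.sum_range_succ _ (k + 1)]
      simp only [Finset.sum_range_succ _ k] at ih ⊢
      push_cast
      linarith
  have h1 := c1 n
  have h2 := c2 n
  have hS1 : ∑ t ∈ Finset.range n, a t ≤ ∑ t ∈ Finset.range (n + 1), a t := by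
    rw [Finset.sum_range_succ]; linarith [ha n]
  have hU1 : ∑ t ∈ Finset.range n, u t ≤ ∑ t ∈ Finset.range (n + 1), u t := by
    rw [Finset.sum_range_succ]; linarith [hu0 n]
  have hS0 : 0 ≤ ∑ t ∈ Finset.range n, a t := Finset.sum_nonneg fun t _ => ha t
  have hU0 : 0 ≤ ∑ t ∈ Finset.range n, u t := Finset.sum_nonneg fun t _ => hu0 t
  push_cast at hT ⊢
  set S := ∑ t ∈ Finset.range (n + 1), a t
  set U := ∑ t ∈ Finset.range (n + 1), u t
  set S' := ∑ t ∈ Finset.range n, a t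
  set U' := ∑ t ∈ Finset.range n, u t
  set Tz := ((n : ℝ) + 1) * z with hTz
  have hTz0 : 0 ≤ Tz := by positivity
  have hη3 : η ≤ 2 / 845 := by linarith
  have hη4 : 16 * η ^ 2 ≤ 1 / 1000 := by nlinarith
  have h3 : U ≤ 10 * Tz + 18 * S + 1 / 1000 * U := by
    have : 16 * η ^ 2 * U' ≤ 1 / 1000 * U :=
      mul_le_mul hη4 hU1 hU0 (by norm_num)
    rw [hTz]
    linarith
  -- The left side is at most 14 S + Tz + (5/2) U, and `h3` bounds U by (1000/999) (10 Tz + 18 S).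
  have h4 : 10 * S' + 4 * S + Tz + U' + 3 / 2 * U ≤ 60 * S + 27 * Tz := by linarith
  have h5 : e 0 ≤ η * gap * (Tz / 64) := by
    rw [div_le_iff₀ (by positivity)] at hT
    have h6 : μ * e 0 ≤ μ * (η * gap * (Tz / 64)) := by
      rw [hTz]
      nlinarith
    exact le_of_mul_le_mul_left h6 hμ
  have h7 : 2 * η ^ 2 * (10 * S' + 4 * S + Tz + U' + 3 / 2 * U) ≤
      2 * (η * gap) * ((60 * S + 27 * Tz) / 845) := by
    calc 2 * η ^ 2 * (10 * S' + 4 * S + Tz + U' + 3 / 2 * U)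
        ≤ 2 * η ^ 2 * (60 * S + 27 * Tz) := by gcongr
      _ = 2 * η * η * (60 * S + 27 * Tz) := by ring
      _ ≤ 2 * η * (gap / 845) * (60 * S + 27 * Tz) := by
          have : 0 ≤ 60 * S + 27 * Tz := by linarith
          gcongr
      _ = _ := by ring
  have h8 : (η * gap) * (2 * S) ≤
      (η * gap) * (Tz / 64 + 2 * ((60 * S + 27 * Tz) / 845)) := by
    have := he (n + 1)
    linarith
  have h9 := le_of_mul_le_mul_left h8 (by positivity)
  have h10 : ((n : ℝ) + 1) / 20 * z = Tz / 20 := by rw [hTz]; ring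
  rw [h10]
  linarith

variable {E : Type*} [Fintype E] [DecidableEq E] {d : ℕ} {D : E → ℝ} {P : Matrix E E ℝ}
  {Ψ : Matrix E (Fin d) ℝ}

/-- Deviation of the inner iterates from the fixed point of the epoch; `w` is the deviation of the
initial point, and the sample of step `t` is taken at time `s + (τ + 1) t + τ`. -/
def innerDev (D : E → ℝ) (P : Matrix E E ℝ) (Ψ : Matrix E (Fin d) ℝ) (η : ℝ) (s τ : ℕ)
    (w : (ℕ → E) → Fin d → ℝ) : ℕ → (ℕ → E) → Fin d → ℝ
  | 0 => w
  | t + 1 => fun x => innerDev D P Ψ η s τ w t x -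
      η • (sampleOp Ψ (x (s + (τ + 1) * t + τ)) (x (s + (τ + 1) * t + τ + 1))
        (innerDev D P Ψ η s τ w t x - w x) + (opMatrix D P Ψ).mulVec (w x))

/-- The direction of the step `t` of `innerDev`. -/
def innerDir (D : E → ℝ) (P : Matrix E E ℝ) (Ψ : Matrix E (Fin d) ℝ) (η : ℝ) (s τ : ℕ)
    (w : (ℕ → E) → Fin d → ℝ) (t : ℕ) (x : ℕ → E) : Fin d → ℝ :=
  sampleOp Ψ (x (s + (τ + 1) * t + τ)) (x (s + (τ + 1) * t + τ + 1))
    (innerDev D P Ψ η s τ w t x - w x) + (opMatrix D P Ψ).mulVec (w x)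

variable {η : ℝ} {s τ : ℕ} {w : (ℕ → E) → Fin d → ℝ}

lemma innerDev_succ (t : ℕ) (x : ℕ → E) : innerDev D P Ψ η s τ w (t + 1) x =
    innerDev D P Ψ η s τ w t x - η • innerDir D P Ψ η s τ w t x := rfl

lemma adapted_innerDev (hw : Adapted s w) (t : ℕ) :
    Adapted (s + (τ + 1) * t) (innerDev D P Ψ η s τ w t) := by
  induction t with
  | zero => exact hw
  | succ t ih =>
    intro x y hxy
    have h1 : innerDev D P Ψ η s τ w t x = innerDev D P Ψ η s τ w t y :=
      ih fun i hi => hxy i (by simp only [Set.mem_Iic] at hi ⊢; nlinarith)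
    have h2 : w x = w y := hw fun i hi => hxy i (by simp only [Set.mem_Iic] at hi ⊢; nlinarith)
    have h3 : x (s + (τ + 1) * t + τ) = y (s + (τ + 1) * t + τ) :=
      hxy _ (by simp only [Set.mem_Iic]; nlinarith)
    have h4 : x (s + (τ + 1) * t + τ + 1) = y (s + (τ + 1) * t + τ + 1) :=
      hxy _ (by simp only [Set.mem_Iic]; nlinarith)
    simp only [innerDev, h1, h2, h3, h4]

lemma adapted_innerDir (hw : Adapted s w) (t : ℕ) :
    Adapted (s + (τ + 1) * (t + 1)) (innerDir D P Ψ η s τ w t) := by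
  intro x y hxy
  have h1 : innerDev D P Ψ η s τ w t x = innerDev D P Ψ η s τ w t y :=
    adapted_innerDev hw t fun i hi => hxy i (by simp only [Set.mem_Iic] at hi ⊢; nlinarith)
  have h2 : w x = w y := hw fun i hi => hxy i (by simp only [Set.mem_Iic] at hi ⊢; nlinarith)
  have h3 : x (s + (τ + 1) * t + τ) = y (s + (τ + 1) * t + τ) :=
    hxy _ (by simp only [Set.mem_Iic]; nlinarith)
  have h4 : x (s + (τ + 1) * t + τ + 1) = y (s + (τ + 1) * t + τ + 1) :=
    hxy _ (by simp only [Set.mem_Iic]; nlinarith)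
  simp only [innerDir, h1, h2, h3, h4]

lemma smul_dot_self (c : ℝ) (u : Fin d → ℝ) : (c • u) ⬝ᵥ (c • u) = c ^ 2 * (u ⬝ᵥ u) := by
  rw [smul_dotProduct, dotProduct_smul, smul_eq_mul, smul_eq_mul]
  ring

lemma sub_smul_dot_self (v u : Fin d → ℝ) (c : ℝ) :
    (v - c • u) ⬝ᵥ (v - c • u) = v ⬝ᵥ v - 2 * c * (v ⬝ᵥ u) + c ^ 2 * (u ⬝ᵥ u) := by
  rw [sub_dotProduct, dotProduct_sub, dotProduct_sub, smul_dotProduct, smul_dot_self,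
    dotProduct_smul, smul_eq_mul, smul_eq_mul, dotProduct_comm u v]
  ring

lemma sub_dot_self_le (v u : Fin d → ℝ) :
    (v - u) ⬝ᵥ (v - u) ≤ 2 * (v ⬝ᵥ v) + 2 * (u ⬝ᵥ u) := by
  have h := dotProduct_add_self_le v (-u) one_pos
  rw [← sub_eq_add_neg, dotProduct_neg, neg_dotProduct, neg_neg] at h
  linarith

/-- Growth of the step direction along one step. -/
lemma dir_self_le (hψ : ∀ x, Ψ x ⬝ᵥ Ψ x ≤ 1) (b v u : Fin d → ℝ) (x y : E) :
    (sampleOp Ψ x y (v - η • u - b) + (opMatrix D P Ψ).mulVec b) ⬝ᵥ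
        (sampleOp Ψ x y (v - η • u - b) + (opMatrix D P Ψ).mulVec b) ≤
      4 * (sampleOp Ψ x y v ⬝ᵥ sampleOp Ψ x y v) + 16 * η ^ 2 * (u ⬝ᵥ u) +
        2 * ((sampleOp Ψ x y b - (opMatrix D P Ψ).mulVec b) ⬝ᵥ
          (sampleOp Ψ x y b - (opMatrix D P Ψ).mulVec b)) := by
  have e : sampleOp Ψ x y (v - η • u - b) + (opMatrix D P Ψ).mulVec b =
      (sampleOp Ψ x y v - η • sampleOp Ψ x y u) -
        (sampleOp Ψ x y b - (opMatrix D P Ψ).mulVec b) := by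
    rw [sampleOp_sub, sampleOp_sub, sampleOp_smul]
    abel
  rw [e]
  have h1 := sub_dot_self_le (sampleOp Ψ x y v - η • sampleOp Ψ x y u)
    (sampleOp Ψ x y b - (opMatrix D P Ψ).mulVec b)
  have h2 := sub_dot_self_le (sampleOp Ψ x y v) (η • sampleOp Ψ x y u)
  rw [smul_dot_self] at h2
  have h3 := mul_le_mul_of_nonneg_left (sampleOp_self_le' hψ x y u) (sq_nonneg η)
  linarith

/-- One step of the inner iteration: `v` is the point before the previous step, `u` the previous
direction and `b` the initial point. -/
lemma inner_step_le {μ gap : ℝ} (hc : StationaryChain D P) (hψ : ∀ x, Ψ x ⬝ᵥ Ψ x ≤ 1)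
    (hm : StronglyMonotone D P Ψ μ gap) (hη : 0 ≤ η) (b v u v' u' : Fin d → ℝ) (x y : E)
    (hv' : v' = v - η • u)
    (hu' : u' = sampleOp Ψ x y (v' - b) + (opMatrix D P Ψ).mulVec b) :
    (v' - η • u') ⬝ᵥ (v' - η • u') + 2 * η * gap * featSq D Ψ v' ≤
      v' ⬝ᵥ v' - 2 * η * (v ⬝ᵥ sampleOp Ψ x y (v - b) - v ⬝ᵥ (opMatrix D P Ψ).mulVec (v - b)) +
        2 * η ^ 2 * (4 * (Ψ x ⬝ᵥ v) ^ 2 + 4 * featSq D Ψ v + u ⬝ᵥ u + 3 / 2 * (u' ⬝ᵥ u') +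
          4 * featSq D Ψ v') := by
  set A := opMatrix D P Ψ with hA
  -- Substituting v' = v - η u moves the fluctuation of the sample onto the older point v, where
  -- mixing controls its mean. Every correction carries an additional η and is bounded pathwise.
  have e1 : v' ⬝ᵥ u' = v' ⬝ᵥ A.mulVec v' +
      (v ⬝ᵥ sampleOp Ψ x y (v - b) - v ⬝ᵥ A.mulVec (v - b)) -
      η * (v ⬝ᵥ sampleOp Ψ x y u - v ⬝ᵥ A.mulVec u) - η * (u ⬝ᵥ (u' - A.mulVec v')) := by
    have h1 : u' - A.mulVec v' = sampleOp Ψ x y (v' - b) - A.mulVec (v' - b) := by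
      rw [hu', mulVec_sub]; abel
    have h2 : v' ⬝ᵥ u' = v' ⬝ᵥ A.mulVec v' + v' ⬝ᵥ (u' - A.mulVec v') := by
      rw [← dotProduct_add]; congr 1; abel
    have h3 : v' ⬝ᵥ (u' - A.mulVec v') = v ⬝ᵥ (u' - A.mulVec v') -
        η * (u ⬝ᵥ (u' - A.mulVec v')) := by
      nth_rewrite 1 [hv']
      rw [sub_dotProduct, smul_dotProduct, smul_eq_mul]
    have h4 : v ⬝ᵥ (u' - A.mulVec v') =
        (v ⬝ᵥ sampleOp Ψ x y (v - b) - v ⬝ᵥ A.mulVec (v - b)) -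
        η * (v ⬝ᵥ sampleOp Ψ x y u - v ⬝ᵥ A.mulVec u) := by
      have h5 : v' - b = (v - b) - η • u := by rw [hv']; abel
      rw [h1, h5, sampleOp_sub, sampleOp_smul, mulVec_sub A (v - b), mulVec_smul, dotProduct_sub,
        dotProduct_sub, dotProduct_sub, dotProduct_smul, dotProduct_smul, smul_eq_mul, smul_eq_mul]
      ring
    linarith
  have b1 := abs_dot_sampleOp_le hψ x y v u
  have b2 := abs_dot_opMatrix_le hc hψ v u
  have b3 : u ⬝ᵥ (u' - A.mulVec v') ≤ 1 / 2 * (u ⬝ᵥ u) + u' ⬝ᵥ u' + 4 * featSq D Ψ v' := by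
    have h1 := dotProduct_le_of_pos u (u' - A.mulVec v') one_pos
    have h2 := sub_dot_self_le u' (A.mulVec v')
    have h3 := opMatrix_self_le hc hψ v'
    linarith [le_abs_self (u ⬝ᵥ (u' - A.mulVec v'))]
  have b4 := hm.gap_le v'
  have b5 : v ⬝ᵥ sampleOp Ψ x y u - v ⬝ᵥ A.mulVec u ≤
      4 * (Ψ x ⬝ᵥ v) ^ 2 + 4 * featSq D Ψ v + 1 / 2 * (u ⬝ᵥ u) := by
    linarith [le_abs_self (v ⬝ᵥ sampleOp Ψ x y u), neg_abs_le (v ⬝ᵥ A.mulVec u)]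
  rw [sub_smul_dot_self, e1]
  have c1 := mul_le_mul_of_nonneg_left b4 hη
  have c2 := mul_le_mul_of_nonneg_left b3 (sq_nonneg η)
  have c3 := mul_le_mul_of_nonneg_left b5 (sq_nonneg η)
  nlinarith [c1, c2, c3]

lemma StronglyMonotone.gap_le_two {μ gap : ℝ} (hc : StationaryChain D P)
    (hm : StronglyMonotone D P Ψ μ gap) (hd : 0 < d) : gap ≤ 2 := by
  set v : Fin d → ℝ := fun _ => 1
  have hv : 0 < v ⬝ᵥ v := by simp [v, dotProduct, hd]
  have hf : 0 < featSq D Ψ v := lt_of_lt_of_le (mul_pos hm.mu_pos hv) (hm.mu_le v)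
  have h1 := hm.gap_le v
  rw [← monoConst_form hc, form_eq_half hc] at h1
  have h2 := pairMean_sub_sq_stat_le hc (Ψ.mulVec v)
  have h3 : normSqD D (Ψ.mulVec v) = featSq D Ψ v := rfl
  rw [h3] at h2
  exact le_of_mul_le_mul_right (by linarith) hf

variable {Ω : Type*} [MeasurableSpace Ω] {ℙ : Measure Ω} [IsProbabilityMeasure ℙ]
  {X : ℕ → Ω → E}

/-- The inner loop contracts the initial deviation, on average over the loop. -/
theorem sum_innerDev_le {μ gap : ℝ} (hX : IsTrajectory P X ℙ) (hc : StationaryChain D P)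
    (hψ : ∀ x, Ψ x ⬝ᵥ Ψ x ≤ 1) (hm : StronglyMonotone D P Ψ μ gap) (hd : 0 < d) (hη : 0 < η)
    (hη2 : η ≤ gap / 845) (hn : ∀ x, NearStationary D P Ψ η ((P ^ (2 * τ + 1)) x))
    {T : ℕ} (hT : 64 / (μ * gap * η) ≤ T) (hw : Adapted s w) :
    ∑ t ∈ Finset.range T, pathMean ℙ X (fun x => featSq D Ψ (innerDev D P Ψ η s τ w t x)) ≤
      T / 20 * pathMean ℙ X fun x => featSq D Ψ (w x) := by
  have hgap2 := hm.gap_le_two hc hd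
  have hf0 := fun v => featSq_nonneg hc.pos Ψ v
  have hd0 := fun v : Fin d → ℝ => dotProduct_self_nonneg' v
  set V := innerDev D P Ψ η s τ w with hV
  set U := innerDir D P Ψ η s τ w with hU
  have aV : ∀ t, Adapted (s + (τ + 1) * t) (V t) := adapted_innerDev hw
  have aU : ∀ t, Adapted (s + (τ + 1) * (t + 1)) (U t) := adapted_innerDir hw
  have aw : ∀ t, Adapted (s + (τ + 1) * t) w := fun t => hw.mono' (by omega)
  -- expectations of functions of the earlier point and of a new sample
  have samp : ∀ t (F : E → E → (Fin d → ℝ) → (Fin d → ℝ) → ℝ),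
      pathMean ℙ X (fun x => F (x (s + (τ + 1) * (t + 1) + τ))
        (x (s + (τ + 1) * (t + 1) + τ + 1)) (V t x) (w x)) =
      pathMean ℙ X (fun x => pairMean ((P ^ (2 * τ + 1)) (x (s + (τ + 1) * t))) P
        fun y y' => F y y' (V t x) (w x)) := by
    intro t F
    -- The sample of step t + 1 lies 2τ + 1 steps after the time by which `V t` is determined.
    have e : s + (τ + 1) * (t + 1) + τ = s + (τ + 1) * t + (2 * τ + 1) := by ring
    rw [e]
    exact hX.pathMean_pair (2 * τ + 1) (G := fun x y y' => F y y' (V t x) (w x))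
      fun y y' => (aV t).comp₂ (aw t) (F y y')
  have le_samp : ∀ t (F : E → E → (Fin d → ℝ) → (Fin d → ℝ) → ℝ)
      (H : (Fin d → ℝ) → (Fin d → ℝ) → ℝ),
      (∀ p, NearStationary D P Ψ η p → ∀ v b, pairMean p P (fun y y' => F y y' v b) ≤ H v b) →
      pathMean ℙ X (fun x => F (x (s + (τ + 1) * (t + 1) + τ))
        (x (s + (τ + 1) * (t + 1) + τ + 1)) (V t x) (w x)) ≤
      pathMean ℙ X (fun x => H (V t x) (w x)) := by
    intro t F H h
    rw [samp]
    refine hX.pathMean_mono (n := s + (τ + 1) * t) ?_ ((aV t).comp₂ (aw t) H)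
      fun x => h _ (hn _) _ _
    exact (aV t).comp₃ (aw t) (adapted_coord le_rfl) fun v b e =>
      pairMean ((P ^ (2 * τ + 1)) e) P fun y y' => F y y' v b
  have adS : ∀ t (F : E → E → (Fin d → ℝ) → (Fin d → ℝ) → ℝ),
      Adapted (s + (τ + 1) * (t + 2)) (fun x => F (x (s + (τ + 1) * (t + 1) + τ))
        (x (s + (τ + 1) * (t + 1) + τ + 1)) (V t x) (w x)) := by
    intro t F x y hxy
    have h1 : V t x = V t y := (aV t).mono' (by nlinarith) hxy
    have h2 : w x = w y := hw.mono' (by omega) hxy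
    have h3 : x (s + (τ + 1) * (t + 1) + τ) = y (s + (τ + 1) * (t + 1) + τ) :=
      hxy _ (by simp only [Set.mem_Iic]; nlinarith)
    have h4 : x (s + (τ + 1) * (t + 1) + τ + 1) = y (s + (τ + 1) * (t + 1) + τ + 1) :=
      hxy _ (by simp only [Set.mem_Iic]; nlinarith)
    simp only [h1, h2, h3, h4]
  refine sum_le_of_inner_recursion
    (e := fun t => pathMean ℙ X fun x => V t x ⬝ᵥ V t x)
    (u := fun t => pathMean ℙ X fun x => U t x ⬝ᵥ U t x) (μ := μ) (gap := gap) (η := η)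
    (fun t => pathMean_nonneg fun x => hd0 _) (fun t => pathMean_nonneg fun x => hf0 _)
    (fun t => pathMean_nonneg fun x => hd0 _) (pathMean_nonneg fun x => hf0 _) hm.mu_pos
    hm.gap_pos hgap2 hη hη2 hT ?_ ?_ ?_ ?_ ?_
  · rw [← pathMean_mul_left]
    exact hX.pathMean_mono (hw.comp fun v => μ * (v ⬝ᵥ v)) (hw.comp fun v => featSq D Ψ v)
      fun x => hm.mu_le _
  · rw [← pathMean_mul_left]
    refine hX.pathMean_mono ((aU 0).comp fun v => v ⬝ᵥ v)
      ((aw 1).comp fun v => 4 * featSq D Ψ v) fun x => ?_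
    have e : U 0 x = (opMatrix D P Ψ).mulVec (w x) := by
      simp [hU, innerDir, innerDev, sampleOp]
    rw [e]
    exact opMatrix_self_le hc hψ _
  -- At the first step the iterate equals the initial point, so the sampled part vanishes, the
  -- direction is exactly A w, and no conditioning is needed.
  · have a0 : Adapted (s + (τ + 1) * (0 + 1)) (V 0) := (aV 0).mono' (by nlinarith)
    have aw1 : Adapted (s + (τ + 1) * (0 + 1)) w := aw 1
    have h : pathMean ℙ X (fun x => V 1 x ⬝ᵥ V 1 x + (2 * η * gap) * featSq D Ψ (V 0 x)) ≤
        pathMean ℙ X (fun x => V 0 x ⬝ᵥ V 0 x + η ^ 2 * (U 0 x ⬝ᵥ U 0 x)) := by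
      refine hX.pathMean_mono (n := s + (τ + 1) * (0 + 1))
        ((aV 1).comp₂ a0 fun v v' => v ⬝ᵥ v + (2 * η * gap) * featSq D Ψ v')
        (a0.comp₂ (aU 0) fun v u => v ⬝ᵥ v + η ^ 2 * (u ⬝ᵥ u)) fun x => ?_
      have e : U 0 x = (opMatrix D P Ψ).mulVec (V 0 x) := by
        simp [hU, hV, innerDir, innerDev, sampleOp]
      have e1 : V 1 x = V 0 x - η • U 0 x := innerDev_succ 0 x
      rw [e1, sub_smul_dot_self]
      have := mul_le_mul_of_nonneg_left (hm.gap_le (V 0 x)) hη.le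
      rw [← e] at this
      linarith
    rw [hX.pathMean_add ((aV 1).comp fun v => v ⬝ᵥ v)
        (a0.comp fun v => (2 * η * gap) * featSq D Ψ v),
      hX.pathMean_add (a0.comp fun v => v ⬝ᵥ v) ((aU 0).comp fun v => η ^ 2 * (v ⬝ᵥ v)),
      pathMean_mul_left, pathMean_mul_left] at h
    exact h
  · intro t
    -- F gathers the terms of `inner_step_le` that combine the fresh sample with the older iterate;
    -- only these are averaged through the conditional law.
    set F : E → E → (Fin d → ℝ) → (Fin d → ℝ) → ℝ := fun y y' v b =>
      -(2 * η) * (v ⬝ᵥ sampleOp Ψ y y' (v - b) - v ⬝ᵥ (opMatrix D P Ψ).mulVec (v - b)) +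
        8 * η ^ 2 * (Ψ y ⬝ᵥ v) ^ 2 with hF
    have hFle : pathMean ℙ X (fun x => F (x (s + (τ + 1) * (t + 1) + τ))
        (x (s + (τ + 1) * (t + 1) + τ + 1)) (V t x) (w x)) ≤
        12 * η ^ 2 * pathMean ℙ X (fun x => featSq D Ψ (V t x)) +
          2 * η ^ 2 * pathMean ℙ X (fun x => featSq D Ψ (w x)) := by
      rw [← pathMean_mul_left, ← pathMean_mul_left,
        ← hX.pathMean_add ((aV t).comp fun v => 12 * η ^ 2 * featSq D Ψ v)
          ((aw t).comp fun v => 2 * η ^ 2 * featSq D Ψ v)]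
      refine le_samp t F (fun v b => 12 * η ^ 2 * featSq D Ψ v + 2 * η ^ 2 * featSq D Ψ b)
        fun p hp v b => ?_
      rw [hF, pairMean_add, pairMean_mul_left, pairMean_mul_left, pairMean_sub,
        pairMean_const hp.sum_eq hc.row, pairMean_fst hc.row fun y => (Ψ y ⬝ᵥ v) ^ 2]
      have h1 := (abs_le.1 (hp.bias v (v - b))).1
      have h2 := hp.sq_le v
      have h3 := featSq_sub_le hc.pos Ψ v b one_pos
      have h4 := mul_le_mul_of_nonneg_left h1 hη.le
      have h5 := mul_le_mul_of_nonneg_left h2 (sq_nonneg η)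
      have h6 := mul_le_mul_of_nonneg_left h3 (sq_nonneg η)
      nlinarith [h4, h5, h6]
    have aV2 : Adapted (s + (τ + 1) * (t + 2)) (V (t + 2)) := aV (t + 2)
    have aV1 : Adapted (s + (τ + 1) * (t + 2)) (V (t + 1)) := (aV (t + 1)).mono' (by nlinarith)
    have aV0 : Adapted (s + (τ + 1) * (t + 2)) (V t) := (aV t).mono' (by nlinarith)
    have aU1 : Adapted (s + (τ + 1) * (t + 2)) (U (t + 1)) := aU (t + 1)
    have aU0 : Adapted (s + (τ + 1) * (t + 2)) (U t) := (aU t).mono' (by nlinarith)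
    have aF := adS t F
    have b1 := (aV0.comp fun v => (8 * η ^ 2) * featSq D Ψ v)
    have b2 := (aU0.comp fun v => (2 * η ^ 2) * (v ⬝ᵥ v))
    have b3 := (aU1.comp fun v => (3 * η ^ 2) * (v ⬝ᵥ v))
    have b4 := (aV1.comp fun v => (8 * η ^ 2) * featSq D Ψ v)
    have b5 := (aV1.comp fun v => v ⬝ᵥ v)
    have h : pathMean ℙ X (fun x => V (t + 2) x ⬝ᵥ V (t + 2) x +
          (2 * η * gap) * featSq D Ψ (V (t + 1) x)) ≤
        pathMean ℙ X (fun x => V (t + 1) x ⬝ᵥ V (t + 1) x +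
          (F (x (s + (τ + 1) * (t + 1) + τ)) (x (s + (τ + 1) * (t + 1) + τ + 1)) (V t x) (w x) +
          ((8 * η ^ 2) * featSq D Ψ (V t x) + ((2 * η ^ 2) * (U t x ⬝ᵥ U t x) +
          ((3 * η ^ 2) * (U (t + 1) x ⬝ᵥ U (t + 1) x) +
            (8 * η ^ 2) * featSq D Ψ (V (t + 1) x)))))) := by
      refine hX.pathMean_mono (n := s + (τ + 1) * (t + 2))
        (aV2.comp₂ aV1 fun v v' => v ⬝ᵥ v + (2 * η * gap) * featSq D Ψ v')
        (b5.comp₂ (aF.comp₂ (b1.comp₂ (b2.comp₂ (b3.comp₂ b4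
          fun x y => x + y) fun x y => x + y) fun x y => x + y) fun x y => x + y)
          fun x y => x + y) fun x => ?_
      have e2 : V (t + 2) x = V (t + 1) x - η • U (t + 1) x := innerDev_succ (t + 1) x
      have := inner_step_le hc hψ hm hη.le (w x) (V t x) (U t x) (V (t + 1) x) (U (t + 1) x)
        (x (s + (τ + 1) * (t + 1) + τ)) (x (s + (τ + 1) * (t + 1) + τ + 1))
        (innerDev_succ t x) rfl
      rw [e2, hF]
      linarith
    rw [hX.pathMean_add (aV2.comp fun v => v ⬝ᵥ v)
        (aV1.comp fun v => (2 * η * gap) * featSq D Ψ v),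
      hX.pathMean_add b5 (aF.comp₂ (b1.comp₂ (b2.comp₂ (b3.comp₂ b4
          fun x y => x + y) fun x y => x + y) fun x y => x + y) fun x y => x + y),
      hX.pathMean_add aF (b1.comp₂ (b2.comp₂ (b3.comp₂ b4
          fun x y => x + y) fun x y => x + y) fun x y => x + y),
      hX.pathMean_add b1 (b2.comp₂ (b3.comp₂ b4 fun x y => x + y) fun x y => x + y),
      hX.pathMean_add b2 (b3.comp₂ b4 fun x y => x + y), hX.pathMean_add b3 b4,
      pathMean_mul_left, pathMean_mul_left, pathMean_mul_left, pathMean_mul_left,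
      pathMean_mul_left] at h
    linarith
  · intro t
    set F : E → E → (Fin d → ℝ) → (Fin d → ℝ) → ℝ := fun y y' v b =>
      4 * (sampleOp Ψ y y' v ⬝ᵥ sampleOp Ψ y y' v) +
        2 * ((sampleOp Ψ y y' b - (opMatrix D P Ψ).mulVec b) ⬝ᵥ
          (sampleOp Ψ y y' b - (opMatrix D P Ψ).mulVec b)) with hF
    have hFle : pathMean ℙ X (fun x => F (x (s + (τ + 1) * (t + 1) + τ))
        (x (s + (τ + 1) * (t + 1) + τ + 1)) (V t x) (w x)) ≤
        18 * pathMean ℙ X (fun x => featSq D Ψ (V t x)) +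
          10 * pathMean ℙ X (fun x => featSq D Ψ (w x)) := by
      rw [← pathMean_mul_left, ← pathMean_mul_left,
        ← hX.pathMean_add ((aV t).comp fun v => 18 * featSq D Ψ v)
          ((aw t).comp fun v => 10 * featSq D Ψ v)]
      refine le_samp t F (fun v b => 18 * featSq D Ψ v + 10 * featSq D Ψ b) fun p hp v b => ?_
      rw [hF, pairMean_add, pairMean_mul_left, pairMean_mul_left]
      linarith [hp.sampleOp_le hc hψ v, hp.centered_le hc hψ hη.le (by linarith) b]
    have aU1 : Adapted (s + (τ + 1) * (t + 2)) (U (t + 1)) := aU (t + 1)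
    have aU0 : Adapted (s + (τ + 1) * (t + 2)) (U t) := (aU t).mono' (by nlinarith)
    have aF := adS t F
    have b2 := (aU0.comp fun v => (16 * η ^ 2) * (v ⬝ᵥ v))
    have h : pathMean ℙ X (fun x => U (t + 1) x ⬝ᵥ U (t + 1) x) ≤
        pathMean ℙ X (fun x => F (x (s + (τ + 1) * (t + 1) + τ))
          (x (s + (τ + 1) * (t + 1) + τ + 1)) (V t x) (w x) +
          (16 * η ^ 2) * (U t x ⬝ᵥ U t x)) := by
      refine hX.pathMean_mono (n := s + (τ + 1) * (t + 2)) (aU1.comp fun v => v ⬝ᵥ v)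
        (aF.comp₂ b2 fun x y => x + y) fun x => ?_
      have := dir_self_le (D := D) (P := P) (η := η) hψ (w x) (V t x) (U t x)
        (x (s + (τ + 1) * (t + 1) + τ)) (x (s + (τ + 1) * (t + 1) + τ + 1))
      rw [← innerDev_succ] at this
      refine this.trans (le_of_eq ?_)
      rw [hF]
      ring
    rw [hX.pathMean_add aF b2, pathMean_mul_left] at h
    linarith

end InnerLoop

/-! ### Second moments of the skipped sums of costs and of operator noise. -/

section Batch

open Matrix MeasureTheory

variable {E : Type*} [Fintype E] [DecidableEq E] {d : ℕ} {D : E → ℝ} {P : Matrix E E ℝ}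
  {Ψ : Matrix E (Fin d) ℝ} {CP r : ℝ}
  {Ω : Type*} [MeasurableSpace Ω] {ℙ : Measure Ω} [IsProbabilityMeasure ℙ]
  {X : ℕ → Ω → E}

/-- Geometric mixing of the state-action chain, which starts one step later than that of the state
chain. -/
def DelayedMixing (D : E → ℝ) (P : Matrix E E ℝ) (CP r : ℝ) : Prop :=
  ∀ (m : ℕ) (x : E), ∑ y, |(P ^ (m + 1)) x y - D y| ≤ CP * r ^ m

lemma pow_nonneg' (hc : StationaryChain D P) (m : ℕ) (x y : E) : 0 ≤ (P ^ m) x y := by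
  induction m generalizing y with
  | zero => rw [pow_zero, Matrix.one_apply]; split_ifs <;> norm_num
  | succ m ih =>
    rw [pow_succ, Matrix.mul_apply]
    exact Finset.sum_nonneg fun z _ => mul_nonneg (ih z) (hc.nonneg z y)

lemma pow_row (hc : StationaryChain D P) (m : ℕ) (x : E) : ∑ y, (P ^ m) x y = 1 := by
  induction m with
  | zero => simp [Matrix.one_apply]
  | succ m ih =>
    simp only [pow_succ, Matrix.mul_apply]
    rw [Finset.sum_comm]
    simp only [← Finset.mul_sum, hc.row, mul_one, ih]

/-- The mixing error is at most the smallest weight of D, hence at most D y in every coordinate. -/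
lemma DelayedMixing.le_two_mul (hmix : DelayedMixing D P CP r) (hCP : 0 ≤ CP) (hr0 : 0 ≤ r)
    (hr1 : r ≤ 1) {τ' m : ℕ} (hdens : CP * r ^ τ' ≤ ⨅ x, D x) (hm : τ' ≤ m) (x y : E) :
    (P ^ (m + 1)) x y ≤ 2 * D y := by
  have h1 : |(P ^ (m + 1)) x y - D y| ≤ CP * r ^ m :=
    (Finset.single_le_sum (f := fun y => |(P ^ (m + 1)) x y - D y|) (fun _ _ => abs_nonneg _)
      (Finset.mem_univ y)).trans (hmix m x)
  have h2 : CP * r ^ m ≤ CP * r ^ τ' :=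
    mul_le_mul_of_nonneg_left (pow_le_pow_of_le_one hr0 hr1 hm) hCP
  have h3 : ⨅ x, D x ≤ D y := ciInf_le (Set.finite_range D).bddBelow y
  linarith [le_abs_self ((P ^ (m + 1)) x y - D y)]

/-- A geometric series without its constant term: the condition on q amounts to C q ≤ (1 - q) / 4,
which is just what the induction preserves. -/
lemma mul_sum_pow_le {C q : ℝ} (hC : 0 ≤ C) (hq0 : 0 ≤ q) (hq : q ≤ 1 / (4 * C + 1)) (N : ℕ) :
    C * ∑ i ∈ Finset.range N, q ^ (N - i) ≤ 1 / 4 := by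
  induction N with
  | zero => norm_num
  | succ N ih =>
    have e : ∑ i ∈ Finset.range (N + 1), q ^ (N + 1 - i) =
        q * (∑ i ∈ Finset.range N, q ^ (N - i) + 1) := by
      rw [Finset.sum_range_succ, mul_add, Finset.mul_sum]
      congr 1
      · refine Finset.sum_congr rfl fun i hi => ?_
        have : N + 1 - i = N - i + 1 := by have := Finset.mem_range.1 hi; omega
        rw [this, pow_succ, mul_comm]
      · simp
    rw [e]
    rw [le_div_iff₀ (by positivity)] at hq
    nlinarith [mul_le_mul_of_nonneg_left ih hq0]

lemma pow_lag_le {r : ℝ} (hr0 : 0 ≤ r) (hr1 : r ≤ 1) (τ' j m : ℕ) (h : τ' * j ≤ m) :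
    r ^ m ≤ (r ^ τ') ^ j := by
  rw [← pow_mul]
  exact pow_le_pow_of_le_one hr0 hr1 h

/-- Second moment of the sum of centred costs along the skipped samples. -/
theorem sum_cost_sq_le (hX : IsTrajectory P X ℙ) (hc : StationaryChain D P)
    (hmix : DelayedMixing D P CP r) (hCP : 0 ≤ CP) (hr0 : 0 ≤ r) (hr1 : r ≤ 1) {τ' : ℕ}
    (hq : r ^ τ' ≤ 1 / (4 * CP + 1)) {c : E → ℝ} {cbar ρ : ℝ} (hcbar : ∀ x, |c x| ≤ cbar)
    (hρ : ρ = ∑ x, D x * c x) (s N : ℕ) :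
    pathMean ℙ X (fun x =>
      (∑ i ∈ Finset.range N, (c (x (s + (τ' + 1) * i + τ')) - ρ)) ^ 2) ≤ 5 * cbar ^ 2 * N := by
  have hρ' : |ρ| ≤ cbar := by
    rw [hρ]
    calc |∑ x, D x * c x| ≤ ∑ x, |D x * c x| := Finset.abs_sum_le_sum_abs _ _
      _ ≤ ∑ x, D x * cbar := Finset.sum_le_sum fun x _ => by
          rw [abs_mul, abs_of_pos (hc.pos x)]
          exact mul_le_mul_of_nonneg_left (hcbar x) (hc.pos x).le
      _ = cbar := by rw [← Finset.sum_mul, hc.sum_eq, one_mul]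
  have hcb0 : 0 ≤ cbar := (abs_nonneg _).trans hρ'
  have hf : ∀ x, |c x - ρ| ≤ 2 * cbar := fun x => by
    have := abs_sub (c x) ρ
    linarith [hcbar x]
  have hcond : ∀ (m : ℕ) (x : E), |∑ y, (P ^ (m + 1)) x y * (c y - ρ)| ≤ cbar * (CP * r ^ m) := by
    intro m x
    have e : ∑ y, (P ^ (m + 1)) x y * (c y - ρ) = ∑ y, ((P ^ (m + 1)) x y - D y) * c y := by
      simp only [mul_sub, sub_mul, Finset.sum_sub_distrib, ← Finset.sum_mul, pow_row hc, ← hρ,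
        one_mul]
    rw [e]
    calc |∑ y, ((P ^ (m + 1)) x y - D y) * c y|
        ≤ ∑ y, |((P ^ (m + 1)) x y - D y) * c y| := Finset.abs_sum_le_sum_abs _ _
      _ ≤ ∑ y, |(P ^ (m + 1)) x y - D y| * cbar := Finset.sum_le_sum fun y _ => by
          rw [abs_mul]
          exact mul_le_mul_of_nonneg_left (hcbar y) (abs_nonneg _)
      _ ≤ _ := by
          rw [← Finset.sum_mul, mul_comm]
          exact mul_le_mul_of_nonneg_left (hmix m x) hcb0
  set f : ℕ → (ℕ → E) → ℝ := fun i x => c (x (s + (τ' + 1) * i + τ')) - ρ with hfdef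
  have af : ∀ {i n}, i ≤ n → Adapted (s + (τ' + 1) * n + τ') (f i) := fun {i n} h =>
    (adapted_coord (E := E) (by nlinarith)).comp fun e => c e - ρ
  induction N with
  | zero => simp [pathMean_const]
  | succ N ih =>
    have hcross : ∀ i ∈ Finset.range N,
        pathMean ℙ X (fun x => 2 * (f i x * f N x)) ≤
          4 * cbar ^ 2 * (CP * (r ^ τ') ^ (N - i)) := by
      intro i hi
      have hiN := Finset.mem_range.1 hi
      obtain ⟨j, rfl⟩ : ∃ j, N = i + j + 1 := ⟨N - i - 1, by omega⟩
      -- Of the (τ' + 1)(j + 1) steps between the two samples one is spent on the delay of mixing,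
      -- and the rest still exceeds τ' (j + 1).
      have e : s + (τ' + 1) * (i + j + 1) + τ' =
          s + (τ' + 1) * i + τ' + ((τ' * (j + 1) + j) + 1) := by ring
      have h1 : pathMean ℙ X (fun x => f i x * f (i + j + 1) x) = pathMean ℙ X (fun x =>
          ∑ y, (P ^ ((τ' * (j + 1) + j) + 1)) (x (s + (τ' + 1) * i + τ')) y *
            (f i x * (c y - ρ))) := by
        rw [← hX.pathMean_lag _ (G := fun x y => f i x * (c y - ρ))
          fun y => (af le_rfl).comp fun t => t * (c y - ρ)]
        simp only [hfdef, e]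
      rw [pathMean_mul_left, h1]
      have h2 : pathMean ℙ X (fun x =>
          ∑ y, (P ^ ((τ' * (j + 1) + j) + 1)) (x (s + (τ' + 1) * i + τ')) y *
            (f i x * (c y - ρ))) ≤
          pathMean ℙ X (fun _ => 2 * cbar ^ 2 * (CP * (r ^ τ') ^ (j + 1))) := by
        refine hX.pathMean_mono (n := s + (τ' + 1) * i + τ')
          ((adapted_coord le_rfl).comp₂ (af le_rfl) fun e t =>
            ∑ y, (P ^ ((τ' * (j + 1) + j) + 1)) e y * (t * (c y - ρ)))
          (adapted_const _ _) fun x => ?_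
        have e2 : ∑ y, (P ^ ((τ' * (j + 1) + j) + 1)) (x (s + (τ' + 1) * i + τ')) y *
            (f i x * (c y - ρ)) = f i x *
            ∑ y, (P ^ ((τ' * (j + 1) + j) + 1)) (x (s + (τ' + 1) * i + τ')) y * (c y - ρ) := by
          rw [Finset.mul_sum]
          exact Finset.sum_congr rfl fun y _ => by ring
        rw [e2]
        refine (le_abs_self _).trans ?_
        rw [abs_mul]
        calc _ ≤ (2 * cbar) * (cbar * (CP * r ^ (τ' * (j + 1) + j))) :=
              mul_le_mul (hf _) (hcond _ _) (abs_nonneg _) (by positivity)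
          _ ≤ (2 * cbar) * (cbar * (CP * (r ^ τ') ^ (j + 1))) := by
              gcongr
              exact pow_lag_le hr0 hr1 τ' (j + 1) _ (by omega)
          _ = _ := by ring
      rw [pathMean_const] at h2
      have e3 : i + j + 1 - i = j + 1 := by omega
      rw [e3]
      linarith
    have hsq : pathMean ℙ X (fun x => f N x ^ 2) ≤ 4 * cbar ^ 2 := by
      rw [← pathMean_const (ℙ := ℙ) (X := X) (4 * cbar ^ 2)]
      refine hX.pathMean_mono ((af le_rfl).comp fun t => t ^ 2) (adapted_const _ _) fun x => ?_
      rw [← sq_abs]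
      nlinarith [hf (x (s + (τ' + 1) * N + τ')), abs_nonneg (f N x)]
    have aS : Adapted (s + (τ' + 1) * N + τ') fun x => ∑ i ∈ Finset.range N, f i x :=
      adapted_sum fun i hi => af (Finset.mem_range.1 hi).le
    have aC : ∀ i ∈ Finset.range N, Adapted (s + (τ' + 1) * N + τ')
        fun x => 2 * (f i x * f N x) := fun i hi =>
      (af (Finset.mem_range.1 hi).le).comp₂ (af le_rfl) fun a b => 2 * (a * b)
    have e : ∀ x : ℕ → E, (∑ i ∈ Finset.range (N + 1), f i x) ^ 2 =
        (∑ i ∈ Finset.range N, f i x) ^ 2 + (∑ i ∈ Finset.range N, 2 * (f i x * f N x) +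
          f N x ^ 2) := by
      intro x
      rw [Finset.sum_range_succ, ← Finset.mul_sum, ← Finset.sum_mul]
      ring
    change pathMean ℙ X (fun x => (∑ i ∈ Finset.range (N + 1), f i x) ^ 2) ≤ _
    change pathMean ℙ X (fun x => (∑ i ∈ Finset.range N, f i x) ^ 2) ≤ _ at ih
    simp only [e]
    rw [hX.pathMean_add (aS.comp fun t => t ^ 2)
        ((adapted_sum aC).comp₂ ((af le_rfl).comp fun t => t ^ 2) fun a b => a + b),
      hX.pathMean_add (adapted_sum aC) ((af le_rfl).comp fun t => t ^ 2), hX.pathMean_sum aC]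
    have h3 := Finset.sum_le_sum hcross
    rw [← Finset.mul_sum, ← Finset.mul_sum] at h3
    -- A new index adds 4 c̄² on the diagonal and 4 c̄² · 1/4 from all its correlations, in total 5
    -- c̄².
    have h4 := mul_sum_pow_le hCP (pow_nonneg hr0 τ') hq N
    have h5 := mul_le_mul_of_nonneg_left h4 (by positivity : 0 ≤ 4 * cbar ^ 2)
    push_cast
    linarith

lemma featSq_add (v w : Fin d → ℝ) : featSq D Ψ (v + w) =
    featSq D Ψ v + 2 * (v ⬝ᵥ (gram D Ψ).mulVec w) + featSq D Ψ w := by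
  rw [← dot_gram_self, ← dot_gram_self, ← dot_gram_self, mulVec_add, dotProduct_add,
    add_dotProduct, add_dotProduct, dotProduct_mulVec w, ← mulVec_transpose, gram_transpose,
    dotProduct_comm _ v]
  ring

lemma normSqD_add_le {D : E → ℝ} (hD : ∀ x, 0 < D x) (f g : E → ℝ) :
    normSqD D (f + g) ≤ 2 * normSqD D f + 2 * normSqD D g := by
  simp only [normSqD, Finset.mul_sum, ← Finset.sum_add_distrib, Pi.add_apply]
  refine Finset.sum_le_sum fun x _ => ?_
  nlinarith [mul_nonneg (hD x).le (sq_nonneg (f x - g x))]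

lemma normSqD_sub_le {D : E → ℝ} (hD : ∀ x, 0 < D x) (Q : E → ℝ) (θ θstar : Fin d → ℝ) :
    normSqD D (Ψ.mulVec θ - Q) ≤
      2 * normSqD D (Q - Ψ.mulVec θstar) + 2 * featSq D Ψ (θ - θstar) := by
  have e : Ψ.mulVec θ - Q = -(Q - Ψ.mulVec θstar) + Ψ.mulVec (θ - θstar) := by
    rw [mulVec_sub]; abel
  have e2 : normSqD D (-(Q - Ψ.mulVec θstar)) = normSqD D (Q - Ψ.mulVec θstar) := by
    simp only [normSqD, Pi.neg_apply, neg_sq]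
  rw [e, ← e2]
  exact normSqD_add_le hD _ _

/-- Young's inequality with weight 2/5 gives the factors 7/5 and 7/2; the latter meets the centred
second moment bound 4 and becomes 14. -/
lemma StronglyMonotone.noise_stat_le {μ gap : ℝ} (hc : StationaryChain D P)
    (hψ : ∀ x, Ψ x ⬝ᵥ Ψ x ≤ 1) (hm : StronglyMonotone D P Ψ μ gap) (c : E → ℝ) (ρ : ℝ)
    (θstar θ : Fin d → ℝ) :
    pairMean D P (fun x y => featSq D Ψ
        ((opMatrix D P Ψ)⁻¹.mulVec (noise D P Ψ c ρ θstar θ x y))) ≤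
      7 / 5 * pairMean D P (fun x y => featSq D Ψ
        ((opMatrix D P Ψ)⁻¹.mulVec (stochOp Ψ c θstar ρ x y))) +
      14 / (gap ^ 2 * μ) * featSq D Ψ (θ - θstar) := by
  have hg : 0 < gap ^ 2 * μ := mul_pos (pow_pos hm.gap_pos 2) hm.mu_pos
  have h1 := pairMean_mono (p := D) (P := P) (fun x => (hc.pos x).le) hc.nonneg
    (f := fun x y => featSq D Ψ ((opMatrix D P Ψ)⁻¹.mulVec (noise D P Ψ c ρ θstar θ x y)))
    (g := fun x y => 7 / 5 * featSq D Ψ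
        ((opMatrix D P Ψ)⁻¹.mulVec (stochOp Ψ c θstar ρ x y)) + 7 / 2 / (gap ^ 2 * μ) *
        ((sampleOp Ψ x y (θ - θstar) - (opMatrix D P Ψ).mulVec (θ - θstar)) ⬝ᵥ
          (sampleOp Ψ x y (θ - θstar) - (opMatrix D P Ψ).mulVec (θ - θstar)))) fun x y => by
      rw [noise_eq, mulVec_add]
      have h2 := featSq_add_le hc.pos Ψ
        ((opMatrix D P Ψ)⁻¹.mulVec (stochOp Ψ c θstar ρ x y))
        ((opMatrix D P Ψ)⁻¹.mulVec
          (sampleOp Ψ x y (θ - θstar) - (opMatrix D P Ψ).mulVec (θ - θstar)))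
        (c := 2 / 5) (by norm_num)
      have h3 := hm.featSq_inv_le
        (sampleOp Ψ x y (θ - θstar) - (opMatrix D P Ψ).mulVec (θ - θstar))
      generalize sampleOp Ψ x y (θ - θstar) - (opMatrix D P Ψ).mulVec (θ - θstar) = b at h2 h3 ⊢
      have h4 : 7 / 2 / (gap ^ 2 * μ) * (b ⬝ᵥ b) = 7 / 2 * ((b ⬝ᵥ b) / (gap ^ 2 * μ)) := by ring
      rw [h4]
      norm_num at h2
      linarith
  refine h1.trans ?_
  rw [pairMean_add, pairMean_mul_left, pairMean_mul_left]
  have h4 := pairMean_centered_stat_le hc hψ (θ - θstar)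
  have h5 : 7 / 2 / (gap ^ 2 * μ) * _ ≤ 7 / 2 / (gap ^ 2 * μ) * _ :=
    mul_le_mul_of_nonneg_left h4 (by positivity)
  have e : 7 / 2 / (gap ^ 2 * μ) * (4 * featSq D Ψ (θ - θstar)) =
      14 / (gap ^ 2 * μ) * featSq D Ψ (θ - θstar) := by ring
  linarith

/-- Correlation between the noise at a law `p` close to stationarity and an earlier vector. -/
lemma StronglyMonotone.noise_corr_le [Nonempty E] {μ gap : ℝ} (hc : StationaryChain D P)
    (hm : StronglyMonotone D P Ψ μ gap)
    {c Q : E → ℝ} {ρ : ℝ} (hQ : (1 - P).mulVec Q = fun x => c x - ρ)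
    {θstar : Fin d → ℝ} (hθ : ProjectedBellman D P Ψ c ρ θstar)
    {p : E → ℝ} (hp1 : ∑ x, p x = 1) {ε κ : ℝ} (hp : ∑ x, |p x - D x| ≤ ε) (hκ0 : 0 ≤ κ)
    (hκ : ε / √(⨅ x, D x) * specNorm Ψ * specNorm (1 - P) ≤ κ) (u θ : Fin d → ℝ) :
    pairMean p P (fun x y => u ⬝ᵥ (gram D Ψ).mulVec
        ((opMatrix D P Ψ)⁻¹.mulVec (noise D P Ψ c ρ θstar θ x y))) ≤
      κ * (1 / 4 * featSq D Ψ u + 2 / (gap ^ 2 * μ) *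
        (normSqD D (Q - Ψ.mulVec θstar) + featSq D Ψ (θ - θstar))) := by
  have hg : 0 < gap ^ 2 * μ := mul_pos (pow_pos hm.gap_pos 2) hm.mu_pos
  simp only [gram_dot_inv]
  set w := ((opMatrix D P Ψ)⁻¹ᵀ * gram D Ψ).mulVec u with hw
  rw [pairMean_noise hc hQ hθ hp1]
  refine (le_abs_self _).trans ((abs_bias_le hc.pos hp hκ w _).trans ?_)
  refine mul_le_mul_of_nonneg_left ?_ hκ0
  have h1 : w ⬝ᵥ w ≤ featSq D Ψ u / (gap ^ 2 * μ) := hm.adjoint_self_le hc u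
  have h2 := normSqD_sub_le (Ψ := Ψ) hc.pos Q θ θstar
  have h3 := normSqD_nonneg hc.pos (Ψ.mulVec θ - Q)
  have h4 := featSq_nonneg hc.pos Ψ u
  set n := normSqD D (Ψ.mulVec θ - Q)
  calc √(w ⬝ᵥ w) * √n ≤ √(featSq D Ψ u / (gap ^ 2 * μ)) * √n := by gcongr
    _ = √(featSq D Ψ u) * √(n / (gap ^ 2 * μ)) := by
        rw [← Real.sqrt_mul (by positivity), ← Real.sqrt_mul h4]
        congr 1
        ring
    _ ≤ 1 / 4 * featSq D Ψ u + n / (gap ^ 2 * μ) := by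
        have hn : 0 ≤ n / (gap ^ 2 * μ) := by positivity
        nlinarith [sq_nonneg (√(featSq D Ψ u) / 2 - √(n / (gap ^ 2 * μ))), Real.sq_sqrt h4,
          Real.sq_sqrt hn]
    _ ≤ _ := by
        have h5 := div_le_div_of_nonneg_right h2 hg.le
        have h6 : 2 / (gap ^ 2 * μ) * (normSqD D (Q - Ψ.mulVec θstar) + featSq D Ψ (θ - θstar)) =
            (2 * normSqD D (Q - Ψ.mulVec θstar) + 2 * featSq D Ψ (θ - θstar)) / (gap ^ 2 * μ) := by
          ring
        rw [h6]
        linarith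

/-- Second moment of the batch noise. -/
theorem sum_noise_featSq_le [Nonempty E] {μ gap : ℝ} (hX : IsTrajectory P X ℙ)
    (hc : StationaryChain D P)
    (hmix : DelayedMixing D P CP r) (hCP : 0 ≤ CP) (hr0 : 0 ≤ r) (hr1 : r ≤ 1) {τ' : ℕ}
    {C : ℝ} (hCM : constCM D P Ψ CP ≤ C) (hC0 : 0 ≤ C) (hq : r ^ τ' ≤ 1 / (4 * C + 1))
    (hdens : CP * r ^ τ' ≤ ⨅ x, D x)
    (hψ : ∀ x, Ψ x ⬝ᵥ Ψ x ≤ 1) (hm : StronglyMonotone D P Ψ μ gap)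
    {c Q : E → ℝ} {ρ : ℝ} (hQ : (1 - P).mulVec Q = fun x => c x - ρ)
    {θstar : Fin d → ℝ} (hθ : ProjectedBellman D P Ψ c ρ θstar)
    {n₀ s : ℕ} (hs : n₀ + τ' + 1 ≤ s) {θ : (ℕ → E) → Fin d → ℝ} (aθ : Adapted n₀ θ) (N : ℕ) :
    pathMean ℙ X (fun x => featSq D Ψ ((opMatrix D P Ψ)⁻¹.mulVec
      (∑ i ∈ Finset.range N, noise D P Ψ c ρ θstar (θ x) (x (s + (τ' + 1) * i + τ'))
        (x (s + (τ' + 1) * i + τ' + 1))))) ≤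
      N * (35 / 4 * pairMean D P (fun x y => featSq D Ψ
          ((opMatrix D P Ψ)⁻¹.mulVec (stochOp Ψ c θstar ρ x y))) +
        1 / (gap ^ 2 * μ) * normSqD D (Q - Ψ.mulVec θstar) +
        177 / 2 / (gap ^ 2 * μ) * pathMean ℙ X fun x => featSq D Ψ (θ x - θstar)) := by
  have hg : 0 < gap ^ 2 * μ := mul_pos (pow_pos hm.gap_pos 2) hm.mu_pos
  set n : ℕ → (ℕ → E) → Fin d → ℝ := fun i x => (opMatrix D P Ψ)⁻¹.mulVec
    (noise D P Ψ c ρ θstar (θ x) (x (s + (τ' + 1) * i + τ')) (x (s + (τ' + 1) * i + τ' + 1)))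
    with hn
  set tr := pairMean D P (fun x y => featSq D Ψ
    ((opMatrix D P Ψ)⁻¹.mulVec (stochOp Ψ c θstar ρ x y))) with htr
  set W := normSqD D (Q - Ψ.mulVec θstar) with hW
  set Eθ := pathMean ℙ X fun x => featSq D Ψ (θ x - θstar) with hEθ
  have aθ' : ∀ k, Adapted (n₀ + k) θ := fun k => aθ.mono' (Nat.le_add_right n₀ k)
  have an : ∀ {i k}, i ≤ k → Adapted (s + (τ' + 1) * k + τ' + 1) (n i) := by
    intro i k hik x y hxy
    have hle : (τ' + 1) * i ≤ (τ' + 1) * k := Nat.mul_le_mul_left _ hik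
    have h1 : θ x = θ y := aθ.mono' (by omega) hxy
    have h2 : x (s + (τ' + 1) * i + τ') = y (s + (τ' + 1) * i + τ') :=
      hxy _ (by simp only [Set.mem_Iic]; omega)
    have h3 : x (s + (τ' + 1) * i + τ' + 1) = y (s + (τ' + 1) * i + τ' + 1) :=
      hxy _ (by simp only [Set.mem_Iic]; omega)
    simp only [hn, h1, h2, h3]
  have hV : ∀ i, pathMean ℙ X (fun x => featSq D Ψ (n i x)) ≤
      14 / 5 * tr + 28 / (gap ^ 2 * μ) * Eθ := by
    intro i
    -- The gap between n₀ and s leaves at least τ' + 1 steps after θ is known, so the density bound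
    -- 2 applies to every sample.
    obtain ⟨m, hm1, hm2⟩ : ∃ m, τ' ≤ m ∧ s + (τ' + 1) * i + τ' = n₀ + (m + 1) :=
      ⟨s + (τ' + 1) * i + τ' - n₀ - 1, by omega, by omega⟩
    have h1 : pathMean ℙ X (fun x => featSq D Ψ (n i x)) =
        pathMean ℙ X (fun x => pairMean ((P ^ (m + 1)) (x n₀)) P fun y y' =>
          featSq D Ψ ((opMatrix D P Ψ)⁻¹.mulVec (noise D P Ψ c ρ θstar (θ x) y y'))) := by
      rw [← hX.pathMean_pair (m + 1) fun y y' => aθ.comp fun t =>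
        featSq D Ψ ((opMatrix D P Ψ)⁻¹.mulVec (noise D P Ψ c ρ θstar t y y'))]
      simp only [hn, hm2]
    rw [h1]
    calc _ ≤ pathMean ℙ X (fun x => 14 / 5 * tr +
          28 / (gap ^ 2 * μ) * featSq D Ψ (θ x - θstar)) := by
          refine hX.pathMean_mono (n := n₀) (aθ.comp₂ (adapted_coord le_rfl) fun t e =>
            pairMean ((P ^ (m + 1)) e) P fun y y' =>
              featSq D Ψ ((opMatrix D P Ψ)⁻¹.mulVec (noise D P Ψ c ρ θstar t y y')))
            (aθ.comp fun t => 14 / 5 * tr + 28 / (gap ^ 2 * μ) * featSq D Ψ (t - θstar))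
            fun x => ?_
          have h2 := pairMean_le_mul (p := (P ^ (m + 1)) (x n₀)) (q := D) (C := 2) hc.nonneg
            (fun y => hmix.le_two_mul hCP hr0 hr1 hdens hm1 (x n₀) y)
            (f := fun y y' => featSq D Ψ
              ((opMatrix D P Ψ)⁻¹.mulVec (noise D P Ψ c ρ θstar (θ x) y y')))
            fun y y' => featSq_nonneg hc.pos Ψ _
          have h3 := hm.noise_stat_le hc hψ c ρ θstar (θ x)
          rw [← htr] at h3
          have e : 28 / (gap ^ 2 * μ) * featSq D Ψ (θ x - θstar) =
              2 * (14 / (gap ^ 2 * μ) * featSq D Ψ (θ x - θstar)) := by ring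
          rw [e]
          linarith
      _ = _ := by
          rw [hX.pathMean_add (adapted_const n₀ _)
            (aθ.comp fun t => 28 / (gap ^ 2 * μ) * featSq D Ψ (t - θstar)), pathMean_const,
            pathMean_mul_left]
  set V := 14 / 5 * tr + 28 / (gap ^ 2 * μ) * Eθ with hVdef
  set G := 2 / (gap ^ 2 * μ) * (W + Eθ) with hG
  have hEθ0 : 0 ≤ Eθ := pathMean_nonneg fun x => featSq_nonneg hc.pos Ψ _
  have hW0 : 0 ≤ W := normSqD_nonneg hc.pos _
  have hG0 : 0 ≤ G := by positivity
  have hV0 : 0 ≤ V := (pathMean_nonneg fun x => featSq_nonneg hc.pos Ψ _).trans (hV 0)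
  have hq0 : 0 ≤ r ^ τ' := pow_nonneg hr0 τ'
  -- A noise term involves two successive points, so for adjacent samples only τ' steps remain and
  -- delayed mixing falls short by one power. Correlations are therefore bounded by mixing from
  -- distance 2 on; adjacent pairs are left to Young's inequality.
  have hcorr : ∀ i k, pathMean ℙ X (fun x =>
      n i x ⬝ᵥ (gram D Ψ).mulVec (n (i + k + 2) x)) ≤ C * (r ^ τ') ^ (k + 2) * (V / 4 + G) := by
    intro i k
    have e : s + (τ' + 1) * (i + k + 2) + τ' =
        s + (τ' + 1) * i + τ' + 1 + ((τ' * (k + 2) + k) + 1) := by ring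
    have aθi : Adapted (s + (τ' + 1) * i + τ' + 1) θ := aθ.mono' (by omega)
    have h1 : pathMean ℙ X (fun x => n i x ⬝ᵥ (gram D Ψ).mulVec (n (i + k + 2) x)) =
        pathMean ℙ X (fun x =>
          pairMean ((P ^ ((τ' * (k + 2) + k) + 1)) (x (s + (τ' + 1) * i + τ' + 1))) P
          fun y y' => n i x ⬝ᵥ (gram D Ψ).mulVec
            ((opMatrix D P Ψ)⁻¹.mulVec (noise D P Ψ c ρ θstar (θ x) y y'))) := by
      rw [← hX.pathMean_pair ((τ' * (k + 2) + k) + 1) fun y y' => (an (i := i) le_rfl).comp₂ aθi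
        fun u t => u ⬝ᵥ (gram D Ψ).mulVec
            ((opMatrix D P Ψ)⁻¹.mulVec (noise D P Ψ c ρ θstar t y y'))]
      simp only [hn, e]
    have hκ0 : 0 ≤ C * (r ^ τ') ^ (k + 2) := by positivity
    rw [h1]
    calc _ ≤ pathMean ℙ X (fun x => C * (r ^ τ') ^ (k + 2) * (1 / 4 * featSq D Ψ (n i x) +
          2 / (gap ^ 2 * μ) * (W + featSq D Ψ (θ x - θstar)))) := by
          refine hX.pathMean_mono (n := s + (τ' + 1) * i + τ' + 1)
            ((an (i := i) le_rfl).comp₃ aθi (adapted_coord le_rfl) fun u t e =>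
              pairMean ((P ^ ((τ' * (k + 2) + k) + 1)) e) P fun y y' => u ⬝ᵥ (gram D Ψ).mulVec
                ((opMatrix D P Ψ)⁻¹.mulVec (noise D P Ψ c ρ θstar t y y')))
            ((an (i := i) le_rfl).comp₂ aθi fun u t => C * (r ^ τ') ^ (k + 2) *
              (1 / 4 * featSq D Ψ u + 2 / (gap ^ 2 * μ) * (W + featSq D Ψ (t - θstar))))
            fun x => ?_
          refine hm.noise_corr_le hc hQ hθ (pow_row hc _ _) (hmix _ _) hκ0 ?_ _ _
          have hCM0 : 0 ≤ constCM D P Ψ CP := by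
            have := specNorm_nonneg Ψ
            have := specNorm_nonneg (1 - P)
            unfold constCM
            positivity
          calc CP * r ^ (τ' * (k + 2) + k) / √(⨅ x, D x) * specNorm Ψ * specNorm (1 - P)
              = constCM D P Ψ CP * r ^ (τ' * (k + 2) + k) := by rw [constCM]; ring
            _ ≤ C * (r ^ τ') ^ (k + 2) :=
                mul_le_mul hCM (pow_lag_le hr0 hr1 τ' (k + 2) _ (by omega)) (by positivity) hC0
      _ = C * (r ^ τ') ^ (k + 2) * (1 / 4 * pathMean ℙ X (fun x => featSq D Ψ (n i x)) + G) := by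
          rw [pathMean_mul_left, hX.pathMean_add (n := s + (τ' + 1) * i + τ' + 1)
            ((an (i := i) le_rfl).comp fun u => 1 / 4 * featSq D Ψ u)
            (aθi.comp fun t => 2 / (gap ^ 2 * μ) * (W + featSq D Ψ (t - θstar))),
            pathMean_mul_left, pathMean_mul_left,
            hX.pathMean_add (adapted_const n₀ _) (aθ.comp fun t => featSq D Ψ (t - θstar)),
            pathMean_const]
      _ ≤ _ := by
          refine mul_le_mul_of_nonneg_left ?_ hκ0
          linarith [hV i]
  -- The increment per index is V + 2 (V + (V / 4 + G) / 4) = 25 V / 8 + G / 2: diagonal, adjacent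
  -- pair, distant pairs.
  have main : ∀ N : ℕ, pathMean ℙ X (fun x => featSq D Ψ (∑ i ∈ Finset.range N, n i x)) ≤
      N * (25 / 8 * V + G / 2) := by
    intro N
    induction N with
    | zero => simp [featSq, normSqD, pathMean_const]
    | succ N ih =>
      have aS : Adapted (s + (τ' + 1) * N + τ' + 1) fun x => ∑ i ∈ Finset.range N, n i x :=
        adapted_sum fun i hi => an (Finset.mem_range.1 hi).le
      have aC : ∀ i ∈ Finset.range N, Adapted (s + (τ' + 1) * N + τ' + 1)
          fun x => n i x ⬝ᵥ (gram D Ψ).mulVec (n N x) := fun i hi =>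
        (an (Finset.mem_range.1 hi).le).comp₂ (an le_rfl) fun a b => a ⬝ᵥ (gram D Ψ).mulVec b
      have e : ∀ x : ℕ → E, featSq D Ψ (∑ i ∈ Finset.range (N + 1), n i x) =
          featSq D Ψ (∑ i ∈ Finset.range N, n i x) +
            (2 * ∑ i ∈ Finset.range N, n i x ⬝ᵥ (gram D Ψ).mulVec (n N x) +
              featSq D Ψ (n N x)) := by
        intro x
        rw [Finset.sum_range_succ, featSq_add, sum_dotProduct]
        ring
      simp only [e]
      rw [hX.pathMean_add (aS.comp fun t => featSq D Ψ t)
          (((adapted_sum aC).comp fun t => 2 * t).comp₂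
            ((an le_rfl).comp fun t => featSq D Ψ t) fun a b => a + b),
        hX.pathMean_add ((adapted_sum aC).comp fun t => 2 * t)
          ((an le_rfl).comp fun t => featSq D Ψ t), pathMean_mul_left, hX.pathMean_sum aC]
      have hsum : ∑ i ∈ Finset.range N, pathMean ℙ X
          (fun x => n i x ⬝ᵥ (gram D Ψ).mulVec (n N x)) ≤ V + 1 / 4 * (V / 4 + G) := by
        rcases N with _ | N
        · simp only [Finset.range_zero, Finset.sum_empty]
          positivity
        rw [Finset.sum_range_succ, add_comm]
        refine add_le_add ?_ ?_
        · have h1 : pathMean ℙ X (fun x => n N x ⬝ᵥ (gram D Ψ).mulVec (n (N + 1) x)) ≤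
              pathMean ℙ X (fun x => 1 / 2 * featSq D Ψ (n N x) +
                1 / 2 * featSq D Ψ (n (N + 1) x)) := by
            refine hX.pathMean_mono (aC N (Finset.self_mem_range_succ N))
              ((an (Nat.le_succ N)).comp₂ (an (le_refl (N + 1))) fun a b =>
                1 / 2 * featSq D Ψ a + 1 / 2 * featSq D Ψ b) fun x => ?_
            have := gram_cauchy_young (Ψ := Ψ) hc.pos (n (N + 1) x) (n N x) one_pos
            linarith [le_abs_self (n N x ⬝ᵥ (gram D Ψ).mulVec (n (N + 1) x))]
          rw [hX.pathMean_add ((an (Nat.le_succ N)).comp fun a => 1 / 2 * featSq D Ψ a)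
            ((an (le_refl (N + 1))).comp fun a => 1 / 2 * featSq D Ψ a), pathMean_mul_left,
            pathMean_mul_left] at h1
          linarith [hV N, hV (N + 1)]
        · have h2 : ∑ i ∈ Finset.range N, pathMean ℙ X
              (fun x => n i x ⬝ᵥ (gram D Ψ).mulVec (n (N + 1) x)) ≤
              ∑ i ∈ Finset.range N, C * (r ^ τ') ^ (N + 1 - i) * (V / 4 + G) := by
            refine Finset.sum_le_sum fun i hi => ?_
            obtain ⟨k, rfl⟩ : ∃ k, N = i + k + 1 :=
              ⟨N - i - 1, by have := Finset.mem_range.1 hi; omega⟩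
            have e1 : i + k + 1 + 1 - i = k + 2 := by omega
            rw [e1]
            exact hcorr i k
          refine h2.trans ?_
          rw [← Finset.sum_mul, ← Finset.mul_sum]
          refine mul_le_mul_of_nonneg_right ?_ (by positivity)
          have h3 := mul_sum_pow_le hC0 hq0 hq (N + 1)
          rw [Finset.sum_range_succ] at h3
          have : 0 ≤ C * (r ^ τ') ^ (N + 1 - N) := by positivity
          linarith
      have := hV N
      push_cast
      linarith
  have e : ∀ x : ℕ → E, (opMatrix D P Ψ)⁻¹.mulVec
      (∑ i ∈ Finset.range N, noise D P Ψ c ρ θstar (θ x) (x (s + (τ' + 1) * i + τ'))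
        (x (s + (τ' + 1) * i + τ' + 1))) = ∑ i ∈ Finset.range N, n i x := by
    intro x
    rw [mulVec_sum]
  simp only [e]
  refine (main N).trans (le_of_eq ?_)
  rw [hVdef, hG]
  ring

end Batch

/-! ### One epoch of the algorithm. -/

section Epoch

open Matrix MeasureTheory

variable {E : Type*} {d : ℕ}

/-- The time at which the inner loop of epoch `k` starts. -/
def innerStart (p : Params) (k : ℕ) : ℕ :=
  epochStart p k + (p.tau' + 1) * p.batchRho k + (p.tau' + 1) * p.batch k

lemma epochStart_succ (p : Params) (k : ℕ) :
    epochStart p (k + 2) = innerStart p (k + 1) + (p.tau + 1) * p.T := by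
  rw [epochStart, Finset.sum_Ico_succ_top (by omega)]
  simp only [innerStart, epochStart, epochLength]
  ring

section Adaptedness

variable (p : Params) (Ψ : Matrix E (Fin d) ℝ) (c : E → ℝ)

lemma adapted_rhoHat (k : ℕ) :
    Adapted (epochStart p k + (p.tau' + 1) * p.batchRho k) fun x => rhoHat p c x k := by
  refine (adapted_sum fun i hi => (adapted_coord ?_).comp c).comp fun t =>
    (1 / (p.batchRho k : ℝ)) * t
  have := Finset.mem_range.1 hi
  have : (p.tau' + 1) * (i + 1) ≤ (p.tau' + 1) * p.batchRho k := Nat.mul_le_mul_left _ this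
  rw [mul_add] at this
  omega

lemma batch_time_le {n s i N m : ℕ} (hi : i < N) (h : s + (m + 1) * N ≤ n) :
    s + (m + 1) * i + m + 1 ≤ n := by
  have : (m + 1) * (i + 1) ≤ (m + 1) * N := Nat.mul_le_mul_left _ hi
  rw [mul_add] at this
  omega

lemma adapted_batchOp (k : ℕ) (θ : Fin d → ℝ) (ρ : ℝ) :
    Adapted (innerStart p k) fun x => batchOp p Ψ c x k θ ρ := by
  refine (adapted_sum fun i hi => ?_).comp fun t => (1 / (p.batch k : ℝ)) • t
  have := batch_time_le (n := innerStart p k) (Finset.mem_range.1 hi) le_rfl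
  exact (adapted_coord (by omega)).comp₂ (adapted_coord this) (stochOp Ψ c θ ρ)

lemma adapted_innerIter (k : ℕ) (θ : Fin d → ℝ) (t : ℕ) :
    Adapted (innerStart p k + (p.tau + 1) * t) fun x => innerIter p Ψ c x k θ t := by
  induction t with
  | zero => exact adapted_const _ _
  | succ t ih =>
    intro x y hxy
    have e : innerStart p k + (p.tau + 1) * (t + 1) =
        innerStart p k + (p.tau + 1) * t + p.tau + 1 := by ring
    rw [e] at hxy
    have h1 : innerIter p Ψ c x k θ t = innerIter p Ψ c y k θ t := ih.mono' (by omega) hxy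
    have h2 : rhoHat p c x k = rhoHat p c y k :=
      (adapted_rhoHat p c k).mono' (by simp only [innerStart]; omega) hxy
    have h3 : ∀ ρ, batchOp p Ψ c x k θ ρ = batchOp p Ψ c y k θ ρ := fun ρ =>
      (adapted_batchOp p Ψ c k θ ρ).mono' (by omega) hxy
    have h4 : x (innerStart p k + (p.tau + 1) * t + p.tau) =
      y (innerStart p k + (p.tau + 1) * t + p.tau) := hxy _ (by simp only [Set.mem_Iic]; omega)
    have h5 : x (innerStart p k + (p.tau + 1) * t + p.tau + 1) =
      y (innerStart p k + (p.tau + 1) * t + p.tau + 1) :=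
        hxy _ (by simp only [Set.mem_Iic]; omega)
    simp only [innerStart] at h4 h5
    simp only [innerIter, h1, h2, h3, h4, h5]

lemma adapted_thetaHat (θ0 : Fin d → ℝ) (k : ℕ) :
    Adapted (epochStart p (k + 1)) fun x => thetaHat p Ψ c θ0 x k := by
  induction k with
  | zero => exact adapted_const _ _
  | succ k ih =>
    intro x y hxy
    rw [epochStart_succ] at hxy
    have h1 : thetaHat p Ψ c θ0 x k = thetaHat p Ψ c θ0 y k :=
      ih.mono' (by simp only [innerStart]; omega) hxy
    have h2 : ∀ θ, ∀ t ∈ Finset.range p.T,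
        innerIter p Ψ c x (k + 1) θ t = innerIter p Ψ c y (k + 1) θ t := fun θ t ht =>
      (adapted_innerIter p Ψ c (k + 1) θ t).mono'
        (by have := Finset.mem_range.1 ht; gcongr) hxy
    simp only [thetaHat, h1]
    rw [Finset.sum_congr rfl (h2 _)]

end Adaptedness

variable [Fintype E] [DecidableEq E] {D : E → ℝ} {P : Matrix E E ℝ}
  {Ψ : Matrix E (Fin d) ℝ} {CP r : ℝ}
  {Ω : Type*} [MeasurableSpace Ω] {ℙ : Measure Ω} [IsProbabilityMeasure ℙ]
  {X : ℕ → Ω → E}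

/-- Accuracy of the average-cost estimate. -/
theorem rhoHat_sq_le (hX : IsTrajectory P X ℙ) (hc : StationaryChain D P)
    (hmix : DelayedMixing D P CP r) (hCP : 0 ≤ CP) (hr0 : 0 ≤ r) (hr1 : r ≤ 1) {p : Params}
    (hq : r ^ p.tau' ≤ 1 / (4 * CP + 1)) {c : E → ℝ} {cbar ρ : ℝ} (hcbar : ∀ x, |c x| ≤ cbar)
    (hρ : ρ = ∑ x, D x * c x) {k : ℕ} (hk : 0 < p.batchRho k) :
    pathMean ℙ X (fun x => (rhoHat p c x k - ρ) ^ 2) ≤ 5 * cbar ^ 2 / p.batchRho k := by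
  have hk' : (0 : ℝ) < p.batchRho k := by exact_mod_cast hk
  have e : ∀ x : ℕ → E, (rhoHat p c x k - ρ) ^ 2 = (1 / (p.batchRho k : ℝ)) ^ 2 *
      (∑ i ∈ Finset.range (p.batchRho k),
        (c (x (epochStart p k + (p.tau' + 1) * i + p.tau')) - ρ)) ^ 2 := by
    intro x
    rw [← mul_pow, Finset.sum_sub_distrib, Finset.sum_const, Finset.card_range, nsmul_eq_mul,
      mul_sub, rhoHat]
    congr 2
    field_simp
  simp only [e]
  rw [pathMean_mul_left]
  calc _ ≤ (1 / (p.batchRho k : ℝ)) ^ 2 * (5 * cbar ^ 2 * p.batchRho k) :=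
        mul_le_mul_of_nonneg_left
          (sum_cost_sq_le hX hc hmix hCP hr0 hr1 hq hcbar hρ _ _) (by positivity)
    _ = _ := by field_simp

/-- The error of the batch operator relative to `A (θ - θ*)`. -/
def batchErr (D : E → ℝ) (P : Matrix E E ℝ) (Ψ : Matrix E (Fin d) ℝ) (p : Params) (c : E → ℝ)
    (θstar : Fin d → ℝ) (k : ℕ) (x : ℕ → E) (θ : Fin d → ℝ) : Fin d → ℝ :=
  batchOp p Ψ c x k θ (rhoHat p c x k) - (opMatrix D P Ψ).mulVec (θ - θstar)

/-- The shift of the fixed point of the inner loop caused by the batch error. -/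
def batchShift (D : E → ℝ) (P : Matrix E E ℝ) (Ψ : Matrix E (Fin d) ℝ) (p : Params) (c : E → ℝ)
    (θstar : Fin d → ℝ) (k : ℕ) (x : ℕ → E) (θ : Fin d → ℝ) : Fin d → ℝ :=
  (opMatrix D P Ψ)⁻¹.mulVec (batchErr D P Ψ p c θstar k x θ)

lemma adapted_batchShift {p : Params} {c : E → ℝ} {θstar : Fin d → ℝ} {k n : ℕ}
    (hn : innerStart p k ≤ n) {θ : (ℕ → E) → Fin d → ℝ} (hθ : Adapted n θ) :
    Adapted n fun x => batchShift D P Ψ p c θstar k x (θ x) := by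
  intro x y hxy
  have h1 : θ x = θ y := hθ hxy
  have h2 : rhoHat p c x k = rhoHat p c y k :=
    (adapted_rhoHat p c k).mono' (by simp only [innerStart] at hn; omega) hxy
  have h3 : ∀ θ ρ, batchOp p Ψ c x k θ ρ = batchOp p Ψ c y k θ ρ := fun θ ρ =>
    (adapted_batchOp p Ψ c k θ ρ).mono' hn hxy
  simp only [batchShift, batchErr, h1, h2, h3]

/-- The operator g̃ is affine in ρ with slope ψ, so replacing ρ̂ by the true average cost leaves
centred noise and a multiple of the mean feature. -/
lemma batchErr_eq {p : Params} {c : E → ℝ} (ρ : ℝ) {θstar : Fin d → ℝ} {k : ℕ}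
    (hk : 0 < p.batch k) (x : ℕ → E) (θ : Fin d → ℝ) :
    batchErr D P Ψ p c θstar k x θ =
      (1 / (p.batch k : ℝ)) • (∑ i ∈ Finset.range (p.batch k), noise D P Ψ c ρ θstar θ
        (x (epochStart p k + (p.tau' + 1) * p.batchRho k + (p.tau' + 1) * i + p.tau'))
        (x (epochStart p k + (p.tau' + 1) * p.batchRho k + (p.tau' + 1) * i + p.tau' + 1))) +
      (rhoHat p c x k - ρ) • ((1 / (p.batch k : ℝ)) • ∑ i ∈ Finset.range (p.batch k),
        Ψ (x (epochStart p k + (p.tau' + 1) * p.batchRho k + (p.tau' + 1) * i + p.tau'))) := by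
  have hk' : (p.batch k : ℝ) ≠ 0 := by exact_mod_cast hk.ne'
  have h : ∀ ρ' y z, stochOp Ψ c θ ρ' y z =
      noise D P Ψ c ρ θstar θ y z + (opMatrix D P Ψ).mulVec (θ - θstar) + (ρ' - ρ) • Ψ y := by
    intro ρ' y z
    rw [noise, sub_add_cancel, stochOp, stochOp, ← add_smul]
    congr 1
    ring
  simp only [batchErr, batchOp, h, Finset.sum_add_distrib, Finset.sum_const, Finset.card_range,
    smul_add, ← Finset.smul_sum]
  rw [← Nat.cast_smul_eq_nsmul ℝ, smul_smul, one_div_mul_cancel hk', one_smul,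
    smul_comm (rhoHat p c x k - ρ)]
  abel

/-- A applied to θ - θ* + Δ is exactly the batch operator at θ, and ρ̂ cancels in the difference of
the two sampled operators. The iteration around θ* - Δ is thus homogeneous in the deviations, which
is what `innerDev` encodes. -/
lemma innerIter_eq {μ gap : ℝ} (hm : StronglyMonotone D P Ψ μ gap) (p : Params) (c : E → ℝ)
    (θstar : Fin d → ℝ) (k : ℕ) (θ : (ℕ → E) → Fin d → ℝ) (t : ℕ) (x : ℕ → E) :
    innerIter p Ψ c x k (θ x) t =
      innerDev D P Ψ p.eta (innerStart p k) p.tau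
        (fun x => θ x - θstar + batchShift D P Ψ p c θstar k x (θ x)) t x +
      θstar - batchShift D P Ψ p c θstar k x (θ x) := by
  set w : (ℕ → E) → Fin d → ℝ := fun x => θ x - θstar + batchShift D P Ψ p c θstar k x (θ x)
    with hw
  have hA : (opMatrix D P Ψ).mulVec (w x) = batchOp p Ψ c x k (θ x) (rhoHat p c x k) := by
    rw [hw]
    simp only [mulVec_add, batchShift]
    rw [mulVec_mulVec, hm.mul_inv, one_mulVec, batchErr]
    abel
  induction t with
  | zero =>
    simp only [innerIter, innerDev, hw]
    abel
  | succ t ih =>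
    have h1 : innerIter p Ψ c x k (θ x) t - θ x =
        innerDev D P Ψ p.eta (innerStart p k) p.tau w t x - w x := by
      have hwx : w x = θ x - θstar + batchShift D P Ψ p c θstar k x (θ x) := rfl
      rw [ih, hwx]
      abel
    have h2 : innerIter p Ψ c x k (θ x) (t + 1) = innerIter p Ψ c x k (θ x) t -
        p.eta • (sampleOp Ψ (x (innerStart p k + (p.tau + 1) * t + p.tau))
          (x (innerStart p k + (p.tau + 1) * t + p.tau + 1))
          (innerIter p Ψ c x k (θ x) t - θ x) + batchOp p Ψ c x k (θ x) (rhoHat p c x k)) := by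
      rw [← stochOp_sub (c := c) _ _ (rhoHat p c x k)]
      rfl
    rw [h2, h1, ih, innerDev_succ, innerDir, hA]
    abel

/-- A mean b of vectors in the unit ball stays in it: |b|² is the mean of the products Ψ (y i) ⬝ b,
each at most 1/2 + |b|² / 2. -/
lemma featSq_mean_feature_le {μ gap : ℝ} (hψ : ∀ x, Ψ x ⬝ᵥ Ψ x ≤ 1)
    (hm : StronglyMonotone D P Ψ μ gap) {N : ℕ} (y : ℕ → E) :
    featSq D Ψ ((opMatrix D P Ψ)⁻¹.mulVec ((1 / (N : ℝ)) • ∑ i ∈ Finset.range N, Ψ (y i))) ≤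
      1 / (gap ^ 2 * μ) := by
  have hg : 0 < gap ^ 2 * μ := mul_pos (pow_pos hm.gap_pos 2) hm.mu_pos
  refine (hm.featSq_inv_le _).trans (div_le_div_of_nonneg_right ?_ hg.le)
  set b := (1 / (N : ℝ)) • ∑ i ∈ Finset.range N, Ψ (y i) with hb
  have h1 : b ⬝ᵥ b = (1 / (N : ℝ)) * ∑ i ∈ Finset.range N, Ψ (y i) ⬝ᵥ b := by
    nth_rewrite 1 [hb]
    rw [smul_dotProduct, sum_dotProduct, smul_eq_mul]
  have h2 : ∑ i ∈ Finset.range N, Ψ (y i) ⬝ᵥ b ≤ N * (1 / 2 + 1 / 2 * (b ⬝ᵥ b)) := by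
    calc _ ≤ ∑ _i ∈ Finset.range N, (1 / 2 + 1 / 2 * (b ⬝ᵥ b)) :=
          Finset.sum_le_sum fun i _ => by
            have := sq_feature_le hψ (y i) b
            nlinarith [sq_nonneg (Ψ (y i) ⬝ᵥ b - 1)]
      _ = _ := by rw [Finset.sum_const, Finset.card_range, nsmul_eq_mul]
  rcases Nat.eq_zero_or_pos N with rfl | hN
  · simp [hb]
  have hN' : (0 : ℝ) < N := by exact_mod_cast hN
  have h3 : b ⬝ᵥ b ≤ 1 / 2 + 1 / 2 * (b ⬝ᵥ b) := by
    calc b ⬝ᵥ b ≤ (1 / (N : ℝ)) * (N * (1 / 2 + 1 / 2 * (b ⬝ᵥ b))) := by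
          rw [h1] at h2 ⊢
          exact mul_le_mul_of_nonneg_left h2 (by positivity)
      _ = _ := by field_simp
  linarith

/-- One epoch of the method halves the error up to statistical errors. -/
theorem epoch_le [Nonempty E] {μ gap : ℝ} (hX : IsTrajectory P X ℙ)
    (hc : StationaryChain D P)
    (hmix : DelayedMixing D P CP r) (hCP : 0 ≤ CP) (hr0 : 0 ≤ r) (hr1 : r ≤ 1) {p : Params}
    {C : ℝ} (hCM : constCM D P Ψ CP ≤ C) (hCPC : CP ≤ C) (hq : r ^ p.tau' ≤ 1 / (4 * C + 1))
    (hdens : CP * r ^ p.tau' ≤ ⨅ x, D x)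
    (hψ : ∀ x, Ψ x ⬝ᵥ Ψ x ≤ 1) (hm : StronglyMonotone D P Ψ μ gap) (hd : 0 < d)
    {c Q : E → ℝ} {cbar ρ : ℝ} (hcbar : ∀ x, |c x| ≤ cbar) (hρ : ρ = ∑ x, D x * c x)
    (hQ : (1 - P).mulVec Q = fun x => c x - ρ)
    {θstar : Fin d → ℝ} (hθ : ProjectedBellman D P Ψ c ρ θstar) (θ0 : Fin d → ℝ)
    (hη : 0 < p.eta) (hη2 : p.eta ≤ gap / 845)
    (hn : ∀ x, NearStationary D P Ψ p.eta ((P ^ (2 * p.tau + 1)) x))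
    (hT : 64 / (μ * gap * p.eta) ≤ p.T) {k : ℕ}
    (hbatch : 1160 / (μ * gap ^ 2) ≤ p.batch (k + 1)) (hrho : 0 < p.batchRho (k + 1)) :
    pathMean ℙ X (fun x => featSq D Ψ (thetaHat p Ψ c θ0 x (k + 1) - θstar)) ≤
      1 / 2 * pathMean ℙ X (fun x => featSq D Ψ (thetaHat p Ψ c θ0 x k - θstar)) +
      (22 * pairMean D P (fun x y => featSq D Ψ
          ((opMatrix D P Ψ)⁻¹.mulVec (stochOp Ψ c θstar ρ x y))) +
        4 / (μ * gap ^ 2) * normSqD D (Q - Ψ.mulVec θstar)) / p.batch (k + 1) +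
      36 * cbar ^ 2 / (gap ^ 2 * μ) / p.batchRho (k + 1) := by
  have hg : 0 < gap ^ 2 * μ := mul_pos (pow_pos hm.gap_pos 2) hm.mu_pos
  have hN' : (0 : ℝ) < p.batch (k + 1) :=
    lt_of_lt_of_le (div_pos (by norm_num) (by rwa [mul_comm])) hbatch
  have hN : 0 < p.batch (k + 1) := by exact_mod_cast hN'
  have hR' : (0 : ℝ) < p.batchRho (k + 1) := by exact_mod_cast hrho
  have hT0 : (0 : ℝ) < p.T :=
    lt_of_lt_of_le (div_pos (by norm_num) (mul_pos (mul_pos hm.mu_pos hm.gap_pos) hη)) hT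
  have hf0 := fun v => featSq_nonneg hc.pos Ψ v
  set θ : (ℕ → E) → Fin d → ℝ := fun x => thetaHat p Ψ c θ0 x k with hθdef
  set s := innerStart p (k + 1) with hs
  have aθ : Adapted (epochStart p (k + 1)) θ := adapted_thetaHat p Ψ c θ0 k
  have aθs : Adapted s θ := aθ.mono' (by simp only [hs, innerStart]; omega)
  set Δ : (ℕ → E) → Fin d → ℝ := fun x => batchShift D P Ψ p c θstar (k + 1) x (θ x) with hΔ
  have aΔ : Adapted s Δ := adapted_batchShift le_rfl aθs
  set w : (ℕ → E) → Fin d → ℝ := fun x => θ x - θstar + Δ x with hw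
  have aw : Adapted s w := aθs.comp₂ aΔ fun a b => a - θstar + b
  set v := innerDev D P Ψ p.eta s p.tau w with hv
  set tr := pairMean D P (fun x y => featSq D Ψ
    ((opMatrix D P Ψ)⁻¹.mulVec (stochOp Ψ c θstar ρ x y))) with htr
  set W := normSqD D (Q - Ψ.mulVec θstar) with hW
  set Eθ := pathMean ℙ X fun x => featSq D Ψ (θ x - θstar) with hEθ
  set n := s + (p.tau + 1) * p.T with hndef
  have av : ∀ t ∈ Finset.range p.T, Adapted n (v t) := fun t ht =>
    (adapted_innerDev aw t).mono' (by
      have := Finset.mem_range.1 ht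
      simp only [hndef]
      gcongr)
  have aΔn : Adapted n Δ := aΔ.mono' (Nat.le_add_right _ _)
  have awn : Adapted n w := aw.mono' (Nat.le_add_right _ _)
  have aθn : Adapted n θ := aθs.mono' (Nat.le_add_right _ _)
  -- the output in terms of the deviations
  have hout : ∀ x, thetaHat p Ψ c θ0 x (k + 1) - θstar =
      (1 / (p.T : ℝ)) • ∑ t ∈ Finset.range p.T, v t x - Δ x := by
    intro x
    simp only [thetaHat]
    have h : ∀ t, innerIter p Ψ c x (k + 1) (thetaHat p Ψ c θ0 x k) t =
        v t x + (θstar - Δ x) := fun t => by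
      rw [← add_sub_assoc]
      exact innerIter_eq hm p c θstar (k + 1) θ t x
    simp only [h, Finset.sum_add_distrib, Finset.sum_const, Finset.card_range]
    rw [← Nat.cast_smul_eq_nsmul ℝ, smul_add, smul_smul, one_div_mul_cancel hT0.ne', one_smul]
    abel
  have hinner : pathMean ℙ X (fun x => featSq D Ψ
      ((1 / (p.T : ℝ)) • ∑ t ∈ Finset.range p.T, v t x)) ≤
      1 / 20 * pathMean ℙ X (fun x => featSq D Ψ (w x)) := by
    have h1 := sum_innerDev_le hX hc hψ hm hd hη hη2 hn hT aw
    calc _ ≤ pathMean ℙ X (fun x => (1 / (p.T : ℝ)) * ∑ t ∈ Finset.range p.T,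
          featSq D Ψ (v t x)) := hX.pathMean_mono (n := n)
            ((adapted_sum av).comp fun a => featSq D Ψ ((1 / (p.T : ℝ)) • a))
            ((adapted_sum fun t ht => (av t ht).comp fun a => featSq D Ψ a).comp fun a =>
              (1 / (p.T : ℝ)) * a) fun x => sum_smul_featSq_le hc.pos Ψ p.T fun t => v t x
      _ = (1 / (p.T : ℝ)) * ∑ t ∈ Finset.range p.T, pathMean ℙ X
            (fun x => featSq D Ψ (v t x)) := by
          rw [pathMean_mul_left, hX.pathMean_sum fun t ht => (av t ht).comp fun a => featSq D Ψ a]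
      _ ≤ (1 / (p.T : ℝ)) * (p.T / 20 * pathMean ℙ X fun x => featSq D Ψ (w x)) :=
          mul_le_mul_of_nonneg_left h1 (by positivity)
      _ = _ := by field_simp
  have hwle : pathMean ℙ X (fun x => featSq D Ψ (w x)) ≤
      2 * Eθ + 2 * pathMean ℙ X (fun x => featSq D Ψ (Δ x)) := by
    rw [hEθ, ← pathMean_mul_left, ← pathMean_mul_left, ← hX.pathMean_add
      (aθs.comp fun a => 2 * featSq D Ψ (a - θstar)) (aΔ.comp fun a => 2 * featSq D Ψ a)]
    refine hX.pathMean_mono (aw.comp fun a => featSq D Ψ a)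
      (aθs.comp₂ aΔ fun a b => 2 * featSq D Ψ (a - θstar) + 2 * featSq D Ψ b) fun x => ?_
    have := featSq_add_le hc.pos Ψ (θ x - θstar) (Δ x) one_pos
    norm_num at this
    exact this
  -- Young's inequality with factors 3 and 3/2, combined with `hinner` and `hwle`: 3 · (1/20) · 2 =
  -- 3/10, and 3/10 + 3/2 = 9/5.
  have hstep : pathMean ℙ X (fun x => featSq D Ψ (thetaHat p Ψ c θ0 x (k + 1) - θstar)) ≤
      3 / 10 * Eθ + 9 / 5 * pathMean ℙ X (fun x => featSq D Ψ (Δ x)) := by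
    have am : Adapted n fun x => (1 / (p.T : ℝ)) • ∑ t ∈ Finset.range p.T, v t x :=
      (adapted_sum av).comp fun a => (1 / (p.T : ℝ)) • a
    have h1 : pathMean ℙ X (fun x => featSq D Ψ (thetaHat p Ψ c θ0 x (k + 1) - θstar)) ≤
        pathMean ℙ X (fun x => 3 * featSq D Ψ ((1 / (p.T : ℝ)) • ∑ t ∈ Finset.range p.T, v t x) +
          3 / 2 * featSq D Ψ (Δ x)) := by
      simp only [hout]
      refine hX.pathMean_mono (am.comp₂ aΔn fun a b => featSq D Ψ (a - b))
        (am.comp₂ aΔn fun a b => 3 * featSq D Ψ a + 3 / 2 * featSq D Ψ b) fun x => ?_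
      have := featSq_sub_le hc.pos Ψ ((1 / (p.T : ℝ)) • ∑ t ∈ Finset.range p.T, v t x) (Δ x)
        (c := 2) (by norm_num)
      linarith
    rw [hX.pathMean_add (am.comp fun a => 3 * featSq D Ψ a)
      (aΔn.comp fun a => 3 / 2 * featSq D Ψ a), pathMean_mul_left, pathMean_mul_left] at h1
    linarith
  -- the two parts of the shift
  set Nz : (ℕ → E) → Fin d → ℝ := fun x => ∑ i ∈ Finset.range (p.batch (k + 1)),
    noise D P Ψ c ρ θstar (θ x)
      (x (epochStart p (k + 1) + (p.tau' + 1) * p.batchRho (k + 1) + (p.tau' + 1) * i + p.tau'))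
      (x (epochStart p (k + 1) + (p.tau' + 1) * p.batchRho (k + 1) + (p.tau' + 1) * i +
        p.tau' + 1)) with hNz
  have aNz : Adapted s Nz := by
    refine adapted_sum fun i hi => ?_
    have := batch_time_le (n := s) (Finset.mem_range.1 hi) le_rfl
    exact aθs.comp₃ (adapted_coord (by omega)) (adapted_coord this) (noise D P Ψ c ρ θstar)
  have aρ : Adapted s fun x => rhoHat p c x (k + 1) :=
    (adapted_rhoHat p c (k + 1)).mono' (by simp only [hs, innerStart]; omega)
  have hnoise : pathMean ℙ X (fun x => featSq D Ψ ((opMatrix D P Ψ)⁻¹.mulVec (Nz x))) ≤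
      p.batch (k + 1) * (35 / 4 * tr + 1 / (gap ^ 2 * μ) * W + 177 / 2 / (gap ^ 2 * μ) * Eθ) := by
    refine sum_noise_featSq_le hX hc hmix hCP hr0 hr1 hCM (hCP.trans hCPC) hq hdens hψ hm hQ hθ
      ?_ aθ (p.batch (k + 1))
    have : (p.tau' + 1) * 1 ≤ (p.tau' + 1) * p.batchRho (k + 1) := Nat.mul_le_mul_left _ hrho
    omega
  -- The weight 3/8 gives 11/8 and 11/3. After the factor 9/5 of `hstep` the trace gets
  -- (9/5)(11/8)(35/4) < 22 and the cost error (9/5)(11/3) · 5 = 33 < 36.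
  have hΔle : pathMean ℙ X (fun x => featSq D Ψ (Δ x)) ≤
      11 / 8 * ((1 / (p.batch (k + 1) : ℝ)) ^ 2 *
        pathMean ℙ X (fun x => featSq D Ψ ((opMatrix D P Ψ)⁻¹.mulVec (Nz x)))) +
      11 / 3 * (1 / (gap ^ 2 * μ)) *
        pathMean ℙ X (fun x => (rhoHat p c x (k + 1) - ρ) ^ 2) := by
    rw [← pathMean_mul_left, ← pathMean_mul_left, ← pathMean_mul_left, ← hX.pathMean_add
      (aNz.comp fun a => 11 / 8 * ((1 / (p.batch (k + 1) : ℝ)) ^ 2 *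
        featSq D Ψ ((opMatrix D P Ψ)⁻¹.mulVec a)))
      (aρ.comp fun a => 11 / 3 * (1 / (gap ^ 2 * μ)) * (a - ρ) ^ 2)]
    refine hX.pathMean_mono (aΔ.comp fun a => featSq D Ψ a)
      (aNz.comp₂ aρ fun a b => 11 / 8 * ((1 / (p.batch (k + 1) : ℝ)) ^ 2 *
        featSq D Ψ ((opMatrix D P Ψ)⁻¹.mulVec a)) +
          11 / 3 * (1 / (gap ^ 2 * μ)) * (b - ρ) ^ 2) fun x => ?_
    simp only [hΔ, batchShift]
    rw [batchErr_eq ρ hN, mulVec_add, mulVec_smul, mulVec_smul]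
    have h1 := featSq_add_le hc.pos Ψ
      ((1 / (p.batch (k + 1) : ℝ)) • (opMatrix D P Ψ)⁻¹.mulVec (Nz x))
      ((rhoHat p c x (k + 1) - ρ) • (opMatrix D P Ψ)⁻¹.mulVec ((1 / (p.batch (k + 1) : ℝ)) •
        ∑ i ∈ Finset.range (p.batch (k + 1)), Ψ (x (epochStart p (k + 1) +
          (p.tau' + 1) * p.batchRho (k + 1) + (p.tau' + 1) * i + p.tau')))) (c := 3 / 8)
      (by norm_num)
    rw [featSq_smul, featSq_smul] at h1
    have h2 := featSq_mean_feature_le hψ hm (N := p.batch (k + 1)) fun i =>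
      x (epochStart p (k + 1) + (p.tau' + 1) * p.batchRho (k + 1) + (p.tau' + 1) * i + p.tau')
    have h3 := mul_le_mul_of_nonneg_left h2 (sq_nonneg (rhoHat p c x (k + 1) - ρ))
    norm_num at h1 h3 ⊢
    linarith
  have hρle : pathMean ℙ X (fun x => (rhoHat p c x (k + 1) - ρ) ^ 2) ≤
      5 * cbar ^ 2 / p.batchRho (k + 1) := by
    refine rhoHat_sq_le hX hc hmix hCP hr0 hr1 (hq.trans ?_) hcbar hρ hrho
    exact one_div_le_one_div_of_le (by positivity) (by linarith)
  have hEθ0 : 0 ≤ Eθ := pathMean_nonneg fun x => hf0 _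
  have htr0 : 0 ≤ tr := pairMean_nonneg (fun x => (hc.pos x).le) hc.nonneg fun x y => hf0 _
  have hW0 : 0 ≤ W := normSqD_nonneg hc.pos _
  have e1 : 4 / (μ * gap ^ 2) = 4 * (1 / (gap ^ 2 * μ)) := by rw [mul_comm μ]; ring
  have e2 : 36 * cbar ^ 2 / (gap ^ 2 * μ) = 36 * cbar ^ 2 * (1 / (gap ^ 2 * μ)) := by ring
  have e3 : 177 / 2 / (gap ^ 2 * μ) = 177 / 2 * (1 / (gap ^ 2 * μ)) := by ring
  have e4 : 1160 / (μ * gap ^ 2) = 1160 * (1 / (gap ^ 2 * μ)) := by rw [mul_comm μ]; ring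
  rw [e1, e2, div_eq_mul_one_div _ (p.batch (k + 1) : ℝ),
    div_eq_mul_one_div _ (p.batchRho (k + 1) : ℝ)]
  rw [e3] at hnoise
  rw [e4] at hbatch
  rw [div_eq_mul_one_div _ (p.batchRho (k + 1) : ℝ)] at hρle
  set j := 1 / (gap ^ 2 * μ) with hj
  have hj0 : 0 < j := by positivity
  set a := 1 / (p.batch (k + 1) : ℝ) with ha
  have ha0 : 0 < a := by positivity
  have han : a * p.batch (k + 1) = 1 := by rw [ha]; field_simp
  set R := 1 / (p.batchRho (k + 1) : ℝ) with hR
  have hR0 : 0 < R := by positivity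
  -- Makes the noise proportional to the current error at most (9/5)(11/8)(177/2) / 1160 < 1/5 of
  -- it, so that 3/10 + 1/5 = 1/2.
  have hja : j * a ≤ 1 / 1160 := by
    have := mul_le_mul_of_nonneg_right hbatch ha0.le
    rw [mul_comm (p.batch (k + 1) : ℝ), han] at this
    linarith
  have f1 : a ^ 2 * pathMean ℙ X (fun x => featSq D Ψ ((opMatrix D P Ψ)⁻¹.mulVec (Nz x))) ≤
      a * (35 / 4 * tr + j * W + 177 / 2 * j * Eθ) := by
    calc _ ≤ a ^ 2 * (p.batch (k + 1) * (35 / 4 * tr + j * W + 177 / 2 * j * Eθ)) :=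
          mul_le_mul_of_nonneg_left hnoise (sq_nonneg a)
      _ = a * (a * p.batch (k + 1)) * (35 / 4 * tr + j * W + 177 / 2 * j * Eθ) := by ring
      _ = _ := by rw [han, mul_one]
  have f2 := mul_le_mul_of_nonneg_left hρle hj0.le
  have f3 := mul_le_mul_of_nonneg_right hja hEθ0
  have f4 : 0 ≤ a * tr := by positivity
  have f5 : 0 ≤ a * (j * W) := by positivity
  have f6 : 0 ≤ j * (cbar ^ 2 * R) := by positivity
  linarith

end Epoch

/-! ### The state-action chain of the decision process and its Poisson equation. -/

section DecisionProcess

open Matrix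

variable {S A : Type*} [Fintype S] [Fintype A] [DecidableEq S] [DecidableEq A]
  {M : MDP S A} {pol : Policy S A} {ν : S → ℝ}

lemma vecMul_pow_of_stationary {P : Matrix S S ℝ} (h : vecMul ν P = ν) (k : ℕ) :
    vecMul ν (P ^ k) = ν := by
  induction k with
  | zero => simp
  | succ k ih => rw [pow_succ, ← vecMul_vecMul, ih, h]

/-- Some state carries mass; irreducibility transports it to s through a power of P, under which ν
is invariant. -/
lemma stationary_pos {P : Matrix S S ℝ} (hirr : P.IsIrreducible) (hν : IsStationaryDist P ν)
    (s : S) : 0 < ν s := by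
  obtain ⟨⟨h0, h1⟩, hstat⟩ := hν
  obtain ⟨s₀, hs₀⟩ : ∃ s₀, 0 < ν s₀ := by
    by_contra h
    push Not at h
    have : ∑ s, ν s ≤ 0 := Finset.sum_nonpos fun s _ => h s
    linarith
  obtain ⟨k, -, hk⟩ := (isIrreducible_iff_exists_pow_pos hirr.nonneg).1 hirr s₀ s
  have hnn : ∀ k i j, 0 ≤ (P ^ k) i j := by
    intro k
    induction k with
    | zero =>
      intro i j
      rw [pow_zero, Matrix.one_apply]
      split_ifs <;> norm_num
    | succ k ih =>
      intro i j
      rw [pow_succ, Matrix.mul_apply]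
      exact Finset.sum_nonneg fun z _ => mul_nonneg (ih i z) (hirr.nonneg z j)
  rw [← vecMul_pow_of_stationary hstat k]
  exact lt_of_lt_of_le (mul_pos hs₀ hk) (Finset.single_le_sum (f := fun x => ν x * (P ^ k) x s)
    (fun x _ => mul_nonneg (h0 x) (hnn k x s)) (Finset.mem_univ s₀))

lemma stationaryChain_saMatrix (hpol : ∀ s a, 0 < pol.prob s a) (hpos : ∀ s, 0 < ν s)
    (hν : IsStationaryDist (stateMatrix M pol) ν) :
    StationaryChain (saDist pol ν) (saMatrix M pol) where
  pos x := mul_pos (hpos x.1) (hpol x.1 x.2)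
  sum_eq := by
    simp only [saDist, Fintype.sum_prod_type, ← Finset.mul_sum, (pol.prob_mem _).2, mul_one]
    exact hν.1.2
  nonneg x y := mul_nonneg ((M.trans_mem _ _).1 _) ((pol.prob_mem _).1 _)
  row x := by
    simp only [saMatrix, of_apply, Fintype.sum_prod_type, ← Finset.mul_sum, (pol.prob_mem _).2,
      mul_one]
    exact (M.trans_mem _ _).2
  stat y := by
    have h := congrFun hν.2 y.1
    simp only [saDist, saMatrix, of_apply, Fintype.sum_prod_type]
    rw [← h, vecMul, dotProduct, Finset.sum_mul]
    refine Finset.sum_congr rfl fun s _ => ?_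
    rw [stateMatrix, of_apply, Finset.mul_sum, Finset.sum_mul]
    exact Finset.sum_congr rfl fun a _ => by ring

/-- The first transition uses the given action and the last draw uses the policy, so m + 1
state-action steps contain only m steps of the state matrix. This is the origin of the delay in
mixing. -/
lemma saMatrix_pow_succ (m : ℕ) (x y : S × A) : (saMatrix M pol ^ (m + 1)) x y =
    (∑ s, M.trans x.1 x.2 s * (stateMatrix M pol ^ m) s y.1) * pol.prob y.1 y.2 := by
  induction m generalizing y with
  | zero => simp [saMatrix, Matrix.one_apply]
  | succ m ih =>
    have hcomm : ∑ s, M.trans x.1 x.2 s * (stateMatrix M pol ^ (m + 1)) s y.1 =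
        ∑ z, (∑ s, M.trans x.1 x.2 s * (stateMatrix M pol ^ m) s z) *
          stateMatrix M pol z y.1 := by
      simp only [pow_succ _ m, Matrix.mul_apply, Finset.mul_sum, Finset.sum_mul, mul_assoc]
      exact Finset.sum_comm
    rw [hcomm, pow_succ, Matrix.mul_apply]
    simp only [ih, Fintype.sum_prod_type]
    rw [Finset.sum_mul]
    refine Finset.sum_congr rfl fun z _ => ?_
    generalize ∑ s, M.trans x.1 x.2 s * (stateMatrix M pol ^ m) s z = g
    rw [mul_assoc, stateMatrix, of_apply, Finset.sum_mul, Finset.mul_sum]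
    refine Finset.sum_congr rfl fun a _ => ?_
    simp only [saMatrix, of_apply]
    ring

lemma delayedMixing_saMatrix {CP r : ℝ} (hmix : GeomMixing (stateMatrix M pol) ν CP r) :
    DelayedMixing (saDist pol ν) (saMatrix M pol) CP r := by
  intro m x
  have h : ∀ y : S × A, |(saMatrix M pol ^ (m + 1)) x y - saDist pol ν y| =
      |∑ s, M.trans x.1 x.2 s * ((stateMatrix M pol ^ m) s y.1 - ν y.1)| * pol.prob y.1 y.2 := by
    intro y
    rw [saMatrix_pow_succ, saDist, ← sub_mul, abs_mul, abs_of_nonneg ((pol.prob_mem _).1 _)]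
    simp only [mul_sub, Finset.sum_sub_distrib, ← Finset.sum_mul, (M.trans_mem _ _).2, one_mul]
  simp only [h, Fintype.sum_prod_type, ← Finset.mul_sum, (pol.prob_mem _).2, mul_one]
  calc ∑ s', |∑ s, M.trans x.1 x.2 s * ((stateMatrix M pol ^ m) s s' - ν s')|
      ≤ ∑ s', ∑ s, M.trans x.1 x.2 s * |(stateMatrix M pol ^ m) s s' - ν s'| :=
        Finset.sum_le_sum fun s' _ => (Finset.abs_sum_le_sum_abs _ _).trans
          (Finset.sum_le_sum fun s _ => by rw [abs_mul, abs_of_nonneg ((M.trans_mem _ _).1 _)])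
    _ = ∑ s, M.trans x.1 x.2 s * ∑ s', |(stateMatrix M pol ^ m) s s' - ν s'| := by
        rw [Finset.sum_comm]
        simp only [Finset.mul_sum]
    _ ≤ ∑ s, M.trans x.1 x.2 s * (CP * r ^ m) := Finset.sum_le_sum fun s _ =>
        mul_le_mul_of_nonneg_left (hmix m s) ((M.trans_mem _ _).1 _)
    _ = CP * r ^ m := by rw [← Finset.sum_mul, (M.trans_mem _ _).2, one_mul]

lemma avgCost_eq : avgCost M pol ν = ∑ x, saDist pol ν x * costVec M x := by
  simp only [avgCost, saDist, costVec, Fintype.sum_prod_type, Finset.mul_sum, mul_assoc]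

/-- Since h has D-mean zero, P^(t+1) h is (P^(t+1) - 1 Dᵀ) h, which decays geometrically. The index
is shifted because mixing says nothing about t = 0. -/
lemma DelayedMixing.summable_pow_mulVec {E : Type*} [Fintype E] [DecidableEq E] {D : E → ℝ}
    {P : Matrix E E ℝ} {CP r : ℝ} (hmix : DelayedMixing D P CP r) (hr0 : 0 ≤ r) (hr1 : r < 1)
    {h : E → ℝ} (h0 : ∑ x, D x * h x = 0) (x : E) : Summable fun t : ℕ => ((P ^ t).mulVec h) x := by
  rw [← summable_nat_add_iff 1]
  obtain ⟨C, hC⟩ : ∃ C, ∀ y, |h y| ≤ C :=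
    ⟨∑ y, |h y|, fun y => Finset.single_le_sum (f := fun y => |h y|) (fun _ _ => abs_nonneg _)
      (Finset.mem_univ y)⟩
  refine Summable.of_norm_bounded (g := fun t : ℕ => C * CP * r ^ t)
    ((summable_geometric_of_lt_one hr0 hr1).mul_left _) fun t => ?_
  have e : ((P ^ (t + 1)).mulVec h) x = ∑ y, ((P ^ (t + 1)) x y - D y) * h y := by
    simp only [sub_mul, Finset.sum_sub_distrib, h0, sub_zero]
    rfl
  rw [Real.norm_eq_abs, e]
  calc _ ≤ ∑ y, |((P ^ (t + 1)) x y - D y) * h y| := Finset.abs_sum_le_sum_abs _ _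
    _ ≤ ∑ y, |(P ^ (t + 1)) x y - D y| * C := Finset.sum_le_sum fun y _ => by
        rw [abs_mul]
        exact mul_le_mul_of_nonneg_left (hC y) (abs_nonneg _)
    _ ≤ CP * r ^ t * C := by
        rw [← Finset.sum_mul]
        exact mul_le_mul_of_nonneg_right (hmix t x) ((abs_nonneg _).trans (hC x))
    _ = _ := by ring

/-- The Poisson equation for the differential action-value function. -/
lemma one_sub_mulVec_basicQ (hc : StationaryChain (saDist pol ν) (saMatrix M pol)) {CP r : ℝ}
    (hmix : DelayedMixing (saDist pol ν) (saMatrix M pol) CP r) (hr0 : 0 ≤ r) (hr1 : r < 1)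
    (b : ℝ) :
    (1 - saMatrix M pol).mulVec (fun x => basicQ M pol ν x + b) =
      fun x => costVec M x - avgCost M pol ν := by
  set P := saMatrix M pol with hP
  set h : S × A → ℝ := fun y => costVec M y - avgCost M pol ν with hh
  have h0 : ∑ x, saDist pol ν x * h x = 0 := by
    simp only [hh, mul_sub, Finset.sum_sub_distrib, ← Finset.sum_mul, hc.sum_eq, ← avgCost_eq]
    ring
  have hs := hmix.summable_pow_mulVec hr0 hr1 h0
  funext x
  have e1 : ∑ y, P x y * basicQ M pol ν y = ∑' t : ℕ, ((P ^ (t + 1)).mulVec h) x := by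
    have e : ∀ t : ℕ, ((P ^ (t + 1)).mulVec h) x = ∑ y, P x y * ((P ^ t).mulVec h) y := by
      intro t
      rw [pow_succ', ← mulVec_mulVec]
      rfl
    simp only [e]
    rw [Summable.tsum_finsetSum fun y _ => (hs y).mul_left _]
    exact Finset.sum_congr rfl fun y _ => (tsum_mul_left ..).symm
  have e2 : basicQ M pol ν x = h x + ∑' t : ℕ, ((P ^ (t + 1)).mulVec h) x := by
    have := (hs x).tsum_eq_zero_add
    rw [pow_zero, one_mulVec] at this
    exact this
  -- Rows of P sum to one, so the constant b lies in the kernel of I - P.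
  have e3 : (P.mulVec fun y => basicQ M pol ν y + b) x = ∑ y, P x y * basicQ M pol ν y + b := by
    change ∑ y, P x y * (basicQ M pol ν y + b) = _
    simp only [mul_add, Finset.sum_add_distrib, ← Finset.sum_mul, hc.row, one_mul]
  rw [sub_mulVec, one_mulVec, Pi.sub_apply, e3, e2, e1]
  ring

end DecisionProcess

/-- The inductive bound carries the weight 3 (4/3)^(K-k). The number 3 is the fixed point of the
step: half of 3 · 4/3, plus 1 for the new epoch, is 3 again. -/
lemma le_of_epoch_recursion {e : ℕ → ℝ} {W R n n' : ℝ} {K : ℕ} {m m' : ℕ → ℝ} (hW : 0 ≤ W)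
    (hR : 0 ≤ R) (hn : 0 < n) (hn' : 0 < n')
    (hm : ∀ k ∈ Finset.Icc 1 K, (3 / 4 : ℝ) ^ (K - k) * n ≤ m k)
    (hm' : ∀ k ∈ Finset.Icc 1 K, (3 / 4 : ℝ) ^ (K - k) * n' ≤ m' k)
    (h : ∀ k, k < K → e (k + 1) ≤ 1 / 2 * e k + W / m (k + 1) + R / m' (k + 1)) :
    e K ≤ 1 / 2 ^ K * e 0 + 3 * W / n + 3 * R / n' := by
  have key : ∀ k ≤ K, e k ≤ 1 / 2 ^ k * e 0 + 3 * (4 / 3) ^ (K - k) * (W / n + R / n') := by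
    intro k
    induction k with
    | zero =>
      intro _
      have : 0 ≤ 3 * (4 / 3 : ℝ) ^ (K - 0) * (W / n + R / n') := by positivity
      simp only [pow_zero, div_one, one_mul]
      linarith
    | succ k ih =>
      intro hk
      have h1 := ih (by omega)
      have h2 := h k (by omega)
      have hmem : k + 1 ∈ Finset.Icc 1 K := by simp; omega
      have e1 : K - k = K - (k + 1) + 1 := by omega
      have hinv : ∀ {x y z : ℝ}, 0 ≤ x → 0 < y → (3 / 4 : ℝ) ^ (K - (k + 1)) * y ≤ z →
          x / z ≤ (4 / 3) ^ (K - (k + 1)) * (x / y) := by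
        intro x y z hx hy hz
        have h3 : x / z ≤ x / ((3 / 4 : ℝ) ^ (K - (k + 1)) * y) :=
          div_le_div_of_nonneg_left hx (by positivity) hz
        refine h3.trans (le_of_eq ?_)
        have h4 : (4 / 3 : ℝ) ^ (K - (k + 1)) = ((3 / 4 : ℝ) ^ (K - (k + 1)))⁻¹ := by
          rw [← inv_pow]; norm_num
        rw [h4]
        field_simp
      have h3 := hinv hW hn (hm _ hmem)
      have h4 := hinv hR hn' (hm' _ hmem)
      rw [e1, pow_succ] at h1
      set c := (4 / 3 : ℝ) ^ (K - (k + 1))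
      have e2 : (1 : ℝ) / 2 ^ (k + 1) * e 0 = 1 / 2 * (1 / 2 ^ k * e 0) := by
        rw [pow_succ]; field_simp
      rw [e2]
      linarith
  have := key K le_rfl
  rw [Nat.sub_self, pow_zero] at this
  refine this.trans (le_of_eq ?_)
  ring

end AvgMDP

end

/-! ### Assembly of the theorem. -/

open AvgMDP in
theorem theorem1 {S A : Type*} [Fintype S] [Fintype A] [DecidableEq S] [DecidableEq A]
    -- the decision process, its cost bound, and a strictly positive policy with an ergodic chain
    (M : MDP S A) (cbar : ℝ) (hcbar : ∀ s a, |M.cost s a| ≤ cbar)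
    (pol : Policy S A) (hpol : ∀ s a, 0 < pol.prob s a)
    (hirr : (stateMatrix M pol).IsIrreducible) (haper : IsAperiodic (stateMatrix M pol))
    -- its stationary distribution and mixing constants
    (ν : S → ℝ) (hν : IsStationaryDist (stateMatrix M pol) ν)
    (CP r : ℝ) (hCP : 0 < CP) (hr0 : 0 < r) (hr1 : r < 1)
    (hmix : GeomMixing (stateMatrix M pol) ν CP r)
    -- the features
    {d : ℕ} (hd : 0 < d) (Ψ : Matrix (S × A) (Fin d) ℝ)
    (hindep : LinearIndependent ℝ fun j => fun x => Ψ x j)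
    (hfeat : ∀ x, √(∑ j, Ψ x j ^ 2) ≤ 1)
    (hone : (fun _ => 1) ∉ featureSpan Ψ)
    -- abbreviations: weights, transition matrix, average cost, smallest eigenvalue, and 1 - β
    (D : S × A → ℝ) (hD : D = saDist pol ν)
    (P : Matrix (S × A) (S × A) ℝ) (hP : P = saMatrix M pol)
    (ρstar : ℝ) (hρstar : ρstar = avgCost M pol ν)
    (μ : ℝ) (hμ : μ = minEig D Ψ)
    (gap : ℝ) (hgap : gap = monoConst D P Ψ)
    -- the solution of the projected Bellman equation, and the differential action-value function
    -- closest to it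
    (θstar : Fin d → ℝ) (hθstar : ProjectedBellman D P Ψ (costVec M) ρstar θstar)
    (b : ℝ) (hb : ∀ b' : ℝ,
      √(normSqD D (fun x => basicQ M pol ν x + b - Ψ.mulVec θstar x)) ≤
        √(normSqD D (fun x => basicQ M pol ν x + b' - Ψ.mulVec θstar x)))
    -- the single trajectory
    {Ω : Type*} [MeasurableSpace Ω] (ℙ : MeasureTheory.Measure Ω)
    [MeasureTheory.IsProbabilityMeasure ℙ] (X : ℕ → Ω → S × A) (hX : IsTrajectory P X ℙ)
    -- the parameters of the algorithm
    (θ0 : Fin d → ℝ) (p : Params) (K N N' : ℕ) (hK : 0 < K) (hN : 0 < N) (hN' : 0 < N')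
    (heta0 : 0 < p.eta) (heta : p.eta ≤ gap / 845)
    (hT : 64 / (μ * gap * p.eta) ≤ p.T)
    (hbatch : ∀ k ∈ Finset.Icc 1 K,
      max (1160 / (μ * gap ^ 2)) ((3 / 4 : ℝ) ^ (K - k) * N) ≤ p.batch k)
    (hbatchRho : ∀ k ∈ Finset.Icc 1 K, (3 / 4 : ℝ) ^ (K - k) * N' ≤ p.batchRho k)
    (htau : r ^ p.tau ≤ √μ * p.eta / constCM D P Ψ CP)
    (htau' : r ^ p.tau' ≤ min ((⨅ x, D x) / CP) (1 / (4 * constCmax D P Ψ CP + 1))) :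
    (∫ ω, (rhoHat p (costVec M) (fun n => X n ω) K - ρstar) ^ 2 ∂ℙ ≤ 5 * cbar ^ 2 / N') ∧
    (∫ ω, normSqD D (Ψ.mulVec (thetaHat p Ψ (costVec M) θ0 (fun n => X n ω) K) -
        Ψ.mulVec θstar) ∂ℙ ≤
      1 / 2 ^ K * normSqD D (Ψ.mulVec θ0 - Ψ.mulVec θstar) +
        3 * constW D P Ψ (costVec M) θstar ρstar (fun x => basicQ M pol ν x + b) / N +
        108 * cbar ^ 2 / (N' * gap ^ 2 * μ) + 3 * cbar ^ 2 / (4 * N')) := by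
  have hνpos := stationary_pos hirr hν
  have hc : StationaryChain D P := by
    rw [hD, hP]
    exact stationaryChain_saMatrix hpol hνpos hν
  have hmixE : DelayedMixing D P CP r := by
    rw [hD, hP]
    exact delayedMixing_saMatrix hmix
  have hQ : (1 - P).mulVec (fun x => basicQ M pol ν x + b) = fun x => costVec M x - ρstar := by
    rw [hP, hρstar]
    rw [hD, hP] at hc hmixE
    exact one_sub_mulVec_basicQ hc hmixE hr0.le hr1 b
  have hne : Nonempty (S × A) := by
    by_contra h
    rw [not_nonempty_iff] at h
    simpa using hc.sum_eq
  have hρ : ρstar = ∑ x, D x * costVec M x := by rw [hρstar, hD, avgCost_eq]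
  have hψ : ∀ x, Ψ x ⬝ᵥ Ψ x ≤ 1 := by
    intro x
    rw [dot_self_eq_sum_sq]
    have h0 : 0 ≤ ∑ j, Ψ x j ^ 2 := Finset.sum_nonneg fun j _ => sq_nonneg _
    rw [← Real.sq_sqrt h0]
    exact pow_le_one₀ (Real.sqrt_nonneg _) (hfeat x)
  -- Positivity of 1 - β is read off from the admissible range of step sizes.
  have hgap0 : 0 < gap := by linarith
  have hm : StronglyMonotone D P Ψ μ gap := by
    refine ⟨?_, ?_, hgap0, ?_⟩
    · rw [hμ]; exact minEig_pos hc.pos hd hindep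
    · rw [hμ]; exact minEig_mul_le
    · rw [hgap]; exact monoConst_mul_le hc
  have hCM0 : 0 ≤ constCM D P Ψ CP := by
    have := specNorm_nonneg Ψ
    have := specNorm_nonneg (1 - P)
    unfold constCM
    positivity
  -- If C_M were 0, the quotient in `htau` would be 0 by the convention for division by zero,
  -- against r^τ > 0.
  have hCMpos : 0 < constCM D P Ψ CP := by
    refine lt_of_le_of_ne hCM0 fun h => ?_
    rw [← h, div_zero] at htau
    exact absurd htau (not_le.2 (pow_pos hr0 _))
  have hη1 : p.eta ≤ gap / 845 := heta
  have hn : ∀ x, NearStationary D P Ψ p.eta ((P ^ (2 * p.tau + 1)) x) := by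
    intro x
    refine NearStationary.of_mixing hc hm hη1 ?_ (pow_nonneg' hc _ x) (pow_row hc _ x)
      (hmixE (2 * p.tau) x)
    rw [le_div_iff₀ hCMpos] at htau
    -- The lag 2τ + 1 yields r^(2τ), of which only r^τ is needed.
    calc CP * r ^ (2 * p.tau) / √(⨅ x, D x) * specNorm Ψ * specNorm (1 - P)
        = r ^ (2 * p.tau) * constCM D P Ψ CP := by rw [constCM]; ring
      _ ≤ r ^ p.tau * constCM D P Ψ CP := by
          gcongr ?_ * _
          exact pow_le_pow_of_le_one hr0.le hr1.le (by omega)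
      _ ≤ _ := htau
  have hCPC : CP ≤ constCmax D P Ψ CP := le_max_left _ _
  have hCMC : constCM D P Ψ CP ≤ constCmax D P Ψ CP :=
    (le_max_left _ _).trans (le_max_right _ _)
  have hdens : CP * r ^ p.tau' ≤ ⨅ x, D x := by
    have := htau'.trans (min_le_left _ _)
    rwa [le_div_iff₀ hCP, mul_comm] at this
  have hq := htau'.trans (min_le_right _ _)
  have hcb : ∀ x, |costVec M x| ≤ cbar := fun x => hcbar x.1 x.2
  have hNpos : (0 : ℝ) < N := by exact_mod_cast hN
  have hNpos' : (0 : ℝ) < N' := by exact_mod_cast hN'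
  have hrhopos : ∀ k ∈ Finset.Icc 1 K, 0 < p.batchRho k := by
    intro k hk
    have : (0 : ℝ) < p.batchRho k := lt_of_lt_of_le (by positivity) (hbatchRho k hk)
    exact_mod_cast this
  constructor
  · have hKmem : K ∈ Finset.Icc 1 K := by simp; omega
    have h1 := rhoHat_sq_le (k := K) hX hc hmixE hCP.le hr0.le hr1.le (hq.trans
      (one_div_le_one_div_of_le (by positivity) (by linarith))) hcb hρ (hrhopos K hKmem)
    have h2 := hbatchRho K hKmem
    rw [Nat.sub_self, pow_zero, one_mul] at h2
    exact h1.trans (div_le_div_of_nonneg_left (by positivity) hNpos' h2)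
  · have hrec := le_of_epoch_recursion
      (e := fun k => pathMean ℙ X
        (fun x => featSq D Ψ (thetaHat p Ψ (costVec M) θ0 x k - θstar)))
      (W := constW D P Ψ (costVec M) θstar ρstar (fun x => basicQ M pol ν x + b))
      (R := 36 * cbar ^ 2 / (gap ^ 2 * μ)) (n := N) (n' := N') (K := K)
      (m := fun k => p.batch k) (m' := fun k => p.batchRho k) ?_ ?_ hNpos hNpos'
      (fun k hk => (le_max_right _ _).trans (hbatch k hk)) hbatchRho ?_
    · have e : ∀ θ : Fin d → ℝ, normSqD D (Ψ.mulVec θ - Ψ.mulVec θstar) =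
          featSq D Ψ (θ - θstar) := fun θ => by rw [featSq, Matrix.mulVec_sub]
      simp only [e]
      have h0 : pathMean ℙ X (fun x => featSq D Ψ (thetaHat p Ψ (costVec M) θ0 x 0 - θstar)) =
          featSq D Ψ (θ0 - θstar) := by
        simp only [thetaHat]
        exact pathMean_const _
      rw [h0] at hrec
      refine hrec.trans ?_
      have e1 : 3 * (36 * cbar ^ 2 / (gap ^ 2 * μ)) / (N' : ℝ) =
          108 * cbar ^ 2 / (N' * gap ^ 2 * μ) := by
        rw [mul_div_assoc', div_div]
        congr 1 <;> ring
      -- The recursion already gives the bound without this last term, which is added as slack.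
      have h3 : 0 ≤ 3 * cbar ^ 2 / (4 * (N' : ℝ)) := by positivity
      rw [e1]
      linarith
    · rw [constW, trace_noiseCov hc hindep hθstar, ← hμ, ← hgap]
      have h1 := pairMean_nonneg (p := D) (P := P) (fun x => (hc.pos x).le) hc.nonneg
        (f := fun x y => featSq D Ψ
          ((opMatrix D P Ψ)⁻¹.mulVec (stochOp Ψ (costVec M) θstar ρstar x y)))
        fun x y => featSq_nonneg hc.pos Ψ _
      have h2 := normSqD_nonneg hc.pos ((fun x => basicQ M pol ν x + b) - Ψ.mulVec θstar)
      have h3 := hm.mu_pos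
      positivity
    · have h3 := hm.mu_pos
      positivity
    · intro k hk
      have hmem : k + 1 ∈ Finset.Icc 1 K := by simp; omega
      rw [constW, trace_noiseCov hc hindep hθstar, ← hμ, ← hgap]
      exact epoch_le hX hc hmixE hCP.le hr0.le hr1.le hCMC hCPC hq hdens hψ hm hd hcb hρ hQ hθstar
        θ0 heta0 hη1 hn hT ((le_max_left _ _).trans (hbatch _ hmem)) (hrhopos _ hmem)
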